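/- **Conventions.** Let $k$ be a commutative ring and $\mathcal V_k$ the category of finitely generated projective $k$-modules. A *strict polynomial functor* $F$ assigns to each $V\in\mathcal V_k$ a $k$-module $F(V)$ and, for every commutative $k$-algebra $R$, to each $R$-linear map $f:R\otimes V\to R\otimes W$ an $R$-linear map $F(f):R\otimes F(V)\to R\otimes F(W)$, functorially and compatibly with extension of scalars. It is *homogeneous of weight $d$* if $F(rf)=r^dF(f)$ for all $r\in R$. A morphism $F\to G$ is a family of $k$-linear maps $F(V)\to G(V)$ which commutes with all the maps $F(f)$, $G(f)$. A *$\mathcal P_k$-cdga-algebra* $A=\{A_{i,d}\}_{i\in\mathbb Z,\,d\ge 0}$ consists of functors $A_{i,d}$ homogeneous of weight $d$, a unit $k\to A_{0,0}$, products $A_{i,d}\otimes A_{j,e}\to A_{i+j,d+e}$, differentials $A_{i,d}\to A_{i-1,d}$ and an augmentation $\epsilon:A\to k$ (zero outside $A_{0,0}$), all of them morphisms of strict polynomial functors, which make each $A(V)=\bigoplus_{i,d} A_{i,d}(V)$ a graded commutative augmented differential graded algebra ($xy=(-1)^{|x||y|}yx$). Morphisms preserve all this structure. A functor has *$k$-projective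 values* if all its values are projective $k$-modules; an algebra has $k$-projective values if all its components do. A *commutative exponential functor concentrated in degree $0$* is a family $E=\{E_d\}_{d\ge 0}$ of functors $E_d$ homogeneous of weight $d$, with values in $\mathcal V_k$, with a unit $k\to E_0$ and products $E_d\otimes E_e\to E_{d+e}$ (morphisms of strict polynomial functors) making each $E(V)=\bigoplus_d E_d(V)$ a commutative algebra, such that the unit $k\to E_0$ is an isomorphism and the composites $$E(V)\otimes E(W)\xrightarrow{E(\iota_V)\otimes E(\iota_W)}E(V\oplus W)^{\otimes 2}\xrightarrow{\ m\ }E(V\oplus W)$$ are isomorphisms for all $V,W\in\mathcal V_k$. It has a comultiplication $\Delta: E(V)\xrightarrow{E(x\mapsto(x,x))}E(V\oplus V)\simeq E(V)\otimes E(V)$, with components $E_{d+e}\to E_d\otimes E_e$, and a counit $E_0\simeq k$. The *convolution algebra* $\mathbb H(E,A)$ has as component of degree $i$ and weight $d$ the strict polynomial functor $V\mapsto \mathrm{Hom}(E_d,A_{i,d}(V\otimes-))$. Its product is $\varphi\star\psi=m\circ(\varphi\otimes\psi)\circ\Delta$, its differential is postcomposition with that of $A$, its unit is induced by the counit of $E$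 and the unit of $A$, and its augmentation by the unit of $E$ and the augmentation of $A$. The *reduced bar construction* of $A$ is $\overline BA=\bigoplus_{n\ge0}(A')^{\otimes n}$ with $A'=\ker\epsilon$; the element $[a_1|\dots|a_n]$ has degree $n+\sum|a_i|$ and weight $\sum w(a_i)$, and $$\partial[a_1|\dots|a_n]=\sum_{i=1}^{n-1}(-1)^{e_i}[a_1|\dots|a_ia_{i+1}|\dots|a_n]-\sum_{i=1}^n(-1)^{e_{i-1}}[a_1|\dots|\partial a_i|\dots|a_n],\qquad e_i=i+\sum_{j\le i}|a_j|.$$ Its product is the shuffle product: $[a_1|\dots|a_p]*[a_{p+1}|\dots|a_{p+q}]$ is the sum over all $(p,q)$-shuffles $\sigma$ of $\pm[a_{\sigma^{-1}(1)}|\dots|a_{\sigma^{-1}(p+q)}]$, where $\pm$ is the Koszul sign of the permutation of the letters $a_i$, the letter $a_i$ being counted with degree $|a_i|+1$. Unit and augmentation are the inclusion of, and the projection onto, $(A')^{\otimes 0}=k$. **Proposition (Interchange property).** Let $k$ be a commutative ring, let $E$ be a commutative exponential functor concentrated in degree $0$, and let $A$ be a $\mathcal P_k$-cdga-algebra. Assume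 that $A$ and $\mathbb H(E,A)$ have $k$-projective values. Then $\mathbb H(E,\overline BA)$ and $\overline B\,\mathbb H(E,A)$ are $\mathcal P_k$-cdga-algebras and there is an isomorphism of $\mathcal P_k$-cdga-algebras $$\mathbb H(E,\overline BA)\simeq\overline B\,\mathbb H(E,A),$$ natural with respect to morphisms between algebras $A$ satisfying these hypotheses. -/

import Mathlib

open scoped TensorProduct

universe u v v' w w'

noncomputable section

/-- Finitely generated projective `k`-modules: the objects of the category `V_k`. -/
structure FGProj (k : Type u) [CommRing k] where
  /-- the underlying module -/
  carrier : Type u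
  [addCommGroup : AddCommGroup carrier]
  [module : Module k carrier]
  [finite : Module.Finite k carrier]
  [projective : Module.Projective k carrier]

namespace FGProj

variable {k : Type u} [CommRing k]

instance : CoeSort (FGProj k) (Type u) := ⟨FGProj.carrier⟩

instance (V : FGProj k) : AddCommGroup V := V.addCommGroup
instance (V : FGProj k) : Module k V := V.module
instance (V : FGProj k) : Module.Finite k V := V.finite
instance (V : FGProj k) : Module.Projective k V := V.projective

/-- The ground ring as an object of `V_k`. -/
@[reducible] def unit (k : Type u) [CommRing k] : FGProj k := ⟨k⟩

/-- The tensor product in `V_k`. -/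
@[reducible] def tensor (V W : FGProj k) : FGProj k := ⟨V ⊗[k] W⟩

/-- The direct sum in `V_k`. -/
@[reducible] def prod (V W : FGProj k) : FGProj k := ⟨V × W⟩

end FGProj

section BaseChange

variable {k : Type u} [CommRing k] {R : Type u} [CommRing R] [Algebra k R]
  {M M' M'' N N' N'' : Type*} [AddCommGroup M] [AddCommGroup M'] [AddCommGroup M'']
  [AddCommGroup N] [AddCommGroup N'] [AddCommGroup N'']
  [Module k M'] [Module k M''] [Module k N'] [Module k N''] [Module k M] [Module k N]

/-- The extension of scalars `R ⊗ M → S ⊗ M` along a morphism of `k`-algebras `ρ : R → S`. -/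
abbrev extScalars {S : Type u} [CommRing S] [Algebra k S] (ρ : R →ₐ[k] S)
    (M : Type*) [AddCommGroup M] [Module k M] : R ⊗[k] M →ₗ[k] S ⊗[k] M :=
  LinearMap.rTensor M ρ.toLinearMap

/-- The tensor product over `R` of two `R`-linear maps `R ⊗ M → R ⊗ M'` and `R ⊗ N → R ⊗ N'`,
transported along the canonical isomorphisms `R ⊗ (M ⊗ N) ≃ (R ⊗ M) ⊗_R (R ⊗ N)`. -/
def bcTensor (f : R ⊗[k] M →ₗ[R] R ⊗[k] M') (g : R ⊗[k] N →ₗ[R] R ⊗[k] N') :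
    R ⊗[k] (M ⊗[k] N) →ₗ[R] R ⊗[k] (M' ⊗[k] N') :=
  (TensorProduct.AlgebraTensorModule.distribBaseChange k R M' N').symm.toLinearMap ∘ₗ
    TensorProduct.map f g ∘ₗ
      (TensorProduct.AlgebraTensorModule.distribBaseChange k R M N).toLinearMap

theorem bcTensor_tmul (f : R ⊗[k] M →ₗ[R] R ⊗[k] M') (g : R ⊗[k] N →ₗ[R] R ⊗[k] N')
    (r : R) (m : M) (n : N) :
    bcTensor f g (r ⊗ₜ (m ⊗ₜ n)) =
      (TensorProduct.AlgebraTensorModule.distribBaseChange k R M' N').symm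
        (f (r ⊗ₜ m) ⊗ₜ g (1 ⊗ₜ n)) := by
  simp [bcTensor]

theorem bcTensor_id :
    bcTensor (LinearMap.id : R ⊗[k] M →ₗ[R] R ⊗[k] M) (LinearMap.id : R ⊗[k] N →ₗ[R] R ⊗[k] N)
      = LinearMap.id := by
  ext; simp [bcTensor]

theorem bcTensor_comp (f' : R ⊗[k] M' →ₗ[R] R ⊗[k] M'') (f : R ⊗[k] M →ₗ[R] R ⊗[k] M')
    (g' : R ⊗[k] N' →ₗ[R] R ⊗[k] N'') (g : R ⊗[k] N →ₗ[R] R ⊗[k] N') :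
    bcTensor (f' ∘ₗ f) (g' ∘ₗ g) = bcTensor f' g' ∘ₗ bcTensor f g := by
  apply LinearMap.ext
  intro x
  simp [bcTensor, TensorProduct.map_comp]

theorem bcTensor_smul (a b : R) (f : R ⊗[k] M →ₗ[R] R ⊗[k] M')
    (g : R ⊗[k] N →ₗ[R] R ⊗[k] N') :
    bcTensor (a • f) (b • g) = (a * b) • bcTensor f g := by
  apply LinearMap.ext
  intro x
  simp only [bcTensor, TensorProduct.map_smul_left, TensorProduct.map_smul_right,
    LinearMap.comp_apply, LinearMap.smul_apply, LinearEquiv.coe_coe, map_smul, mul_smul]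
  rw [smul_comm]

theorem extScalars_smul {S : Type u} [CommRing S] [Algebra k S] (ρ : R →ₐ[k] S) (r : R)
    (x : R ⊗[k] M) : extScalars ρ M (r • x) = ρ r • extScalars ρ M x := by
  induction x with
  | zero => simp
  | tmul a m => simp [extScalars, TensorProduct.smul_tmul']
  | add x y hx hy => simp only [smul_add, map_add, hx, hy]

theorem distrib_symm_tmul (a b : R) (m : M) (n : N) :
    (TensorProduct.AlgebraTensorModule.distribBaseChange k R M N).symm
      ((a ⊗ₜ m) ⊗ₜ (b ⊗ₜ n)) = (a * b) ⊗ₜ (m ⊗ₜ n) := by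
  rw [LinearEquiv.symm_apply_eq, TensorProduct.AlgebraTensorModule.distribBaseChange_tmul]
  have : (b ⊗ₜ[k] n) = b • ((1 : R) ⊗ₜ[k] n) := by simp [TensorProduct.smul_tmul']
  rw [this, TensorProduct.tmul_smul, TensorProduct.smul_tmul', TensorProduct.smul_tmul',
    smul_eq_mul, mul_comm]

theorem extScalars_distrib_symm {S : Type u} [CommRing S] [Algebra k S] (ρ : R →ₐ[k] S)
    (x : R ⊗[k] M) (y : R ⊗[k] N) :
    extScalars ρ (M ⊗[k] N)
        ((TensorProduct.AlgebraTensorModule.distribBaseChange k R M N).symm (x ⊗ₜ y)) =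
      (TensorProduct.AlgebraTensorModule.distribBaseChange k S M N).symm
        (extScalars ρ M x ⊗ₜ extScalars ρ N y) := by
  induction x with
  | zero => simp
  | add x x' hx hx' => simp only [TensorProduct.add_tmul, map_add, hx, hx']
  | tmul a m =>
    induction y with
    | zero => simp
    | add x x' hx hx' => simp only [TensorProduct.tmul_add, map_add, hx, hx']
    | tmul b n =>
      rw [distrib_symm_tmul]
      simp [extScalars, distrib_symm_tmul]

theorem bcTensor_extScalars {S : Type u} [CommRing S] [Algebra k S] (ρ : R →ₐ[k] S)
    {f : R ⊗[k] M →ₗ[R] R ⊗[k] M'} {f' : S ⊗[k] M →ₗ[S] S ⊗[k] M'}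
    {g : R ⊗[k] N →ₗ[R] R ⊗[k] N'} {g' : S ⊗[k] N →ₗ[S] S ⊗[k] N'}
    (hf : ∀ x, f' (extScalars ρ M x) = extScalars ρ M' (f x))
    (hg : ∀ x, g' (extScalars ρ N x) = extScalars ρ N' (g x)) (x : R ⊗[k] (M ⊗[k] N)) :
    bcTensor f' g' (extScalars ρ _ x) = extScalars ρ _ (bcTensor f g x) := by
  induction x with
  | zero => simp
  | add x y hx hy => simp only [map_add, hx, hy]
  | tmul r t =>
    induction t with
    | zero => simp
    | add x y hx hy => simp only [TensorProduct.tmul_add, map_add, hx, hy]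
    | tmul m n =>
      rw [bcTensor_tmul, extScalars_distrib_symm, ← hf, ← hg]
      simp [extScalars, bcTensor_tmul]

/-- The element `x ⊗ y` of `R ⊗ (M ⊗ N)`, for `x` in `R ⊗ M` and `y` in `R ⊗ N`. -/
abbrev bcMul (x : R ⊗[k] M) (y : R ⊗[k] N) : R ⊗[k] (M ⊗[k] N) :=
  (TensorProduct.AlgebraTensorModule.distribBaseChange k R M N).symm (x ⊗ₜ y)

theorem bcTensor_bcMul (f : R ⊗[k] M →ₗ[R] R ⊗[k] M') (g : R ⊗[k] N →ₗ[R] R ⊗[k] N')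
    (x : R ⊗[k] M) (y : R ⊗[k] N) : bcTensor f g (bcMul x y) = bcMul (f x) (g y) := by
  simp [bcTensor, bcMul]

theorem bcMul_induction {P : R ⊗[k] (M ⊗[k] N) → Prop} (h0 : P 0)
    (hadd : ∀ x y, P x → P y → P (x + y)) (h : ∀ x y, P (bcMul x y)) (x) : P x := by
  induction x with
  | zero => exact h0
  | add x y hx hy => exact hadd _ _ hx hy
  | tmul r m =>
    induction m with
    | zero => simpa using h0
    | add x y hx hy => rw [TensorProduct.tmul_add]; exact hadd _ _ hx hy
    | tmul m n =>
      have := h (r ⊗ₜ m) (1 ⊗ₜ n)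
      rwa [bcMul, distrib_symm_tmul, mul_one] at this

theorem bcMul_add_left (x x' : R ⊗[k] M) (y : R ⊗[k] N) :
    bcMul (x + x') y = bcMul x y + bcMul x' y := by
  rw [bcMul, TensorProduct.add_tmul, map_add]

theorem bcMul_add_right (x : R ⊗[k] M) (y y' : R ⊗[k] N) :
    bcMul x (y + y') = bcMul x y + bcMul x y' := by
  rw [bcMul, TensorProduct.tmul_add, map_add]

theorem bcMul_zero_left (y : R ⊗[k] N) : bcMul (0 : R ⊗[k] M) y = 0 := by
  rw [bcMul, TensorProduct.zero_tmul, map_zero]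

theorem bcMul_zero_right (x : R ⊗[k] M) : bcMul x (0 : R ⊗[k] N) = 0 := by
  rw [bcMul, TensorProduct.tmul_zero, map_zero]

theorem assoc_bcMul (x : R ⊗[k] M) (y : R ⊗[k] M') (z : R ⊗[k] M'') :
    (TensorProduct.assoc k M M' M'').toLinearMap.baseChange R (bcMul (bcMul x y) z) =
      bcMul x (bcMul y z) := by
  induction x with
  | zero => simp only [bcMul_zero_left, map_zero]
  | add x x' hx hx' => simp only [bcMul_add_left, map_add, hx, hx']
  | tmul a m =>
  induction y with
  | zero => simp only [bcMul_zero_left, bcMul_zero_right, map_zero]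
  | add x x' hx hx' => simp only [bcMul_add_left, bcMul_add_right, map_add, hx, hx']
  | tmul b n =>
  induction z with
  | zero => simp only [bcMul_zero_right, map_zero]
  | add x x' hx hx' => simp only [bcMul_add_right, map_add, hx, hx']
  | tmul c p => simp [bcMul, distrib_symm_tmul, mul_assoc]

theorem comm_bcMul (x : R ⊗[k] M) (y : R ⊗[k] N) :
    (TensorProduct.comm k M N).toLinearMap.baseChange R (bcMul x y) = bcMul y x := by
  induction x with
  | zero => simp only [bcMul_zero_left, bcMul_zero_right, map_zero]
  | add x x' hx hx' => simp only [bcMul_add_left, bcMul_add_right, map_add, hx, hx']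
  | tmul a m =>
  induction y with
  | zero => simp only [bcMul_zero_left, bcMul_zero_right, map_zero]
  | add x x' hx hx' => simp only [bcMul_add_left, bcMul_add_right, map_add, hx, hx']
  | tmul b n => simp [bcMul, distrib_symm_tmul, mul_comm]

end BaseChange

/-- A strict polynomial functor over `k`, described by its base changes: every finitely generated
projective `V` is sent to a `k`-module `obj V`, and for every commutative `k`-algebra `R`, every
`R`-linear map `R ⊗ V → R ⊗ W` is sent to an `R`-linear map `R ⊗ obj V → R ⊗ obj W`, functorially
and compatibly with extension of scalars. (So `Hom(V, W) → Hom(obj V, obj W)` is a polynomial law.)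
Boundedness of the degree is ensured below by `IsHomogeneous`. -/
structure PolyFunctor (k : Type u) [CommRing k] where
  obj : FGProj k → Type v
  [addCommGroup : ∀ V, AddCommGroup (obj V)]
  [module : ∀ V, Module k (obj V)]
  map : ∀ (R : Type u) [CommRing R] [Algebra k R] {V W : FGProj k},
    (R ⊗[k] V →ₗ[R] R ⊗[k] W) → (R ⊗[k] obj V →ₗ[R] R ⊗[k] obj W)
  map_id : ∀ (R : Type u) [CommRing R] [Algebra k R] (V : FGProj k),
    map R (LinearMap.id : R ⊗[k] V →ₗ[R] R ⊗[k] V) = LinearMap.id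
  map_comp : ∀ (R : Type u) [CommRing R] [Algebra k R] {U V W : FGProj k}
    (g : R ⊗[k] V →ₗ[R] R ⊗[k] W) (f : R ⊗[k] U →ₗ[R] R ⊗[k] V),
    map R (g ∘ₗ f) = map R g ∘ₗ map R f
  map_extScalars : ∀ {R S : Type u} [CommRing R] [Algebra k R] [CommRing S] [Algebra k S]
    (ρ : R →ₐ[k] S) {V W : FGProj k} (f : R ⊗[k] V →ₗ[R] R ⊗[k] W)
    (g : S ⊗[k] V →ₗ[S] S ⊗[k] W),
    (∀ x, g (extScalars ρ V x) = extScalars ρ W (f x)) →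
    ∀ x, map S g (extScalars ρ (obj V) x) = extScalars ρ (obj W) (map R f x)

namespace PolyFunctor

attribute [instance] PolyFunctor.addCommGroup PolyFunctor.module

variable {k : Type u} [CommRing k]

/-- `F` is homogeneous of weight `d`. -/
def IsHomogeneous (F : PolyFunctor.{u, v} k) (d : ℕ) : Prop :=
  ∀ (R : Type u) [CommRing R] [Algebra k R] (V W : FGProj k) (r : R)
    (f : R ⊗[k] V →ₗ[R] R ⊗[k] W), F.map R (r • f) = r ^ d • F.map R f

/-- The morphisms of strict polynomial functors, as a submodule of all families of linear maps. -/
def homSubmodule (F : PolyFunctor.{u, v} k) (G : PolyFunctor.{u, w} k) :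
    Submodule k (∀ V : FGProj k, F.obj V →ₗ[k] G.obj V) where
  carrier := {φ | ∀ (R : Type u) [CommRing R] [Algebra k R] (V W : FGProj k)
    (f : R ⊗[k] V →ₗ[R] R ⊗[k] W),
    (φ W).baseChange R ∘ₗ F.map R f = G.map R f ∘ₗ (φ V).baseChange R}
  add_mem' := by
    intro φ ψ hφ hψ R _ _ V W f
    simp only [Pi.add_apply, LinearMap.baseChange_add, LinearMap.add_comp, LinearMap.comp_add,
      hφ R V W f, hψ R V W f]
  zero_mem' := by
    intro R _ _ V W f
    simp
  smul_mem' := by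
    intro c φ hφ R _ _ V W f
    simp only [Pi.smul_apply, LinearMap.baseChange_smul]
    rw [LinearMap.smul_comp, hφ R V W f, LinearMap.comp_smul]

/-- The `k`-module of morphisms of strict polynomial functors. -/
abbrev Hom (F : PolyFunctor.{u, v} k) (G : PolyFunctor.{u, w} k) : Type (max (u + 1) v w) :=
  homSubmodule F G

namespace Hom

variable {H : PolyFunctor.{u, w'} k} {F : PolyFunctor.{u, v} k} {G : PolyFunctor.{u, w} k}

/-- The component at `V`. -/
def app (φ : Hom F G) (V : FGProj k) : F.obj V →ₗ[k] G.obj V := φ.1 V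

theorem naturality (φ : Hom F G) (R : Type u) [CommRing R] [Algebra k R] {V W : FGProj k}
    (f : R ⊗[k] V →ₗ[R] R ⊗[k] W) :
    (φ.app W).baseChange R ∘ₗ F.map R f = G.map R f ∘ₗ (φ.app V).baseChange R := φ.2 R V W f

theorem naturality_apply (φ : Hom F G) (R : Type u) [CommRing R] [Algebra k R] {V W : FGProj k}
    (f : R ⊗[k] V →ₗ[R] R ⊗[k] W) (x : R ⊗[k] F.obj V) :
    (φ.app W).baseChange R (F.map R f x) = G.map R f ((φ.app V).baseChange R x) :=
  LinearMap.congr_fun (φ.naturality R f) x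

@[ext] theorem ext {φ ψ : Hom F G} (h : ∀ V x, φ.app V x = ψ.app V x) : φ = ψ :=
  Subtype.ext (funext fun V => LinearMap.ext (h V))

@[simp] theorem add_app (φ ψ : Hom F G) (V : FGProj k) : (φ + ψ).app V = φ.app V + ψ.app V := rfl
@[simp] theorem smul_app (c : k) (φ : Hom F G) (V : FGProj k) : (c • φ).app V = c • φ.app V := rfl

/-- The identity morphism. -/
def id (F : PolyFunctor.{u, v} k) : Hom F F :=
  ⟨fun _ => LinearMap.id, fun R _ _ V W f => by simp⟩

/-- Composition of morphisms, `k`-bilinear. -/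
def comp : Hom G H →ₗ[k] Hom F G →ₗ[k] Hom F H :=
  LinearMap.mk₂ k
    (fun ψ φ => ⟨fun V => ψ.app V ∘ₗ φ.app V, fun R _ _ V W f => by
      rw [LinearMap.baseChange_comp, LinearMap.comp_assoc, φ.naturality, ← LinearMap.comp_assoc,
        ψ.naturality, LinearMap.comp_assoc, ← LinearMap.baseChange_comp]⟩)
    (fun _ _ _ => by ext; rfl)
    (fun _ _ _ => by ext; rfl)
    (fun _ _ _ => by ext V x; exact (Hom.app _ V).map_add _ _)
    (fun c _ _ => by ext V x; exact (Hom.app _ V).map_smul c _)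

@[simp] theorem id_app (V : FGProj k) (x : F.obj V) : (Hom.id F).app V x = x := rfl
@[simp] theorem comp_app (ψ : Hom G H) (φ : Hom F G) (V : FGProj k) (x : F.obj V) :
    (comp ψ φ).app V x = ψ.app V (φ.app V x) := rfl

end Hom

/-- The constant functor with value `k` (the unit of the tensor product). -/
@[reducible] def const (k : Type u) [CommRing k] : PolyFunctor.{u, u} k where
  obj _ := k
  map R _ _ _ _ _ := LinearMap.id
  map_id _ _ _ _ := rfl
  map_comp _ _ _ _ _ _ _ _ := rfl
  map_extScalars _ _ _ _ _ _ _ := rfl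

/-- The tensor product `(F ⊗ G)(V) = F(V) ⊗ G(V)`. -/
@[reducible] def tensor (F : PolyFunctor.{u, v} k) (G : PolyFunctor.{u, w} k) :
    PolyFunctor.{u, max v w} k where
  obj V := F.obj V ⊗[k] G.obj V
  map R _ _ _ _ f := bcTensor (F.map R f) (G.map R f)
  map_id R _ _ V := by rw [F.map_id, G.map_id, bcTensor_id]
  map_comp R _ _ _ _ _ g f := by rw [F.map_comp, G.map_comp, bcTensor_comp]
  map_extScalars ρ _ _ f g h :=
    bcTensor_extScalars ρ (F.map_extScalars ρ f g h) (G.map_extScalars ρ f g h)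

/-- The `R`-linear map `R ⊗ ⨁ Mᵢ → R ⊗ ⨁ Nᵢ` given by `R`-linear maps `R ⊗ Mᵢ → R ⊗ Nᵢ`. -/
def bcSum {ι : Type w} [DecidableEq ι] (R : Type u) [CommRing R] [Algebra k R]
    {M N : ι → Type v} [∀ i, AddCommGroup (M i)] [∀ i, AddCommGroup (N i)]
    [∀ i, Module k (M i)] [∀ i, Module k (N i)] (f : ∀ i, R ⊗[k] M i →ₗ[R] R ⊗[k] N i) :
    R ⊗[k] (DirectSum ι M) →ₗ[R] R ⊗[k] (DirectSum ι N) :=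
  LinearMap.liftBaseChange R (DirectSum.toModule k ι _ fun i =>
    ((DirectSum.lof k ι N i).baseChange R).restrictScalars k ∘ₗ
      (f i).restrictScalars k ∘ₗ TensorProduct.mk k R (M i) 1)

theorem bcSum_lof {ι : Type w} [DecidableEq ι] (R : Type u) [CommRing R] [Algebra k R]
    {M N : ι → Type v} [∀ i, AddCommGroup (M i)] [∀ i, AddCommGroup (N i)]
    [∀ i, Module k (M i)] [∀ i, Module k (N i)] (f : ∀ i, R ⊗[k] M i →ₗ[R] R ⊗[k] N i)
    (i : ι) (x : R ⊗[k] M i) :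
    bcSum R f ((DirectSum.lof k ι M i).baseChange R x) =
      (DirectSum.lof k ι N i).baseChange R (f i x) := by
  induction x with
  | zero => simp
  | add x y hx hy => simp only [map_add, hx, hy]
  | tmul r m =>
    rw [LinearMap.baseChange_tmul, bcSum, LinearMap.liftBaseChange_tmul, DirectSum.toModule_lof]
    simp only [LinearMap.comp_apply, LinearMap.restrictScalars_apply, TensorProduct.mk_apply]
    rw [← map_smul, ← map_smul, TensorProduct.smul_tmul', smul_eq_mul, mul_one]

theorem bcSum_induction {ι : Type w} [DecidableEq ι] {R : Type u} [CommRing R] [Algebra k R]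
    {M : ι → Type v} [∀ i, AddCommGroup (M i)] [∀ i, Module k (M i)]
    {P : R ⊗[k] (DirectSum ι M) → Prop} (h0 : P 0) (hadd : ∀ x y, P x → P y → P (x + y))
    (h : ∀ i x, P ((DirectSum.lof k ι M i).baseChange R x)) (x : R ⊗[k] (DirectSum ι M)) : P x := by
  induction x with
  | zero => exact h0
  | add x y hx hy => exact hadd _ _ hx hy
  | tmul r m =>
    induction m using DirectSum.induction_on with
    | zero => simpa using h0
    | add x y hx hy => rw [TensorProduct.tmul_add]; exact hadd _ _ hx hy
    | of i m => exact h i (r ⊗ₜ m)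

/-- The direct sum of a family of functors. -/
@[reducible] def directSum {ι : Type w} [DecidableEq ι] (F : ι → PolyFunctor.{u, v} k) :
    PolyFunctor.{u, max w v} k where
  obj V := DirectSum ι fun i => (F i).obj V
  map R _ _ V W f := bcSum R fun i => (F i).map R f
  map_id R _ _ V := by
    apply LinearMap.ext
    intro x
    induction x using bcSum_induction with
    | h0 => simp
    | hadd x y hx hy => rw [map_add, hx, hy, map_add]
    | h i x => rw [bcSum_lof, (F i).map_id]; rfl
  map_comp R _ _ _ _ _ g f := by
    apply LinearMap.ext
    intro x
    induction x using bcSum_induction with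
    | h0 => simp
    | hadd x y hx hy => rw [map_add, hx, hy, map_add]
    | h i x => rw [LinearMap.comp_apply, bcSum_lof, bcSum_lof, bcSum_lof, (F i).map_comp]; rfl
  map_extScalars {R S} _ _ _ _ ρ V W f g h x := by
    have key : ∀ (U : FGProj k) (i : ι) (x : R ⊗[k] (F i).obj U),
        extScalars ρ _ ((DirectSum.lof k ι (fun i => (F i).obj U) i).baseChange R x) =
          (DirectSum.lof k ι (fun i => (F i).obj U) i).baseChange S (extScalars ρ _ x) := by
      intro U i x
      induction x with
      | zero => simp
      | add x y hx hy => simp only [map_add, hx, hy]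
      | tmul r m => simp [extScalars]
    induction x using bcSum_induction with
    | h0 => simp
    | hadd x y hx hy => simp only [map_add, hx, hy]
    | h i x => rw [bcSum_lof, key, bcSum_lof, key, (F i).map_extScalars ρ f g h]

/-- The inclusion of a summand. -/
def directSumι {ι : Type w} [DecidableEq ι] (F : ι → PolyFunctor.{u, v} k) (i : ι) :
    Hom (F i) (directSum F) :=
  ⟨fun V => DirectSum.lof k ι (fun i => (F i).obj V) i, fun R _ _ V W f => by
    apply LinearMap.ext
    intro x
    exact (bcSum_lof R (fun i => (F i).map R f) i x).symm⟩

/-- The morphism out of a direct sum given by its restrictions to the summands. -/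
def directSumDesc {ι : Type w} [DecidableEq ι] {F : ι → PolyFunctor.{u, v} k}
    {G : PolyFunctor.{u, w'} k} (φ : ∀ i, Hom (F i) G) : Hom (directSum F) G :=
  ⟨fun V => DirectSum.toModule k ι _ fun i => (φ i).app V, fun R _ _ V W f => by
    have key : ∀ (U : FGProj k) (i : ι) (x : R ⊗[k] (F i).obj U),
        (DirectSum.toModule k ι _ fun i => (φ i).app U).baseChange R
          ((DirectSum.lof k ι (fun i => (F i).obj U) i).baseChange R x) =
          ((φ i).app U).baseChange R x := by
      intro U i x
      rw [← LinearMap.comp_apply, ← LinearMap.baseChange_comp]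
      congr 2
      ext m
      simp
    apply LinearMap.ext
    intro x
    induction x using bcSum_induction with
    | h0 => rw [map_zero, map_zero]
    | hadd x y hx hy => rw [map_add, hx, hy, map_add]
    | h i x =>
      rw [LinearMap.comp_apply, LinearMap.comp_apply, key, ← (φ i).naturality_apply, ← key W,
        bcSum_lof]⟩

/-- The tensor product of two morphisms. -/
def tensorHom {F : PolyFunctor.{u, v} k} {F' : PolyFunctor.{u, v'} k} {G : PolyFunctor.{u, w} k}
    {G' : PolyFunctor.{u, w'} k} (φ : Hom F F') (ψ : Hom G G') :
    Hom (tensor F G) (tensor F' G') :=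
  ⟨fun V => TensorProduct.map (φ.app V) (ψ.app V), fun R _ _ V W f => by
    have key : ∀ U, (TensorProduct.map (φ.app U) (ψ.app U)).baseChange R =
        bcTensor ((φ.app U).baseChange R) ((ψ.app U).baseChange R) := by
      intro U
      ext
      simp [bcTensor]
    change _ ∘ₗ bcTensor _ _ = bcTensor _ _ ∘ₗ _
    rw [key, key, ← bcTensor_comp, ← bcTensor_comp, φ.naturality, ψ.naturality]⟩

/-- The associativity isomorphism `(F ⊗ G) ⊗ H → F ⊗ (G ⊗ H)`. -/
def tensorAssoc (F : PolyFunctor.{u, v} k) (G : PolyFunctor.{u, w} k) (H : PolyFunctor.{u, w'} k) :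
    Hom (tensor (tensor F G) H) (tensor F (tensor G H)) :=
  ⟨fun V => (TensorProduct.assoc k (F.obj V) (G.obj V) (H.obj V)).toLinearMap,
    fun R _ _ V W f => by
      apply LinearMap.ext
      intro t
      induction t using bcMul_induction with
      | h0 => rw [map_zero, map_zero]
      | hadd x y hx hy => rw [map_add, hx, hy, map_add]
      | h s z =>
      induction s using bcMul_induction with
      | h0 => rw [bcMul_zero_left, map_zero, map_zero]
      | hadd x y hx hy => rw [bcMul_add_left, map_add, hx, hy, map_add]
      | h x y =>
        simp only [LinearMap.comp_apply, bcTensor_bcMul, assoc_bcMul]⟩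

/-- The inverse associativity isomorphism. -/
def tensorAssocInv (F : PolyFunctor.{u, v} k) (G : PolyFunctor.{u, w} k)
    (H : PolyFunctor.{u, w'} k) : Hom (tensor F (tensor G H)) (tensor (tensor F G) H) :=
  ⟨fun V => (TensorProduct.assoc k (F.obj V) (G.obj V) (H.obj V)).symm.toLinearMap,
    fun R _ _ V W f => by
      have key : ∀ (U : FGProj k) (x : R ⊗[k] F.obj U) (y : R ⊗[k] G.obj U) (z : R ⊗[k] H.obj U),
          (TensorProduct.assoc k (F.obj U) (G.obj U) (H.obj U)).symm.toLinearMap.baseChange R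
            (bcMul x (bcMul y z)) = bcMul (bcMul x y) z := by
        intro U x y z
        rw [← assoc_bcMul, ← LinearMap.comp_apply, ← LinearMap.baseChange_comp]
        simp
      apply LinearMap.ext
      intro t
      induction t using bcMul_induction with
      | h0 => rw [map_zero, map_zero]
      | hadd x y hx hy => rw [map_add, hx, hy, map_add]
      | h x s =>
      induction s using bcMul_induction with
      | h0 => rw [bcMul_zero_right, map_zero, map_zero]
      | hadd x y hx hy => rw [bcMul_add_right, map_add, hx, hy, map_add]
      | h y z =>
        simp only [LinearMap.comp_apply, bcTensor_bcMul, key]⟩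

/-- The symmetry isomorphism `F ⊗ G → G ⊗ F`, without sign. -/
def tensorComm (F : PolyFunctor.{u, v} k) (G : PolyFunctor.{u, w} k) :
    Hom (tensor F G) (tensor G F) :=
  ⟨fun V => (TensorProduct.comm k (F.obj V) (G.obj V)).toLinearMap, fun R _ _ V W f => by
    apply LinearMap.ext
    intro t
    induction t using bcMul_induction with
    | h0 => rw [map_zero, map_zero]
    | hadd x y hx hy => rw [map_add, hx, hy, map_add]
    | h x y => simp only [LinearMap.comp_apply, bcTensor_bcMul, comm_bcMul]⟩

/-- The isomorphism `k ⊗ F → F`. -/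
def tensorLid (F : PolyFunctor.{u, v} k) : Hom (tensor (const k) F) F :=
  ⟨fun V => (TensorProduct.lid k (F.obj V)).toLinearMap, fun R _ _ V W f => by
    have key : ∀ (U : FGProj k) (r : R) (c : k) (x : R ⊗[k] F.obj U),
        (TensorProduct.lid k (F.obj U)).toLinearMap.baseChange R (bcMul (r ⊗ₜ[k] c) x) =
          (c • r) • x := by
      intro U r c x
      induction x with
      | zero => rw [bcMul_zero_right, map_zero, smul_zero]
      | add x y hx hy => rw [bcMul_add_right, map_add, hx, hy, smul_add]
      | tmul s m =>
        simp [bcMul, distrib_symm_tmul, TensorProduct.smul_tmul', ← TensorProduct.smul_tmul]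
    apply LinearMap.ext
    intro t
    induction t using bcMul_induction with
    | h0 => rw [map_zero, map_zero]
    | hadd x y hx hy => rw [map_add, hx, hy, map_add]
    | h c x =>
      induction c with
      | zero => rw [bcMul_zero_left, map_zero, map_zero]
      | add x y hx hy => rw [bcMul_add_left, map_add, hx, hy, map_add]
      | tmul r c =>
        rw [LinearMap.comp_apply, bcTensor_bcMul, LinearMap.id_apply, key, LinearMap.comp_apply,
          key, map_smul]⟩

/-- The morphism out of `F ⊗ ⨁ Gᵢ` given by morphisms out of the `F ⊗ Gᵢ`. -/
def tensorSumDesc {ι : Type w} [DecidableEq ι] {F : PolyFunctor.{u, v'} k}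
    {G : ι → PolyFunctor.{u, v} k} {H : PolyFunctor.{u, w'} k} (φ : ∀ i, Hom (tensor F (G i)) H) :
    Hom (tensor F (directSum G)) H :=
  ⟨fun V => TensorProduct.lift (LinearMap.flip (DirectSum.toModule k ι _ fun i =>
      LinearMap.flip (TensorProduct.curry ((φ i).app V)))), fun R _ _ V W f => by
    have key : ∀ (U : FGProj k) (i : ι) (x : R ⊗[k] F.obj U) (y : R ⊗[k] (G i).obj U),
        (TensorProduct.lift (LinearMap.flip (DirectSum.toModule k ι _ fun i =>
          LinearMap.flip (TensorProduct.curry ((φ i).app U))))).baseChange R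
          (bcMul x ((DirectSum.lof k ι (fun i => (G i).obj U) i).baseChange R y)) =
          ((φ i).app U).baseChange R (bcMul x y) := by
      intro U i x y
      induction x with
      | zero => simp only [bcMul_zero_left, map_zero]
      | add x x' hx hx' => simp only [bcMul_add_left, map_add, hx, hx']
      | tmul a m =>
      induction y with
      | zero => simp only [bcMul_zero_right, map_zero]
      | add x x' hx hx' => simp only [bcMul_add_right, map_add, hx, hx']
      | tmul b n => simp [bcMul, distrib_symm_tmul]
    apply LinearMap.ext
    intro t
    induction t using bcMul_induction with
    | h0 => rw [map_zero, map_zero]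
    | hadd x y hx hy => rw [map_add, hx, hy, map_add]
    | h x s =>
    induction s using bcSum_induction with
    | h0 => rw [bcMul_zero_right, map_zero, map_zero]
    | hadd x y hx hy => rw [bcMul_add_right, map_add, hx, hy, map_add]
    | h i y =>
      rw [LinearMap.comp_apply, LinearMap.comp_apply, bcTensor_bcMul, bcSum_lof, key, key,
        ← (φ i).naturality_apply, bcTensor_bcMul]⟩

/-- The kernel of a morphism `ε : F → G`, when the inclusion of the kernel has a natural
retraction (`q` is an endomorphism of `F` with image `ker ε` which is the identity on `ker ε`). -/
@[reducible] def splitKer {F : PolyFunctor.{u, v} k} {G : PolyFunctor.{u, w} k} (ε : Hom F G)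
    (q : Hom F F) (hq : ∀ V x, ε.app V (q.app V x) = 0)
    (hq' : ∀ V x, ε.app V x = 0 → q.app V x = x) : PolyFunctor.{u, v} k where
  obj V := LinearMap.ker (ε.app V)
  map R _ _ V W f :=
    ((q.app W).codRestrict (LinearMap.ker (ε.app W)) fun x => hq W x).baseChange R ∘ₗ
      F.map R f ∘ₗ (LinearMap.ker (ε.app V)).subtype.baseChange R
  map_id R _ _ V := by
    rw [F.map_id, LinearMap.id_comp, ← LinearMap.baseChange_comp, ← LinearMap.baseChange_id]
    congr 1
    ext x
    exact hq' V x x.2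
  map_comp R _ _ U V W g f := by
    have h : (LinearMap.ker (ε.app V)).subtype.baseChange R ∘ₗ
        ((q.app V).codRestrict (LinearMap.ker (ε.app V)) fun x => hq V x).baseChange R =
        (q.app V).baseChange R := by
      rw [← LinearMap.baseChange_comp]; rfl
    have h' : (q.app U).baseChange R ∘ₗ (LinearMap.ker (ε.app U)).subtype.baseChange R =
        (LinearMap.ker (ε.app U)).subtype.baseChange R := by
      rw [← LinearMap.baseChange_comp]
      congr 1
      ext x
      exact hq' U x x.2
    calc _ = ((q.app W).codRestrict (LinearMap.ker (ε.app W)) fun x => hq W x).baseChange R ∘ₗ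
          F.map R g ∘ₗ F.map R f ∘ₗ (q.app U).baseChange R ∘ₗ
            (LinearMap.ker (ε.app U)).subtype.baseChange R := by
          rw [h', F.map_comp]; rfl
      _ = ((q.app W).codRestrict (LinearMap.ker (ε.app W)) fun x => hq W x).baseChange R ∘ₗ
          F.map R g ∘ₗ ((q.app V).baseChange R ∘ₗ F.map R f) ∘ₗ
            (LinearMap.ker (ε.app U)).subtype.baseChange R := by
          rw [q.naturality]; rfl
      _ = _ := by rw [← h]; rfl
  map_extScalars {R S} _ _ _ _ ρ V W f g h x := by
    have nat : ∀ {M N : Type v} [AddCommGroup M] [AddCommGroup N] [Module k M] [Module k N]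
        (l : M →ₗ[k] N) (x : R ⊗[k] M),
        l.baseChange S (extScalars ρ M x) = extScalars ρ N (l.baseChange R x) := by
      intro M N _ _ _ _ l x
      induction x with
      | zero => simp
      | add x y hx hy => simp only [map_add, hx, hy]
      | tmul r m => simp [extScalars]
    simp only [LinearMap.comp_apply]
    rw [nat, F.map_extScalars ρ f g h, nat]

/-- The inclusion of the kernel. -/
def splitKerι {F : PolyFunctor.{u, v} k} {G : PolyFunctor.{u, w} k} (ε : Hom F G)
    (q : Hom F F) (hq : ∀ V x, ε.app V (q.app V x) = 0)
    (hq' : ∀ V x, ε.app V x = 0 → q.app V x = x) : Hom (splitKer ε q hq hq') F :=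
  ⟨fun V => (LinearMap.ker (ε.app V)).subtype, fun R _ _ V W f => by
    have h : (LinearMap.ker (ε.app W)).subtype.baseChange R ∘ₗ
        ((q.app W).codRestrict (LinearMap.ker (ε.app W)) fun x => hq W x).baseChange R =
        (q.app W).baseChange R := by
      rw [← LinearMap.baseChange_comp]; rfl
    have h₂ : (q.app V).baseChange R ∘ₗ (LinearMap.ker (ε.app V)).subtype.baseChange R =
        (LinearMap.ker (ε.app V)).subtype.baseChange R := by
      rw [← LinearMap.baseChange_comp]
      congr 1
      ext x
      exact hq' V x x.2
    rw [← LinearMap.comp_assoc, h, ← LinearMap.comp_assoc, q.naturality, LinearMap.comp_assoc, h₂]⟩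

/-- The natural retraction onto the kernel. -/
def splitKerπ {F : PolyFunctor.{u, v} k} {G : PolyFunctor.{u, w} k} (ε : Hom F G)
    (q : Hom F F) (hq : ∀ V x, ε.app V (q.app V x) = 0)
    (hq' : ∀ V x, ε.app V x = 0 → q.app V x = x) : Hom F (splitKer ε q hq hq') :=
  ⟨fun V => (q.app V).codRestrict (LinearMap.ker (ε.app V)) fun x => hq V x,
    fun R _ _ V W f => by
    have h : (LinearMap.ker (ε.app V)).subtype.baseChange R ∘ₗ
        ((q.app V).codRestrict (LinearMap.ker (ε.app V)) fun x => hq V x).baseChange R =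
        (q.app V).baseChange R := by
      rw [← LinearMap.baseChange_comp]; rfl
    have h' : ((q.app W).codRestrict (LinearMap.ker (ε.app W)) fun x => hq W x).baseChange R ∘ₗ
        (q.app W).baseChange R =
        ((q.app W).codRestrict (LinearMap.ker (ε.app W)) fun x => hq W x).baseChange R := by
      rw [← LinearMap.baseChange_comp]
      congr 1
      ext x
      exact hq' W _ (hq W x)
    rw [LinearMap.comp_assoc, LinearMap.comp_assoc, h, ← q.naturality, ← LinearMap.comp_assoc,
      h']⟩

theorem IsHomogeneous.const : IsHomogeneous (const k) 0 := by
  intro R _ _ V W r f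
  rw [pow_zero, one_smul]

theorem IsHomogeneous.tensor {F : PolyFunctor.{u, v} k} {G : PolyFunctor.{u, w} k} {d e : ℕ}
    (hF : F.IsHomogeneous d) (hG : G.IsHomogeneous e) : (tensor F G).IsHomogeneous (d + e) := by
  intro R _ _ V W r f
  change bcTensor _ _ = _ • bcTensor _ _
  rw [hF, hG, bcTensor_smul, pow_add]

theorem IsHomogeneous.directSum {ι : Type w} [DecidableEq ι] {F : ι → PolyFunctor.{u, v} k} {d : ℕ}
    (hF : ∀ i, (F i).IsHomogeneous d) : (directSum F).IsHomogeneous d := by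
  intro R _ _ V W r f
  apply LinearMap.ext
  intro x
  induction x using bcSum_induction with
  | h0 => rw [map_zero, map_zero]
  | hadd x y hx hy => rw [map_add, hx, hy, map_add]
  | h i x =>
    rw [LinearMap.smul_apply, bcSum_lof, bcSum_lof, hF i, LinearMap.smul_apply, map_smul]

theorem IsHomogeneous.splitKer {F : PolyFunctor.{u, v} k} {G : PolyFunctor.{u, w} k} {ε : Hom F G}
    {q : Hom F F} {hq : ∀ V x, ε.app V (q.app V x) = 0}
    {hq' : ∀ V x, ε.app V x = 0 → q.app V x = x} {d : ℕ} (hF : F.IsHomogeneous d) :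
    (splitKer ε q hq hq').IsHomogeneous d := by
  intro R _ _ V W r f
  change _ ∘ₗ F.map R (r • f) ∘ₗ _ = _
  rw [hF, LinearMap.smul_comp, LinearMap.comp_smul]

end PolyFunctor

section Generic

variable {k : Type u} [CommRing k]

/-- The `R`-linear map `R ⊗ M → S ⊗ N` extended to `S ⊗ M → S ⊗ N`, along `ρ : R → S`. -/
def extMap {R S : Type u} [CommRing R] [Algebra k R] [CommRing S] [Algebra k S] (ρ : R →ₐ[k] S)
    {M N : Type*} [AddCommGroup M] [AddCommGroup N] [Module k M] [Module k N]
    (f : R ⊗[k] M →ₗ[R] R ⊗[k] N) : S ⊗[k] M →ₗ[S] S ⊗[k] N :=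
  LinearMap.liftBaseChange S
    (extScalars ρ N ∘ₗ f.restrictScalars k ∘ₗ TensorProduct.mk k R M 1)

theorem extMap_extScalars {R S : Type u} [CommRing R] [Algebra k R] [CommRing S] [Algebra k S]
    (ρ : R →ₐ[k] S) {M N : Type*} [AddCommGroup M] [AddCommGroup N] [Module k M] [Module k N]
    (f : R ⊗[k] M →ₗ[R] R ⊗[k] N) (x : R ⊗[k] M) :
    extMap ρ f (extScalars ρ M x) = extScalars ρ N (f x) := by
  induction x with
  | zero => simp
  | add x y hx hy => simp only [map_add, hx, hy]
  | tmul r m =>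
    have : r ⊗ₜ[k] m = r • ((1 : R) ⊗ₜ[k] m) := by simp [TensorProduct.smul_tmul']
    rw [this, map_smul f, extScalars_smul, extScalars_smul, map_smul]
    congr 1
    simp [extMap, extScalars]

theorem baseChange_extScalars {R S : Type u} [CommRing R] [Algebra k R] [CommRing S] [Algebra k S]
    (ρ : R →ₐ[k] S) {M N : Type*} [AddCommGroup M] [AddCommGroup N] [Module k M] [Module k N]
    (f : M →ₗ[k] N) (x : R ⊗[k] M) :
    f.baseChange S (extScalars ρ M x) = extScalars ρ N (f.baseChange R x) := by
  induction x with
  | zero => simp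
  | add x y hx hy => simp only [map_add, hx, hy]
  | tmul r m => simp [extScalars]

/-- An element of `k[tₛ] ⊗ M` is zero when all its coefficients are. -/
theorem mvPolynomial_tensor_eq_zero {σ : Type*} {M : Type*} [AddCommGroup M] [Module k M]
    (x : MvPolynomial σ k ⊗[k] M)
    (h : ∀ α, LinearMap.rTensor M (MvPolynomial.lcoeff k α) x = 0) : x = 0 := by
  classical
  apply (TensorProduct.equivFinsuppOfBasisLeft (MvPolynomial.basisMonomials σ k)).injective
  rw [map_zero]
  ext α
  have : ∀ y : MvPolynomial σ k ⊗[k] M,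
      TensorProduct.equivFinsuppOfBasisLeft (MvPolynomial.basisMonomials σ k) y α =
        TensorProduct.lid k M (LinearMap.rTensor M (MvPolynomial.lcoeff k α) y) := by
    intro y
    induction y with
    | zero => simp
    | add x y hx hy => simp only [map_add, Finsupp.add_apply, hx, hy]
    | tmul p m =>
      rw [TensorProduct.equivFinsuppOfBasisLeft_apply_tmul_apply]
      simp only [MvPolynomial.lcoeff, LinearMap.rTensor_tmul, TensorProduct.lid_tmul]
      rfl
  rw [this, h]
  simp

theorem coeff_aeval_X_mul {σ : Type*} [Finite σ] (d : ℕ)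
    (p : MvPolynomial σ k) :
    (MvPolynomial.aeval (fun i => (Polynomial.X * Polynomial.C (MvPolynomial.X i) :
      Polynomial (MvPolynomial σ k))) p).coeff d = MvPolynomial.homogeneousComponent d p := by
  induction p using MvPolynomial.induction_on' with
  | add p q hp hq => simp only [map_add, Polynomial.coeff_add, hp, hq]
  | monomial α a =>
    have h : MvPolynomial.aeval (fun i => (Polynomial.X * Polynomial.C (MvPolynomial.X i) :
        Polynomial (MvPolynomial σ k))) (MvPolynomial.monomial α a) =
        Polynomial.X ^ α.degree * Polynomial.C (MvPolynomial.monomial α a) := by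
      rw [MvPolynomial.aeval_monomial]
      simp only [mul_pow, Finsupp.prod, Finset.prod_mul_distrib, Finset.prod_pow_eq_pow_sum,
        ← Polynomial.C_pow, ← map_prod]
      rw [MvPolynomial.monomial_eq, Polynomial.C_mul, Finsupp.degree, mul_left_comm]
      rfl
    rw [h, Polynomial.coeff_X_pow_mul', Polynomial.coeff_C]
    classical
    ext β
    rw [MvPolynomial.coeff_homogeneousComponent, MvPolynomial.coeff_monomial]
    by_cases hd : α.degree = d
    · subst hd
      by_cases hb : α = β
      · subst hb; simp
      · simp [hb]
    · by_cases hb : α = β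
      · subst hb
        have : ¬ (α.degree ≤ d ∧ d - α.degree = 0) := by omega
        by_cases h1 : α.degree ≤ d
        · have h2 : d - α.degree ≠ 0 := by omega
          simp [hd, h1, h2]
        · simp [hd, h1]
      · split_ifs <;> simp [hb]

theorem homogeneousComponent_eq_sum {σ : Type*} [Fintype σ]
    [DecidableEq σ] (d : ℕ) (p : MvPolynomial σ k) : MvPolynomial.homogeneousComponent d p =
      ∑ α ∈ Finset.finsuppAntidiag Finset.univ d, MvPolynomial.monomial α (p.coeff α) := by
  ext β
  rw [MvPolynomial.coeff_homogeneousComponent, MvPolynomial.coeff_sum]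
  simp only [MvPolynomial.coeff_monomial, Finset.sum_ite_eq', Finset.mem_finsuppAntidiag]
  simp [Finsupp.degree_eq_sum]

namespace FGProj

theorem exists_coords (V : FGProj k) : ∃ (n : ℕ) (g : Fin n → V) (c : Fin n → V →ₗ[k] k),
    ∀ x, ∑ i, c i x • g i = x := by
  obtain ⟨n, f, g, -, -, h⟩ := Module.Finite.exists_comp_eq_id_of_projective k V
  refine ⟨n, fun i => f (Pi.single i 1), fun i => LinearMap.proj i ∘ₗ g, fun x => ?_⟩
  have := LinearMap.congr_fun h x
  simp only [LinearMap.comp_apply, LinearMap.id_apply] at this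
  conv_rhs => rw [← this, ← Finset.univ_sum_single (g x)]
  rw [map_sum]
  refine Finset.sum_congr rfl fun i _ => ?_
  rw [LinearMap.comp_apply, LinearMap.proj_apply, ← map_smul, ← Pi.single_smul]
  simp

/-- The size of a chosen finite dual basis of `V`. -/
def rk (V : FGProj k) : ℕ := (exists_coords V).choose

/-- The generators in a chosen finite dual basis of `V`. -/
def gen (V : FGProj k) : Fin V.rk → V := (exists_coords V).choose_spec.choose

/-- The linear forms in a chosen finite dual basis of `V`. -/
def coord (V : FGProj k) : Fin V.rk → V →ₗ[k] k := (exists_coords V).choose_spec.choose_spec.choose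

theorem sum_coord (V : FGProj k) (x : V) : ∑ i, V.coord i x • V.gen i = x :=
  (exists_coords V).choose_spec.choose_spec.choose_spec x

variable {R : Type u} [CommRing R] [Algebra k R] {V W : FGProj k}

/-- The index set of the matrices of linear maps from `V` to `W`. -/
abbrev MatIndex (V W : FGProj k) : Type := Fin W.rk × Fin V.rk

/-- The matrix of an `R`-linear map `R ⊗ V → R ⊗ W` in the chosen dual bases. -/
def toMat (f : R ⊗[k] V →ₗ[R] R ⊗[k] W) : MatIndex V W → R := fun p =>
  TensorProduct.AlgebraTensorModule.rid k R R ((W.coord p.1).baseChange R (f (1 ⊗ₜ V.gen p.2)))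

/-- The `R`-linear map `R ⊗ V → R ⊗ W` with a given matrix. -/
def ofMat (m : MatIndex V W → R) : R ⊗[k] V →ₗ[R] R ⊗[k] W :=
  LinearMap.liftBaseChange R (∑ p : MatIndex V W,
    (LinearMap.toSpanSingleton k (R ⊗[k] W) (m p ⊗ₜ W.gen p.1)) ∘ₗ V.coord p.2)

theorem ofMat_one_tmul (m : MatIndex V W → R) (x : V) :
    ofMat m (1 ⊗ₜ x) = ∑ p : MatIndex V W, V.coord p.2 x • (m p ⊗ₜ W.gen p.1) := by
  simp [ofMat, LinearMap.sum_apply]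

theorem linearMap_ext_one {M N : Type*} [AddCommGroup M] [Module k M] [AddCommGroup N] [Module R N]
    {f g : R ⊗[k] M →ₗ[R] N} (h : ∀ x, f (1 ⊗ₜ x) = g (1 ⊗ₜ x)) : f = g := by
  apply LinearMap.ext
  intro x
  induction x with
  | zero => simp
  | add x y hx hy => simp only [map_add, hx, hy]
  | tmul r m =>
    have : r ⊗ₜ[k] m = r • ((1 : R) ⊗ₜ[k] m) := by simp [TensorProduct.smul_tmul']
    rw [this, map_smul, map_smul, h]

theorem sum_rid_coord (y : R ⊗[k] W) : ∑ j, (TensorProduct.AlgebraTensorModule.rid k R R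
    ((W.coord j).baseChange R y)) ⊗ₜ[k] W.gen j = y := by
  induction y with
  | zero => simp
  | add x y hx hy =>
    simp only [map_add, TensorProduct.add_tmul, Finset.sum_add_distrib, hx, hy]
  | tmul r m =>
    conv_rhs => rw [← W.sum_coord m, TensorProduct.tmul_sum]
    refine Finset.sum_congr rfl fun j _ => ?_
    rw [LinearMap.baseChange_tmul, TensorProduct.AlgebraTensorModule.rid_tmul,
      TensorProduct.tmul_smul, TensorProduct.smul_tmul']

theorem ofMat_toMat (f : R ⊗[k] V →ₗ[R] R ⊗[k] W) : ofMat (toMat f) = f := by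
  apply linearMap_ext_one
  intro x
  have h : (1 : R) ⊗ₜ[k] x = ∑ i, algebraMap k R (V.coord i x) • (1 : R) ⊗ₜ[k] V.gen i := by
    conv_lhs => rw [← V.sum_coord x, TensorProduct.tmul_sum]
    refine Finset.sum_congr rfl fun i _ => ?_
    rw [TensorProduct.tmul_smul, algebraMap_smul]
  rw [ofMat_one_tmul, Fintype.sum_prod_type_right, h, map_sum]
  refine Finset.sum_congr rfl fun i _ => ?_
  rw [map_smul, ← sum_rid_coord (f (1 ⊗ₜ V.gen i)), algebraMap_smul, Finset.smul_sum]
  rfl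

theorem toMat_smul (r : R) (f : R ⊗[k] V →ₗ[R] R ⊗[k] W) : toMat (r • f) = r • toMat f := by
  funext p
  simp only [toMat, LinearMap.smul_apply, map_smul, Pi.smul_apply]

theorem toMat_extScalars {S : Type u} [CommRing S] [Algebra k S] (ρ : R →ₐ[k] S)
    {f : R ⊗[k] V →ₗ[R] R ⊗[k] W} {g : S ⊗[k] V →ₗ[S] S ⊗[k] W}
    (h : ∀ x, g (extScalars ρ V x) = extScalars ρ W (f x)) (p : MatIndex V W) :
    toMat g p = ρ (toMat f p) := by
  have := h (1 ⊗ₜ V.gen p.2)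
  rw [show extScalars ρ V ((1 : R) ⊗ₜ V.gen p.2) = 1 ⊗ₜ V.gen p.2 by simp [extScalars]] at this
  rw [toMat, this, baseChange_extScalars, toMat]
  generalize (W.coord p.1).baseChange R (f (1 ⊗ₜ V.gen p.2)) = y
  induction y with
  | zero => simp
  | add x y hx hy => simp only [map_add, hx, hy]
  | tmul r m => simp [extScalars]

theorem ofMat_extScalars {S : Type u} [CommRing S] [Algebra k S] (ρ : R →ₐ[k] S)
    (m : MatIndex V W → R) (m' : MatIndex V W → S) (h : ∀ p, m' p = ρ (m p)) (x : R ⊗[k] V) :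
    ofMat m' (extScalars ρ V x) = extScalars ρ W (ofMat m x) := by
  rw [← extMap_extScalars]
  congr 1
  apply linearMap_ext_one
  intro y
  have := extMap_extScalars ρ (ofMat m) (1 ⊗ₜ y)
  rw [show extScalars ρ V ((1 : R) ⊗ₜ y) = 1 ⊗ₜ y by simp [extScalars]] at this
  rw [this, ofMat_one_tmul, ofMat_one_tmul, map_sum]
  refine Finset.sum_congr rfl fun p _ => ?_
  rw [map_smul, h]
  simp [extScalars]

theorem rel_of_toMat {S : Type u} [CommRing S] [Algebra k S] (ρ : R →ₐ[k] S)
    (m : MatIndex V W → R) (f : S ⊗[k] V →ₗ[S] S ⊗[k] W) (h : ∀ p, toMat f p = ρ (m p))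
    (x : R ⊗[k] V) : f (extScalars ρ V x) = extScalars ρ W (ofMat m x) := by
  have := ofMat_extScalars ρ (V := V) (W := W) m (toMat f) h x
  rwa [ofMat_toMat] at this

theorem smul_extMap_ofMat {S : Type u} [CommRing S] [Algebra k S] (ρ : R →ₐ[k] S) (s : S)
    (m : MatIndex V W → R) : s • extMap ρ (ofMat m) = ofMat fun p => s * ρ (m p) := by
  apply linearMap_ext_one
  intro z
  have h2 := extMap_extScalars ρ (ofMat m) (1 ⊗ₜ z)
  rw [show extScalars ρ V ((1 : R) ⊗ₜ z) = 1 ⊗ₜ z by simp [extScalars]] at h2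
  rw [LinearMap.smul_apply, h2, ofMat_one_tmul, ofMat_one_tmul, map_sum, Finset.smul_sum]
  refine Finset.sum_congr rfl fun p _ => ?_
  rw [map_smul, smul_comm]
  simp [extScalars, TensorProduct.smul_tmul']

/-- The generic linear map from `V` to `W`, over the polynomial ring in the matrix entries. -/
def genericMap (V W : FGProj k) :
    MvPolynomial (MatIndex V W) k ⊗[k] V →ₗ[MvPolynomial (MatIndex V W) k]
      MvPolynomial (MatIndex V W) k ⊗[k] W :=
  ofMat MvPolynomial.X

theorem genericMap_extScalars (f : R ⊗[k] V →ₗ[R] R ⊗[k] W)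
    (x : MvPolynomial (MatIndex V W) k ⊗[k] V) :
    f (extScalars (MvPolynomial.aeval (toMat f)) V x) =
      extScalars (MvPolynomial.aeval (toMat f)) W (genericMap V W x) := by
  have h := ofMat_extScalars (MvPolynomial.aeval (toMat f)) (V := V) (W := W)
    MvPolynomial.X (toMat f) (fun p => (MvPolynomial.aeval_X _ p).symm) x
  rw [ofMat_toMat] at h
  exact h

end FGProj

end Generic

namespace PolyFunctor

variable {k : Type u} [CommRing k]

open FGProj

/-- The coefficient of the monomial `t ^ α` in the action of the generic linear map `V → W`. -/
def coeff (F : PolyFunctor.{u, v} k) (V W : FGProj k) (α : MatIndex V W →₀ ℕ) :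
    F.obj V →ₗ[k] F.obj W :=
  (TensorProduct.lid k (F.obj W)).toLinearMap ∘ₗ
    LinearMap.rTensor (F.obj W) (MvPolynomial.lcoeff k α) ∘ₗ
      (F.map _ (genericMap V W)).restrictScalars k ∘ₗ
        TensorProduct.mk k (MvPolynomial (MatIndex V W) k) (F.obj V) 1

/-- The exponents of the monomials of degree `d` in the entries of a matrix. -/
abbrev exponents (V W : FGProj k) (d : ℕ) : Finset (MatIndex V W →₀ ℕ) :=
  Finset.finsuppAntidiag Finset.univ d

theorem map_homogeneousComponent {F : PolyFunctor.{u, v} k} {d : ℕ} (hF : F.IsHomogeneous d)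
    (V W : FGProj k) (x : F.obj V) :
    LinearMap.rTensor (F.obj W) (MvPolynomial.homogeneousComponent d)
      (F.map _ (genericMap V W) (1 ⊗ₜ x)) = F.map _ (genericMap V W) (1 ⊗ₜ x) := by
  let P := MvPolynomial (MatIndex V W) k
  let τ : P →ₐ[k] Polynomial P :=
    MvPolynomial.aeval fun p => Polynomial.X * Polynomial.C (MvPolynomial.X p)
  let ι : P →ₐ[k] Polynomial P := IsScalarTower.toAlgHom k P (Polynomial P)
  have hι : ∀ p, ι p = Polynomial.C p := fun p => rfl
  have hτ : ∀ p, τ (MvPolynomial.X p) = Polynomial.X * Polynomial.C (MvPolynomial.X p) :=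
    fun p => MvPolynomial.aeval_X _ p
  have h1 : ∀ y, ((Polynomial.X : Polynomial P) • extMap ι (genericMap V W)) (extScalars τ V y) =
      extScalars τ W (genericMap V W y) := by
    intro y
    rw [genericMap, smul_extMap_ofMat]
    exact ofMat_extScalars τ _ _ (fun p => by rw [hτ, hι]) y
  have h2 := F.map_extScalars τ _ _ h1 (1 ⊗ₜ x)
  rw [hF, LinearMap.smul_apply,
    show extScalars τ (F.obj V) ((1 : P) ⊗ₜ x) = extScalars ι _ (1 ⊗ₜ x) by simp [extScalars],
    F.map_extScalars ι (genericMap V W) (extMap ι (genericMap V W))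
      (extMap_extScalars ι (genericMap V W)) (1 ⊗ₜ x)] at h2
  generalize F.map _ (genericMap V W) (1 ⊗ₜ x) = y at h2 ⊢
  have hl : ∀ y : P ⊗[k] F.obj W,
      LinearMap.rTensor (F.obj W) ((Polynomial.lcoeff P d).restrictScalars k)
        ((Polynomial.X ^ d : Polynomial P) • extScalars ι _ y) = y := by
    intro y
    induction y with
    | zero => simp
    | add x y hx hy => simp only [map_add, smul_add, hx, hy]
    | tmul p m =>
      simp [extScalars, hι, TensorProduct.smul_tmul']
  have hr : ∀ y : P ⊗[k] F.obj W,
      LinearMap.rTensor (F.obj W) ((Polynomial.lcoeff P d).restrictScalars k)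
        (extScalars τ _ y) = LinearMap.rTensor (F.obj W) (MvPolynomial.homogeneousComponent d) y := by
    have hp : ∀ p : P, (τ p).coeff d = MvPolynomial.homogeneousComponent d p :=
      coeff_aeval_X_mul d
    intro y
    induction y with
    | zero => simp
    | add x y hx hy => simp only [map_add, hx, hy]
    | tmul p m => simp [extScalars, hp]
  rw [← hr, ← h2, hl]

/-- The Taylor expansion of a homogeneous functor. -/
theorem map_eq_sum {F : PolyFunctor.{u, v} k} {d : ℕ} (hF : F.IsHomogeneous d)
    {R : Type u} [CommRing R] [Algebra k R] {V W : FGProj k} (f : R ⊗[k] V →ₗ[R] R ⊗[k] W)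
    (x : F.obj V) :
    F.map R f (1 ⊗ₜ x) =
      ∑ α ∈ exponents V W d, (α.prod fun p n => toMat f p ^ n) ⊗ₜ F.coeff V W α x := by
  have h := F.map_extScalars (MvPolynomial.aeval (toMat f)) (genericMap V W) f
    (genericMap_extScalars f) (1 ⊗ₜ x)
  rw [show extScalars (MvPolynomial.aeval (toMat f)) (F.obj V)
    ((1 : MvPolynomial (MatIndex V W) k) ⊗ₜ x) = 1 ⊗ₜ x by simp [extScalars]] at h
  rw [h, ← map_homogeneousComponent hF]
  simp only [coeff, LinearMap.comp_apply, LinearMap.restrictScalars_apply,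
    TensorProduct.mk_apply, LinearEquiv.coe_coe]
  generalize F.map _ (genericMap V W) (1 ⊗ₜ x) = y
  induction y with
  | zero => simp
  | add x y hx hy => simp only [map_add, hx, hy, TensorProduct.tmul_add, Finset.sum_add_distrib]
  | tmul p m =>
    simp only [LinearMap.rTensor_tmul, homogeneousComponent_eq_sum, TensorProduct.sum_tmul, map_sum,
      AlgHom.toLinearMap_apply, MvPolynomial.aeval_monomial, TensorProduct.lid_tmul]
    refine Finset.sum_congr rfl fun α _ => ?_
    rw [TensorProduct.tmul_smul, TensorProduct.smul_tmul', Algebra.smul_def]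
    rfl

end PolyFunctor

namespace PolyFunctor

variable {k : Type u} [CommRing k]

open FGProj

/-- The functor `W ↦ G(V ⊗ W)`, for a fixed parameter `V`. -/
@[reducible] def param (G : PolyFunctor.{u, v} k) (V : FGProj k) : PolyFunctor.{u, v} k where
  obj W := G.obj (V.tensor W)
  map R _ _ _ _ g := G.map R (V := V.tensor _) (W := V.tensor _) (bcTensor LinearMap.id g)
  map_id R _ _ W := by rw [bcTensor_id]; exact G.map_id R _
  map_comp R _ _ _ _ _ g f := by
    rw [← G.map_comp, ← bcTensor_comp, LinearMap.id_comp]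
  map_extScalars ρ _ _ f g h :=
    G.map_extScalars ρ _ _ (bcTensor_extScalars ρ (fun _ => rfl) h)

/-- The functor `V ↦ G(V ⊗ W)`, for a fixed parameter `W`. -/
@[reducible] def paramLeft (G : PolyFunctor.{u, v} k) (W : FGProj k) : PolyFunctor.{u, v} k where
  obj V := G.obj (V.tensor W)
  map R _ _ V V' f := G.map R (V := V.tensor W) (W := V'.tensor W) (bcTensor f LinearMap.id)
  map_id R _ _ V := by rw [bcTensor_id]; exact G.map_id R _
  map_comp R _ _ _ _ _ g f := by
    rw [← G.map_comp, ← bcTensor_comp, LinearMap.id_comp]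
  map_extScalars ρ _ _ f g h :=
    G.map_extScalars ρ _ _ (bcTensor_extScalars ρ h (fun _ => rfl))

theorem IsHomogeneous.paramLeft {G : PolyFunctor.{u, v} k} {d : ℕ} (hG : G.IsHomogeneous d)
    (W : FGProj k) : (G.paramLeft W).IsHomogeneous d := by
  intro R _ _ V V' r f
  have h := bcTensor_smul r 1 f (LinearMap.id : R ⊗[k] W →ₗ[R] R ⊗[k] W)
  rw [one_smul, mul_one] at h
  change G.map R _ = _ • G.map R _
  rw [h]
  exact hG R _ _ r _

/-- The functoriality of `G ↦ G(V ⊗ -)`. -/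
def paramMap {G : PolyFunctor.{u, v} k} {H : PolyFunctor.{u, w} k} (φ : Hom G H) (V : FGProj k) :
    Hom (G.param V) (H.param V) :=
  ⟨fun W => φ.app (V.tensor W), fun R _ _ _ _ _ => φ.naturality R _⟩

theorem map_paramLeft_param (G : PolyFunctor.{u, v} k) (R : Type u) [CommRing R] [Algebra k R]
    {V V' W W' : FGProj k} (f : R ⊗[k] V →ₗ[R] R ⊗[k] V') (g : R ⊗[k] W →ₗ[R] R ⊗[k] W')
    (x : R ⊗[k] G.obj (V.tensor W)) :
    (G.paramLeft W').map R f ((G.param V).map R g x) =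
      (G.param V').map R g ((G.paramLeft W).map R f x) := by
  change (G.map R _ ∘ₗ G.map R _) x = (G.map R _ ∘ₗ G.map R _) x
  rw [← G.map_comp, ← G.map_comp, ← bcTensor_comp, ← bcTensor_comp]
  rfl

/-- The coefficients of the action of the generic map `V → V'`, as morphisms
`G(V ⊗ -) → G(V' ⊗ -)`. -/
def coeffHom (G : PolyFunctor.{u, v} k) (V V' : FGProj k) (α : MatIndex V V' →₀ ℕ) :
    Hom (G.param V) (G.param V') :=
  ⟨fun W => (G.paramLeft W).coeff V V' α, by
    intro R _ _ W W' g
    let P := MvPolynomial (MatIndex V V') k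
    let S := MvPolynomial (MatIndex V V') R
    let ιP : P →ₐ[k] S := MvPolynomial.mapAlgHom (Algebra.ofId k R)
    let ιR : R →ₐ[k] S := IsScalarTower.toAlgHom k R S
    let κ : ∀ (M : Type v) [AddCommGroup M] [Module k M], S ⊗[k] M →ₗ[k] R ⊗[k] M :=
      fun M _ _ => LinearMap.rTensor M ((MvPolynomial.lcoeff R α).restrictScalars k)
    let u := extMap ιP (genericMap V V')
    have κmul : ∀ (M : Type v) [AddCommGroup M] [Module k M] (s : S) (y : R ⊗[k] M),
        κ M (s • extScalars ιR M y) = s.coeff α • y := by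
      intro M _ _ s y
      induction y with
      | zero => simp
      | add x y hx hy => simp only [map_add, smul_add, hx, hy]
      | tmul r m =>
        have e : (s * algebraMap R S r).coeff α = s.coeff α * r := by
          change MvPolynomial.coeff α (s * MvPolynomial.C r) = _
          rw [mul_comm, MvPolynomial.coeff_C_mul, mul_comm]
        simp [κ, extScalars, ιR, TensorProduct.smul_tmul', MvPolynomial.lcoeff, e]
    have κsmul : ∀ (M : Type v) [AddCommGroup M] [Module k M] (r : R) (y : S ⊗[k] M),
        κ M (ιR r • y) = r • κ M y := by
      intro M _ _ r y
      induction y with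
      | zero => simp
      | add x y hx hy => simp only [map_add, smul_add, hx, hy]
      | tmul s m =>
        simp [κ, ιR, TensorProduct.smul_tmul', MvPolynomial.lcoeff]
    -- the generic map computes the coefficients
    have h1 : ∀ (U : FGProj k) (z : R ⊗[k] G.obj (V.tensor U)),
        κ _ ((G.paramLeft U).map S u (extScalars ιR _ z)) =
          ((G.paramLeft U).coeff V V' α).baseChange R z := by
      intro U z
      induction z with
      | zero => simp
      | add x y hx hy => simp only [map_add, hx, hy]
      | tmul r x =>
        have e : extScalars ιR (G.obj (V.tensor U)) (r ⊗ₜ x) =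
            ιR r • extScalars ιP _ (1 ⊗ₜ x) := by
          simp [extScalars, TensorProduct.smul_tmul']
        rw [e, map_smul, κsmul, (G.paramLeft U).map_extScalars ιP (genericMap V V') u
          (extMap_extScalars _ _), LinearMap.baseChange_tmul]
        have e2 : ∀ (M : Type v) [AddCommGroup M] [Module k M] (y : P ⊗[k] M),
            κ M (extScalars ιP M y) =
              1 ⊗ₜ TensorProduct.lid k M (LinearMap.rTensor M (MvPolynomial.lcoeff k α) y) := by
          intro M _ _ y
          induction y with
          | zero => simp
          | add x y hx hy => simp only [map_add, TensorProduct.tmul_add, hx, hy]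
          | tmul p m =>
            have e3 : (ιP p).coeff α = p.coeff α • (1 : R) := by
              rw [← Algebra.algebraMap_eq_smul_one]
              exact MvPolynomial.coeff_map (algebraMap k R) p α
            simp [κ, extScalars, MvPolynomial.lcoeff, e3, TensorProduct.smul_tmul']
        rw [e2, TensorProduct.smul_tmul', smul_eq_mul, mul_one]
        rfl
    have h2 : ∀ z : S ⊗[k] G.obj (V'.tensor W),
        κ _ ((G.param V').map S (extMap ιR g) z) = (G.param V').map R g (κ _ z) := by
      intro z
      induction z with
      | zero => simp
      | add x y hx hy => simp only [map_add, hx, hy]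
      | tmul s x =>
        have e : s ⊗ₜ x = s • extScalars ιR _ ((1 : R) ⊗ₜ[k] x) := by
          simp [extScalars, TensorProduct.smul_tmul']
        rw [e, LinearMap.map_smul ((G.param V').map S (extMap ιR g)) s, κmul,
          LinearMap.map_smul ((G.param V').map R g),
          (G.param V').map_extScalars ιR g _ (extMap_extScalars _ _), κmul]
    apply LinearMap.ext
    intro z
    rw [LinearMap.comp_apply, LinearMap.comp_apply, ← h1, ← h1, ← h2, ← map_paramLeft_param,
      (G.param V).map_extScalars ιR g _ (extMap_extScalars _ _)]⟩

theorem map_paramLeft_eq_sum {G : PolyFunctor.{u, w} k} {d : ℕ} (hG : G.IsHomogeneous d)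
    {R : Type u} [CommRing R] [Algebra k R] {V V' : FGProj k} (f : R ⊗[k] V →ₗ[R] R ⊗[k] V')
    (W : FGProj k) (x : G.obj (V.tensor W)) :
    (G.paramLeft W).map R f (1 ⊗ₜ x) =
      ∑ α ∈ exponents V V' d, (α.prod fun p n => toMat f p ^ n) ⊗ₜ (G.coeffHom V V' α).app W x :=
  map_eq_sum (hG.paramLeft W) f x

/-- Evaluation of a morphism at an element. -/
def evalHom (F : PolyFunctor.{u, v} k) (G : PolyFunctor.{u, w} k) (W : FGProj k) (y : F.obj W) :
    Hom F G →ₗ[k] G.obj W where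
  toFun φ := φ.app W y
  map_add' _ _ := rfl
  map_smul' _ _ := rfl

/-- Over a polynomial ring, an element of `R ⊗ Hom(F, G)` is determined by its values. -/
theorem hom_separated {F : PolyFunctor.{u, v} k} {G : PolyFunctor.{u, w} k} {σ : Type u}
    {x x' : MvPolynomial σ k ⊗[k] Hom F G}
    (h : ∀ W y, (evalHom F G W y).baseChange (MvPolynomial σ k) x =
      (evalHom F G W y).baseChange (MvPolynomial σ k) x') : x = x' := by
  rw [← sub_eq_zero]
  replace h : ∀ W y, (evalHom F G W y).baseChange (MvPolynomial σ k) (x - x') = 0 := by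
    intro W y
    rw [map_sub, h, sub_self]
  generalize x - x' = z at h
  apply mvPolynomial_tensor_eq_zero
  intro α
  apply (TensorProduct.lid k _).injective
  rw [map_zero]
  ext W y
  have := congrArg (fun t => TensorProduct.lid k _ (LinearMap.rTensor _ (MvPolynomial.lcoeff k α) t))
    (h W y)
  simp only [map_zero] at this
  rw [show (0 : Hom F G).app W y = 0 from rfl, ← this]
  clear this h
  change evalHom F G W y _ = _
  induction z with
  | zero => simp
  | add x y hx hy => simp only [map_add, hx, hy]
  | tmul p φ => simp

/-- The action of linear maps over `k`-algebras on the modules `Hom(F, G(V ⊗ -))`, for `G`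
homogeneous of weight `d`. Over `R`, a linear map `f : R ⊗ V → R ⊗ V'` with matrix `m` acts on the
left through the expansion `G(f ⊗ -) = ∑ m ^ α ⊗ G_α`, where the `G_α : G(V ⊗ -) → G(V' ⊗ -)` are the
coefficients of the generic map. -/
def paramHomMap (F : PolyFunctor.{u, v} k) (G : PolyFunctor.{u, w} k) (d : ℕ)
    {R : Type u} [CommRing R] [Algebra k R] {V V' : FGProj k} (f : R ⊗[k] V →ₗ[R] R ⊗[k] V') :
    R ⊗[k] Hom F (G.param V) →ₗ[R] R ⊗[k] Hom F (G.param V') :=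
  LinearMap.liftBaseChange R (∑ α ∈ exponents V V' d,
    TensorProduct.mk k R (Hom F (G.param V')) (α.prod fun p n => toMat f p ^ n) ∘ₗ
      Hom.comp (F := F) (G.coeffHom V V' α))

theorem paramHomMap_one_tmul (F : PolyFunctor.{u, v} k) (G : PolyFunctor.{u, w} k) (d : ℕ)
    {R : Type u} [CommRing R] [Algebra k R] {V V' : FGProj k} (f : R ⊗[k] V →ₗ[R] R ⊗[k] V')
    (φ : Hom F (G.param V)) : paramHomMap F G d f (1 ⊗ₜ φ) =
      ∑ α ∈ exponents V V' d, (α.prod fun p n => toMat f p ^ n) ⊗ₜ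
        Hom.comp (G.coeffHom V V' α) φ := by
  rw [paramHomMap, LinearMap.liftBaseChange_tmul, one_smul, LinearMap.sum_apply]
  rfl

/-- The values of the action on morphisms. -/
theorem eval_paramHomMap (F : PolyFunctor.{u, v} k) {G : PolyFunctor.{u, w} k} {d : ℕ}
    (hG : G.IsHomogeneous d) {R : Type u} [CommRing R] [Algebra k R] {V V' : FGProj k}
    (f : R ⊗[k] V →ₗ[R] R ⊗[k] V') (W : FGProj k) (y : F.obj W) (x : R ⊗[k] Hom F (G.param V)) :
    (evalHom F (G.param V') W y).baseChange R (paramHomMap F G d f x) =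
      (G.paramLeft W).map R f ((evalHom F (G.param V) W y).baseChange R x) := by
  have : (evalHom F (G.param V') W y).baseChange R ∘ₗ paramHomMap F G d f =
      (G.paramLeft W).map R f ∘ₗ (evalHom F (G.param V) W y).baseChange R := by
    apply linearMap_ext_one
    intro φ
    rw [LinearMap.comp_apply, paramHomMap_one_tmul, map_sum, LinearMap.comp_apply,
      LinearMap.baseChange_tmul, map_paramLeft_eq_sum hG]
    rfl
  exact LinearMap.congr_fun this x

theorem paramHomMap_extScalars (F : PolyFunctor.{u, v} k) (G : PolyFunctor.{u, w} k) (d : ℕ)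
    {R S : Type u} [CommRing R] [Algebra k R] [CommRing S] [Algebra k S] (ρ : R →ₐ[k] S)
    {V V' : FGProj k} (f : R ⊗[k] V →ₗ[R] R ⊗[k] V') (g : S ⊗[k] V →ₗ[S] S ⊗[k] V')
    (h : ∀ x, g (extScalars ρ V x) = extScalars ρ V' (f x)) (x : R ⊗[k] Hom F (G.param V)) :
    paramHomMap F G d g (extScalars ρ _ x) = extScalars ρ _ (paramHomMap F G d f x) := by
  have h0 : paramHomMap F G d g = extMap ρ (paramHomMap F G d f) := by
    apply linearMap_ext_one
    intro φ
    have h1 := extMap_extScalars ρ (paramHomMap F G d f) (1 ⊗ₜ φ)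
    rw [show extScalars ρ _ ((1 : R) ⊗ₜ φ) = 1 ⊗ₜ φ by simp [extScalars]] at h1
    rw [h1, paramHomMap_one_tmul, paramHomMap_one_tmul, map_sum]
    refine Finset.sum_congr rfl fun α _ => ?_
    simp only [extScalars, LinearMap.rTensor_tmul, AlgHom.toLinearMap_apply, Finsupp.prod,
      map_prod, map_pow, toMat_extScalars ρ h]
  rw [h0, extMap_extScalars]

/-- Base-changing from a polynomial ring: every linear map over `R` is induced from one over a
polynomial ring. -/
theorem map_induction {F : PolyFunctor.{u, v} k} {G : PolyFunctor.{u, w} k}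
    (φ : ∀ V, F.obj V →ₗ[k] G.obj V)
    (h : ∀ (σ : Type u) (V W : FGProj k)
      (f : MvPolynomial σ k ⊗[k] V →ₗ[MvPolynomial σ k] MvPolynomial σ k ⊗[k] W),
      (φ W).baseChange (MvPolynomial σ k) ∘ₗ F.map _ f =
        G.map _ f ∘ₗ (φ V).baseChange (MvPolynomial σ k))
    (R : Type u) [CommRing R] [Algebra k R] (V W : FGProj k) (f : R ⊗[k] V →ₗ[R] R ⊗[k] W) :
    (φ W).baseChange R ∘ₗ F.map R f = G.map R f ∘ₗ (φ V).baseChange R := by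
  let P := MvPolynomial (ULift.{u} (MatIndex V W)) k
  let ρ : P →ₐ[k] R := MvPolynomial.aeval fun p => toMat f p.down
  let m : MatIndex V W → P := fun p => MvPolynomial.X (ULift.up p)
  have hm : ∀ p, toMat f p = ρ (m p) := fun p =>
    (MvPolynomial.aeval_X (fun p : ULift.{u} (MatIndex V W) => toMat f p.down) _).symm
  have hρ := rel_of_toMat ρ m f hm
  apply linearMap_ext_one
  intro x
  have e : (1 : R) ⊗ₜ[k] x = extScalars ρ (F.obj V) ((1 : P) ⊗ₜ x) := by
    rw [extScalars, LinearMap.rTensor_tmul, AlgHom.toLinearMap_apply, map_one]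
  rw [e, LinearMap.comp_apply, LinearMap.comp_apply, F.map_extScalars ρ _ f hρ,
    baseChange_extScalars, baseChange_extScalars, G.map_extScalars ρ _ f hρ]
  exact congrArg _ (LinearMap.congr_fun (h _ V W (ofMat m)) (1 ⊗ₜ x))

/-- The parametrized `Hom`-functor `V ↦ Hom(F, G(V ⊗ -))`, for `G` homogeneous of weight `d`. -/
@[reducible] def paramHom (F : PolyFunctor.{u, v} k) (G : PolyFunctor.{u, w} k) {d : ℕ}
    (hG : G.IsHomogeneous d) : PolyFunctor.{u, max (u + 1) v w} k where
  obj V := Hom F (G.param V)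
  map R _ _ _ _ f := paramHomMap F G d f
  map_id R _ _ V := by
    let ρ : MvPolynomial PEmpty.{u + 1} k →ₐ[k] R := MvPolynomial.aeval PEmpty.elim
    have h : paramHomMap F G d (LinearMap.id : MvPolynomial PEmpty.{u + 1} k ⊗[k] V →ₗ[_] _) =
        LinearMap.id := by
      apply LinearMap.ext
      intro x
      apply hom_separated
      intro W y
      rw [eval_paramHomMap F hG, (G.paramLeft W).map_id]
      rfl
    apply linearMap_ext_one
    intro φ
    rw [show (1 : R) ⊗ₜ φ = extScalars ρ _ (1 ⊗ₜ φ) by simp [extScalars],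
      paramHomMap_extScalars F G d ρ LinearMap.id _ (fun _ => rfl), h]
    rfl
  map_comp R _ _ U V W g f := by
    let P := MvPolynomial (ULift.{u} (MatIndex U V ⊕ MatIndex V W)) k
    let ρ : P →ₐ[k] R := MvPolynomial.aeval fun p => Sum.elim (toMat f) (toMat g) p.down
    let mf : MatIndex U V → P := fun p => MvPolynomial.X (ULift.up (Sum.inl p))
    let mg : MatIndex V W → P := fun p => MvPolynomial.X (ULift.up (Sum.inr p))
    have hmf : ∀ p, toMat f p = ρ (mf p) := fun p =>
      (MvPolynomial.aeval_X (fun p : ULift.{u} (MatIndex U V ⊕ MatIndex V W) =>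
        Sum.elim (toMat f) (toMat g) p.down) (ULift.up (Sum.inl p))).symm
    have hmg : ∀ p, toMat g p = ρ (mg p) := fun p =>
      (MvPolynomial.aeval_X (fun p : ULift.{u} (MatIndex U V ⊕ MatIndex V W) =>
        Sum.elim (toMat f) (toMat g) p.down) (ULift.up (Sum.inr p))).symm
    have hf := rel_of_toMat ρ mf f hmf
    have hg := rel_of_toMat ρ mg g hmg
    have hgf : ∀ x, (g ∘ₗ f) (extScalars ρ U x) =
        extScalars ρ W ((ofMat mg ∘ₗ ofMat mf) x) := by
      intro x
      rw [LinearMap.comp_apply, hf, hg]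
      rfl
    have h : paramHomMap F G d (ofMat mg ∘ₗ ofMat mf) =
        paramHomMap F G d (ofMat mg) ∘ₗ paramHomMap F G d (ofMat mf) := by
      apply LinearMap.ext
      intro x
      apply hom_separated
      intro Z y
      rw [LinearMap.comp_apply, eval_paramHomMap F hG, eval_paramHomMap F hG,
        eval_paramHomMap F hG, (G.paramLeft Z).map_comp]
      rfl
    apply linearMap_ext_one
    intro φ
    rw [show (1 : R) ⊗ₜ φ = extScalars ρ _ (1 ⊗ₜ φ) by simp [extScalars],
      paramHomMap_extScalars F G d ρ _ _ hgf, LinearMap.comp_apply,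
      paramHomMap_extScalars F G d ρ _ _ hf, paramHomMap_extScalars F G d ρ _ _ hg, h]
    rfl
  map_extScalars ρ _ _ f g h := paramHomMap_extScalars F G d ρ f g h

theorem IsHomogeneous.paramHom (F : PolyFunctor.{u, v} k) {G : PolyFunctor.{u, w} k} {d : ℕ}
    (hG : G.IsHomogeneous d) : (paramHom F G hG).IsHomogeneous d := by
  intro R _ _ V V' r f
  change paramHomMap F G d _ = r ^ d • paramHomMap F G d _
  apply linearMap_ext_one
  intro φ
  rw [LinearMap.smul_apply, paramHomMap_one_tmul, paramHomMap_one_tmul, Finset.smul_sum]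
  refine Finset.sum_congr rfl fun α hα => ?_
  rw [TensorProduct.smul_tmul']
  congr 1
  rw [toMat_smul]
  simp only [Finsupp.prod, Pi.smul_apply, smul_eq_mul, mul_pow, Finset.prod_mul_distrib,
    Finset.prod_pow_eq_pow_sum]
  rw [Finset.mem_finsuppAntidiag] at hα
  rw [← hα.1, Finset.sum_subset (Finset.subset_univ α.support)]
  intro p _ hp
  simpa using hp

/-- The functoriality of `paramHom` in the second variable. -/
def paramHomPost (F : PolyFunctor.{u, v} k) {G : PolyFunctor.{u, w} k} {G' : PolyFunctor.{u, w'} k}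
    {d d' : ℕ} (hG : G.IsHomogeneous d) (hG' : G'.IsHomogeneous d') (φ : Hom G G') :
    Hom (paramHom F G hG) (paramHom F G' hG') :=
  ⟨fun V => Hom.comp (F := F) (paramMap φ V), map_induction _ fun σ V V' f => by
    apply LinearMap.ext
    intro x
    apply hom_separated
    intro W y
    have key : ∀ (V : FGProj k) (x : MvPolynomial σ k ⊗[k] Hom F (G.param V)),
        (evalHom F (G'.param V) W y).baseChange (MvPolynomial σ k)
          ((Hom.comp (F := F) (paramMap φ V)).baseChange (MvPolynomial σ k) x) =
        (φ.app (V.tensor W)).baseChange (MvPolynomial σ k)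
          ((evalHom F (G.param V) W y).baseChange (MvPolynomial σ k) x) := by
      intro V x
      rw [← LinearMap.comp_apply, ← LinearMap.comp_apply, ← LinearMap.baseChange_comp,
        ← LinearMap.baseChange_comp]
      rfl
    rw [LinearMap.comp_apply, LinearMap.comp_apply, key, eval_paramHomMap F hG,
      eval_paramHomMap F hG', key]
    exact φ.naturality_apply _ (V := V.tensor W) (W := V'.tensor W) _ _⟩

end PolyFunctor

namespace PolyFunctor

variable {k : Type u} [CommRing k]

open FGProj

/-- Evaluation at an element of `F(W)`, as a morphism of strict polynomial functors in `V`. -/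
def evalParamHom (F : PolyFunctor.{u, v} k) {G : PolyFunctor.{u, w} k} {d : ℕ}
    (hG : G.IsHomogeneous d) (W : FGProj k) (y : F.obj W) : Hom (paramHom F G hG) (G.paramLeft W) :=
  ⟨fun V => evalHom F (G.param V) W y, fun _ _ _ _ _ f =>
    LinearMap.ext fun x => eval_paramHomMap F hG f W y x⟩

/-- A family of linear maps into the modules `Hom(F, G(V ⊗ -))` is a morphism of strict polynomial
functors in `V` as soon as all its values are. -/
def toParamHom {X : PolyFunctor.{u, v'} k} {F : PolyFunctor.{u, v} k} {G : PolyFunctor.{u, w} k}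
    {d : ℕ} (hG : G.IsHomogeneous d) (φ : ∀ V, X.obj V →ₗ[k] Hom F (G.param V))
    (h : ∀ W y, ∃ ψ : Hom X (G.paramLeft W), ∀ V x, ψ.app V x = (φ V x).app W y) :
    Hom X (paramHom F G hG) :=
  ⟨φ, map_induction _ fun σ V V' f => by
    apply LinearMap.ext
    intro x
    apply hom_separated
    intro W y
    obtain ⟨ψ, hψ⟩ := h W y
    have key : ∀ (V : FGProj k) (x : MvPolynomial σ k ⊗[k] X.obj V),
        (evalHom F (G.param V) W y).baseChange (MvPolynomial σ k)
          ((φ V).baseChange (MvPolynomial σ k) x) =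
        (ψ.app V).baseChange (MvPolynomial σ k) x := by
      intro V x
      rw [← LinearMap.comp_apply, ← LinearMap.baseChange_comp]
      congr 2
      ext z
      exact (hψ V z).symm
    rw [LinearMap.comp_apply, LinearMap.comp_apply, key, eval_paramHomMap F hG, key]
    exact ψ.naturality_apply _ f x⟩

/-- The linear map `F(V) → F(W)` induced by a linear map `V → W`. -/
def linMap (F : PolyFunctor.{u, v} k) {V W : FGProj k} (g : V →ₗ[k] W) : F.obj V →ₗ[k] F.obj W :=
  (TensorProduct.lid k (F.obj W)).toLinearMap ∘ₗ F.map k (g.baseChange k) ∘ₗ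
    TensorProduct.mk k k (F.obj V) 1

theorem map_baseChange (F : PolyFunctor.{u, v} k) {V W : FGProj k} (g : V →ₗ[k] W)
    (R : Type u) [CommRing R] [Algebra k R] :
    F.map R (g.baseChange R) = (F.linMap g).baseChange R := by
  apply linearMap_ext_one
  intro x
  have h := F.map_extScalars (Algebra.ofId k R) (g.baseChange k) (g.baseChange R)
    (fun x => baseChange_extScalars _ g x) (1 ⊗ₜ x)
  rw [extScalars, LinearMap.rTensor_tmul, AlgHom.toLinearMap_apply, map_one] at h
  rw [h, LinearMap.baseChange_tmul, linMap, LinearMap.comp_apply, LinearMap.comp_apply,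
    TensorProduct.mk_apply]
  generalize F.map k (g.baseChange k) (1 ⊗ₜ x) = y
  induction y with
  | zero => simp
  | add x y hx hy => simp only [map_add, hx, hy, TensorProduct.tmul_add]
  | tmul c m =>
    simp [extScalars, Algebra.ofId_apply, Algebra.algebraMap_eq_smul_one,
      TensorProduct.smul_tmul']

/-- The direct sum of two `R`-linear maps `R ⊗ M → R ⊗ M'` and `R ⊗ N → R ⊗ N'`. -/
def bcProd {R : Type u} [CommRing R] [Algebra k R]
    {M M' N N' : Type*} [AddCommGroup M] [AddCommGroup M'] [AddCommGroup N] [AddCommGroup N']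
    [Module k M] [Module k M'] [Module k N] [Module k N']
    (f : R ⊗[k] M →ₗ[R] R ⊗[k] M') (g : R ⊗[k] N →ₗ[R] R ⊗[k] N') :
    R ⊗[k] (M × N) →ₗ[R] R ⊗[k] (M' × N') :=
  (TensorProduct.prodRight k R R M' N').symm.toLinearMap ∘ₗ LinearMap.prodMap f g ∘ₗ
    (TensorProduct.prodRight k R R M N).toLinearMap

theorem prodRight_extScalars {R S : Type u} [CommRing R] [Algebra k R] [CommRing S] [Algebra k S]
    (ρ : R →ₐ[k] S) {M N : Type*} [AddCommGroup M] [AddCommGroup N] [Module k M] [Module k N]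
    (x : R ⊗[k] (M × N)) : TensorProduct.prodRight k S S M N (extScalars ρ _ x) =
      (extScalars ρ M (TensorProduct.prodRight k R R M N x).1,
        extScalars ρ N (TensorProduct.prodRight k R R M N x).2) := by
  induction x with
  | zero => simp only [map_zero]; rfl
  | add x y hx hy => simp only [map_add, hx, hy, Prod.fst_add, Prod.snd_add, Prod.mk_add_mk]
  | tmul r m => simp [extScalars]

/-- The functor `V ↦ F(V ⊕ V)`. -/
@[reducible] def double (F : PolyFunctor.{u, v} k) : PolyFunctor.{u, v} k where
  obj V := F.obj (V.prod V)
  map R _ _ V W f := F.map R (V := V.prod V) (W := W.prod W) (bcProd f f)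
  map_id R _ _ V := by
    rw [← F.map_id]
    congr 1
    apply LinearMap.ext
    intro x
    simp [bcProd]
  map_comp R _ _ U V W g f := by
    rw [← F.map_comp]
    congr 1
    apply LinearMap.ext
    intro x
    simp [bcProd]
  map_extScalars {R S} _ _ _ _ ρ V W f g h := F.map_extScalars ρ _ _ fun x => by
    apply (TensorProduct.prodRight k S S W W).injective
    rw [prodRight_extScalars]
    simp [bcProd, prodRight_extScalars, h]

/-- A linear map `V → V ⊕ V` natural in `V` induces a morphism `F(V) → F(V ⊕ V)`. -/
def toDouble (F : PolyFunctor.{u, v} k) (l : ∀ V : FGProj k, V →ₗ[k] V.prod V)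
    (h : ∀ (R : Type u) [CommRing R] [Algebra k R] (V W : FGProj k)
      (f : R ⊗[k] V →ₗ[R] R ⊗[k] W),
      (l W).baseChange R ∘ₗ f = bcProd f f ∘ₗ (l V).baseChange R) : Hom F (double F) :=
  ⟨fun V => F.linMap (l V), fun R _ _ V W f => by
    rw [← map_baseChange, ← map_baseChange]
    exact (F.map_comp R (W := W.prod W) _ f).symm.trans
      ((congrArg (F.map R (W := W.prod W)) (h R V W f)).trans
        (F.map_comp R (V := V.prod V) (W := W.prod W) (bcProd f f) _))⟩

theorem bcProd_inl (R : Type u) [CommRing R] [Algebra k R] (V W : FGProj k)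
    (f : R ⊗[k] V →ₗ[R] R ⊗[k] W) : (LinearMap.inl k W W).baseChange R ∘ₗ f =
      bcProd f f ∘ₗ (LinearMap.inl k V V).baseChange R := by
  have key : ∀ (U : FGProj k) (x : R ⊗[k] U), TensorProduct.prodRight k R R U U
      ((LinearMap.inl k U U).baseChange R x) = (x, 0) := by
    intro U x
    induction x with
    | zero => simp only [map_zero]; rfl
    | add x y hx hy => simp only [map_add, hx, hy, Prod.mk_add_mk, add_zero]
    | tmul r m => simp
  apply LinearMap.ext
  intro x
  apply (TensorProduct.prodRight k R R W W).injective
  simp [bcProd, key]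

theorem bcProd_inr (R : Type u) [CommRing R] [Algebra k R] (V W : FGProj k)
    (f : R ⊗[k] V →ₗ[R] R ⊗[k] W) : (LinearMap.inr k W W).baseChange R ∘ₗ f =
      bcProd f f ∘ₗ (LinearMap.inr k V V).baseChange R := by
  have key : ∀ (U : FGProj k) (x : R ⊗[k] U), TensorProduct.prodRight k R R U U
      ((LinearMap.inr k U U).baseChange R x) = (0, x) := by
    intro U x
    induction x with
    | zero => simp only [map_zero]; rfl
    | add x y hx hy => simp only [map_add, hx, hy, Prod.mk_add_mk, add_zero]
    | tmul r m => simp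
  apply LinearMap.ext
  intro x
  apply (TensorProduct.prodRight k R R W W).injective
  simp [bcProd, key]

theorem bcProd_diag (R : Type u) [CommRing R] [Algebra k R] (V W : FGProj k)
    (f : R ⊗[k] V →ₗ[R] R ⊗[k] W) :
    (LinearMap.prod (LinearMap.id : W →ₗ[k] W) LinearMap.id).baseChange R ∘ₗ f =
      bcProd f f ∘ₗ (LinearMap.prod (LinearMap.id : V →ₗ[k] V) LinearMap.id).baseChange R := by
  have key : ∀ (U : FGProj k) (x : R ⊗[k] U), TensorProduct.prodRight k R R U U
      ((LinearMap.prod (LinearMap.id : U →ₗ[k] U) LinearMap.id).baseChange R x) = (x, x) := by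
    intro U x
    induction x with
    | zero => simp only [map_zero]; rfl
    | add x y hx hy => simp only [map_add, hx, hy, Prod.mk_add_mk]
    | tmul r m => simp
  apply LinearMap.ext
  intro x
  apply (TensorProduct.prodRight k R R W W).injective
  simp [bcProd, key]

/-- The inverse of a bijective morphism. -/
def homInv {F : PolyFunctor.{u, v} k} {G : PolyFunctor.{u, w} k} (φ : Hom F G)
    (h : ∀ V, Function.Bijective (φ.app V)) : Hom G F :=
  ⟨fun V => (LinearEquiv.ofBijective (φ.app V) (h V)).symm.toLinearMap, fun R _ _ V W f => by
    have h1 : ∀ U, (LinearEquiv.ofBijective (φ.app U) (h U)).symm.toLinearMap.baseChange R ∘ₗ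
        (φ.app U).baseChange R = LinearMap.id := by
      intro U
      rw [← LinearMap.baseChange_comp, ← LinearMap.baseChange_id]
      congr 1
      ext x
      exact (LinearEquiv.ofBijective (φ.app U) (h U)).symm_apply_apply x
    have h2 : ∀ U, (φ.app U).baseChange R ∘ₗ
        (LinearEquiv.ofBijective (φ.app U) (h U)).symm.toLinearMap.baseChange R =
        LinearMap.id := by
      intro U
      rw [← LinearMap.baseChange_comp, ← LinearMap.baseChange_id]
      congr 1
      ext x
      exact (LinearEquiv.ofBijective (φ.app U) (h U)).apply_symm_apply x
    apply LinearMap.ext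
    intro y
    obtain ⟨x, rfl⟩ : ∃ x, (φ.app V).baseChange R x = y := ⟨_, LinearMap.congr_fun (h2 V) y⟩
    rw [LinearMap.comp_apply, LinearMap.comp_apply, ← φ.naturality_apply]
    exact (LinearMap.congr_fun (h1 W) _).trans
      (congrArg (F.map R f) (LinearMap.congr_fun (h1 V) x).symm)⟩

/-- The projection of a direct sum onto a summand. -/
def directSumπ {ι : Type w} [DecidableEq ι] (F : ι → PolyFunctor.{u, v} k) (i : ι) :
    Hom (directSum F) (F i) :=
  directSumDesc fun j => if h : j = i then by subst h; exact Hom.id _ else 0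

theorem Hom.zero_app {F : PolyFunctor.{u, v} k} {G : PolyFunctor.{u, w} k} (V : FGProj k)
    (x : F.obj V) : (0 : Hom F G).app V x = 0 := rfl

/-- The functoriality of `F ↦ F(- ⊗ W)`. -/
def paramLeftMap {G : PolyFunctor.{u, v} k} {H : PolyFunctor.{u, w} k} (φ : Hom G H)
    (W : FGProj k) : Hom (G.paramLeft W) (H.paramLeft W) :=
  ⟨fun V => φ.app (V.tensor W), fun R _ _ _ _ _ => φ.naturality R _⟩

theorem exists_tensorEval {F F' : PolyFunctor.{u, v} k} {A B C : PolyFunctor.{u, w} k}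
    (m : Hom (tensor A B) C) {d e : ℕ} (hA : A.IsHomogeneous d) (hB : B.IsHomogeneous e)
    (W : FGProj k) (t : F.obj W ⊗[k] F'.obj W) :
    ∃ ψ : Hom (tensor (paramHom F A hA) (paramHom F' B hB)) (C.paramLeft W),
      ∀ (V : FGProj k) (φ : Hom F (A.param V)) (φ' : Hom F' (B.param V)), ψ.app V (φ ⊗ₜ φ') =
        m.app (V.tensor W) (TensorProduct.map (φ.app W) (φ'.app W) t) := by
  induction t with
  | zero => exact ⟨0, fun V φ φ' => by rw [map_zero, map_zero, Hom.zero_app]⟩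
  | add t t' ht ht' =>
    obtain ⟨ψ, hψ⟩ := ht
    obtain ⟨ψ', hψ'⟩ := ht'
    refine ⟨ψ + ψ', fun V φ φ' => ?_⟩
    rw [Hom.add_app, LinearMap.add_apply, hψ, hψ', map_add, map_add]
  | tmul a b =>
    exact ⟨Hom.comp (G := tensor (A.paramLeft W) (B.paramLeft W)) (paramLeftMap m W)
      (tensorHom (evalParamHom F hA W a) (evalParamHom F' hB W b)), fun V φ φ' => rfl⟩

end PolyFunctor

open PolyFunctor

/-- A strict polynomial algebra concentrated in degree `0`: functors `obj d`, homogeneous of weight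
`d`, with a unit and an associative multiplication. -/
structure PolyAlgebra (k : Type u) [CommRing k] where
  obj : ℕ → PolyFunctor.{u, v} k
  homogeneous : ∀ d, (obj d).IsHomogeneous d
  unit : Hom (const k) (obj 0)
  mul : ∀ {d e n : ℕ}, d + e = n → Hom (tensor (obj d) (obj e)) (obj n)
  one_mul : ∀ (d : ℕ) (V : FGProj k) (x : (obj d).obj V),
    (mul (zero_add d)).app V (unit.app V (1 : k) ⊗ₜ x) = x
  mul_one : ∀ (d : ℕ) (V : FGProj k) (x : (obj d).obj V),
    (mul (add_zero d)).app V (x ⊗ₜ unit.app V (1 : k)) = x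
  mul_assoc : ∀ {a b c ab bc n : ℕ} (hab : a + b = ab) (hbc : b + c = bc) (h : ab + c = n)
    (h' : a + bc = n) (V : FGProj k) (x : (obj a).obj V) (y : (obj b).obj V) (z : (obj c).obj V),
    (mul h).app V ((mul hab).app V (x ⊗ₜ y) ⊗ₜ z) = (mul h').app V (x ⊗ₜ (mul hbc).app V (y ⊗ₜ z))

namespace PolyAlgebra

variable {k : Type u} [CommRing k]

/-- Commutativity: `xy = yx`. -/
def IsCommutative (E : PolyAlgebra.{u, v} k) : Prop :=
  ∀ {d e n : ℕ} (h : d + e = n) (h' : e + d = n) (V : FGProj k) (x : (E.obj d).obj V)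
    (y : (E.obj e).obj V), (E.mul h).app V (x ⊗ₜ y) = (E.mul h').app V (y ⊗ₜ x)

/-- The weight `n` part of the exponential map `E(V) ⊗ E(W) → E(V ⊕ W)`, the composite of
`E(ι_V) ⊗ E(ι_W)` with the multiplication of `E(V ⊕ W)`. -/
def expMap (E : PolyAlgebra.{u, v} k) (n : ℕ) (V W : FGProj k) :
    (DirectSum {p : ℕ × ℕ // p.1 + p.2 = n} fun p =>
      (E.obj p.1.1).obj V ⊗[k] (E.obj p.1.2).obj W) →ₗ[k] (E.obj n).obj (V.prod W) :=
  DirectSum.toModule k _ _ fun p => (E.mul p.2).app (V.prod W) ∘ₗ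
    TensorProduct.map ((E.obj p.1.1).linMap (W := V.prod W) (LinearMap.inl k V W))
      ((E.obj p.1.2).linMap (W := V.prod W) (LinearMap.inr k V W))

/-- `E` is an exponential functor: its components have finitely generated projective values, and
`E(V) ⊗ E(W) → E(V ⊕ W)` and the unit `k → E(0)` (that is, `k → E₀`) are isomorphisms. -/
structure IsExponential (E : PolyAlgebra.{u, v} k) : Prop where
  finite : ∀ d V, Module.Finite k ((E.obj d).obj V)
  projective : ∀ d V, Module.Projective k ((E.obj d).obj V)
  unit_bijective : ∀ V, Function.Bijective (E.unit.app V)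
  exp_bijective : ∀ n V W, Function.Bijective (E.expMap n V W)

/-- The exponential map for `V = W`, as a morphism of strict polynomial functors. -/
def expHom (E : PolyAlgebra.{u, v} k) (n : ℕ) :
    Hom (directSum fun p : {p : ℕ × ℕ // p.1 + p.2 = n} => tensor (E.obj p.1.1) (E.obj p.1.2))
      (double (E.obj n)) :=
  directSumDesc fun p => Hom.comp
    (⟨fun V => (E.mul p.2).app (V.prod V), fun R _ _ _ _ _ => (E.mul p.2).naturality R _⟩ :
      Hom (tensor (double (E.obj p.1.1)) (double (E.obj p.1.2))) (double (E.obj n)))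
    (tensorHom (toDouble (E.obj p.1.1) (fun V => LinearMap.inl k V V) bcProd_inl)
      (toDouble (E.obj p.1.2) (fun V => LinearMap.inr k V V) bcProd_inr))

theorem expHom_app (E : PolyAlgebra.{u, v} k) (n : ℕ) (V : FGProj k) :
    (E.expHom n).app V = E.expMap n V V := rfl

/-- The comultiplication `E_n → E_d ⊗ E_e` of an exponential functor: the component of
`E(V) → E(V ⊕ V) ≃ E(V) ⊗ E(V)`, where the first map is induced by the diagonal of `V`. -/
def comul (E : PolyAlgebra.{u, v} k) (hE : E.IsExponential) {d e n : ℕ} (h : d + e = n) :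
    Hom (E.obj n) (tensor (E.obj d) (E.obj e)) :=
  Hom.comp (directSumπ (fun p : {p : ℕ × ℕ // p.1 + p.2 = n} =>
      tensor (E.obj p.1.1) (E.obj p.1.2)) ⟨(d, e), h⟩)
    (Hom.comp (homInv (E.expHom n) fun V => hE.exp_bijective n V V)
      (toDouble (E.obj n) (fun V => LinearMap.prod LinearMap.id LinearMap.id) bcProd_diag))

/-- The counit `E₀ → k` of an exponential functor, the inverse of the unit. -/
def counit (E : PolyAlgebra.{u, v} k) (hE : E.IsExponential) : Hom (E.obj 0) (const k) :=
  homInv E.unit hE.unit_bijective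

end PolyAlgebra

/-- The data of a strict polynomial differential graded augmented algebra over `k`: functors
`obj i d` of degree `i` and weight `d`, with a unit, a multiplication, a differential of degree
`-1` and an augmentation. The other axioms are in `PolyDga.IsCdga`. -/
structure PolyDga (k : Type u) [CommRing k] where
  obj : ℤ → ℕ → PolyFunctor.{u, w} k
  homogeneous : ∀ i d, (obj i d).IsHomogeneous d
  unit : Hom (const k) (obj 0 0)
  mul : ∀ {i j l : ℤ} {d e n : ℕ}, i + j = l → d + e = n →
    Hom (tensor (obj i d) (obj j e)) (obj l n)
  diff : ∀ {i j : ℤ} (_ : j + 1 = i) (d : ℕ), Hom (obj i d) (obj j d)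
  aug : Hom (obj 0 0) (const k)
  aug_unit : ∀ (V : FGProj k) (c : k), aug.app V (unit.app V c) = c

/-- The sign `(-1) ^ n` in `k`. -/
def ksign (k : Type u) [CommRing k] (n : ℤ) : k := ((Int.negOnePow n : ℤ) : k)

namespace PolyDga

variable {k : Type u} [CommRing k]

/-- The augmentation in degree `i` and weight `d`, which is zero unless `i = 0` and `d = 0`. -/
def augAt (A : PolyDga.{u, w} k) (i : ℤ) (d : ℕ) : Hom (A.obj i d) (const k) :=
  if h : i = 0 ∧ d = 0 then by
    obtain ⟨hi, hd⟩ := h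
    subst hi hd
    exact A.aug
  else 0

/-- The axioms of commutative differential graded augmented algebras. -/
structure IsCdga (A : PolyDga.{u, w} k) : Prop where
  one_mul : ∀ (i : ℤ) (d : ℕ) (V : FGProj k) (x : (A.obj i d).obj V),
    (A.mul (zero_add i) (zero_add d)).app V (A.unit.app V (1 : k) ⊗ₜ x) = x
  mul_one : ∀ (i : ℤ) (d : ℕ) (V : FGProj k) (x : (A.obj i d).obj V),
    (A.mul (add_zero i) (add_zero d)).app V (x ⊗ₜ A.unit.app V (1 : k)) = x
  mul_assoc : ∀ {i₁ i₂ i₃ i₁₂ i₂₃ i : ℤ} {d₁ d₂ d₃ d₁₂ d₂₃ d : ℕ}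
    (hi₁₂ : i₁ + i₂ = i₁₂) (hi₂₃ : i₂ + i₃ = i₂₃) (hi : i₁₂ + i₃ = i) (hi' : i₁ + i₂₃ = i)
    (hd₁₂ : d₁ + d₂ = d₁₂) (hd₂₃ : d₂ + d₃ = d₂₃) (hd : d₁₂ + d₃ = d) (hd' : d₁ + d₂₃ = d)
    (V : FGProj k) (x : (A.obj i₁ d₁).obj V) (y : (A.obj i₂ d₂).obj V) (z : (A.obj i₃ d₃).obj V),
    (A.mul hi hd).app V ((A.mul hi₁₂ hd₁₂).app V (x ⊗ₜ y) ⊗ₜ z) =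
      (A.mul hi' hd').app V (x ⊗ₜ (A.mul hi₂₃ hd₂₃).app V (y ⊗ₜ z))
  mul_comm : ∀ {i j l : ℤ} {d e n : ℕ} (hi : i + j = l) (hi' : j + i = l) (hd : d + e = n)
    (hd' : e + d = n) (V : FGProj k) (x : (A.obj i d).obj V) (y : (A.obj j e).obj V),
    (A.mul hi hd).app V (x ⊗ₜ y) = ksign k (i * j) • (A.mul hi' hd').app V (y ⊗ₜ x)
  diff_diff : ∀ {i j l : ℤ} (hj : j + 1 = i) (hl : l + 1 = j) (d : ℕ) (V : FGProj k)
    (x : (A.obj i d).obj V), (A.diff hl d).app V ((A.diff hj d).app V x) = 0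
  diff_mul : ∀ {i j l i' j' l' : ℤ} {d e n : ℕ} (h : i + j = l) (h₁ : i' + j = l')
    (h₂ : i + j' = l') (hi : i' + 1 = i) (hj : j' + 1 = j) (hl : l' + 1 = l) (hd : d + e = n)
    (V : FGProj k) (x : (A.obj i d).obj V) (y : (A.obj j e).obj V),
    (A.diff hl n).app V ((A.mul h hd).app V (x ⊗ₜ y)) =
      (A.mul h₁ hd).app V ((A.diff hi d).app V x ⊗ₜ y) +
        ksign k i • (A.mul h₂ hd).app V (x ⊗ₜ (A.diff hj e).app V y)
  aug_mul : ∀ {i j l : ℤ} {d e n : ℕ} (hi : i + j = l) (hd : d + e = n) (V : FGProj k)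
    (x : (A.obj i d).obj V) (y : (A.obj j e).obj V),
    (A.augAt l n).app V ((A.mul hi hd).app V (x ⊗ₜ y)) =
      ((A.augAt i d).app V x * (A.augAt j e).app V y : k)
  aug_diff : ∀ (V : FGProj k) (x : (A.obj 1 0).obj V),
    A.aug.app V ((A.diff (zero_add 1) 0).app V x) = 0

/-- All the components take projective values. -/
def HasProjectiveValues (A : PolyDga.{u, w} k) : Prop :=
  ∀ i d V, Module.Projective k ((A.obj i d).obj V)

/-- A morphism of augmented differential graded algebras. -/
structure Hom (A : PolyDga.{u, w} k) (B : PolyDga.{u, w'} k) where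
  hom : ∀ i d, PolyFunctor.Hom (A.obj i d) (B.obj i d)
  map_unit : ∀ (V : FGProj k) (c : k), (hom 0 0).app V (A.unit.app V c) = B.unit.app V c
  map_mul : ∀ {i j l : ℤ} {d e n : ℕ} (hi : i + j = l) (hd : d + e = n) (V : FGProj k)
    (x : (A.obj i d).obj V) (y : (A.obj j e).obj V),
    (hom l n).app V ((A.mul hi hd).app V (x ⊗ₜ y)) =
      (B.mul hi hd).app V ((hom i d).app V x ⊗ₜ (hom j e).app V y)
  map_diff : ∀ {i j : ℤ} (h : j + 1 = i) (d : ℕ) (V : FGProj k) (x : (A.obj i d).obj V),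
    (hom j d).app V ((A.diff h d).app V x) = (B.diff h d).app V ((hom i d).app V x)
  map_aug : ∀ (V : FGProj k) (x : (A.obj 0 0).obj V),
    B.aug.app V ((hom 0 0).app V x) = A.aug.app V x

/-- An isomorphism of augmented differential graded algebras. -/
structure Iso (A : PolyDga.{u, w} k) (B : PolyDga.{u, w'} k) where
  toHom : Hom A B
  invHom : Hom B A
  inv_hom : ∀ i d V x, (invHom.hom i d).app V ((toHom.hom i d).app V x) = x
  hom_inv : ∀ i d V x, (toHom.hom i d).app V ((invHom.hom i d).app V x) = x

section Conv

variable (E : PolyAlgebra.{u, v} k) (hE : E.IsExponential)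

/-- The convolution product `φ ⋆ ψ` of `φ : E_d → A(V ⊗ -)` and `ψ : E_e → B(V ⊗ -)`: the composite
of the comultiplication of `E`, of `φ ⊗ ψ` and of `m : A ⊗ B → C`. -/
def starProd {A : PolyFunctor.{u, w} k} {B : PolyFunctor.{u, w} k} {C : PolyFunctor.{u, w} k}
    (m : PolyFunctor.Hom (tensor A B) C) {d e n : ℕ} (h : d + e = n) (V : FGProj k) :
    PolyFunctor.Hom (E.obj d) (A.param V) →ₗ[k] PolyFunctor.Hom (E.obj e) (B.param V) →ₗ[k]
      PolyFunctor.Hom (E.obj n) (C.param V) :=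
  LinearMap.mk₂ k (fun φ ψ => PolyFunctor.Hom.comp
      (G := tensor (A.param V) (B.param V)) (paramMap m V)
      (PolyFunctor.Hom.comp (tensorHom φ ψ) (E.comul hE h)))
    (fun φ φ' ψ => by
      rw [show tensorHom (φ + φ') ψ = tensorHom φ ψ + tensorHom φ' ψ from
        PolyFunctor.Hom.ext fun V x =>
          LinearMap.congr_fun (TensorProduct.map_add_left (φ.app V) (φ'.app V) (ψ.app V)) x]
      simp only [map_add, LinearMap.add_apply])
    (fun c φ ψ => by
      rw [show tensorHom (c • φ) ψ = c • tensorHom φ ψ from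
        PolyFunctor.Hom.ext fun V x =>
          LinearMap.congr_fun (TensorProduct.map_smul_left c (φ.app V) (ψ.app V)) x]
      simp only [map_smul, LinearMap.smul_apply])
    (fun φ ψ ψ' => by
      rw [show tensorHom φ (ψ + ψ') = tensorHom φ ψ + tensorHom φ ψ' from
        PolyFunctor.Hom.ext fun V x =>
          LinearMap.congr_fun (TensorProduct.map_add_right (φ.app V) (ψ.app V) (ψ'.app V)) x]
      simp only [map_add, LinearMap.add_apply])
    (fun c φ ψ => by
      rw [show tensorHom φ (c • ψ) = c • tensorHom φ ψ from
        PolyFunctor.Hom.ext fun V x =>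
          LinearMap.congr_fun (TensorProduct.map_smul_right c (φ.app V) (ψ.app V)) x]
      simp only [map_smul, LinearMap.smul_apply])

theorem starProd_app {A : PolyFunctor.{u, w} k} {B : PolyFunctor.{u, w} k}
    {C : PolyFunctor.{u, w} k} (m : PolyFunctor.Hom (tensor A B) C) {d e n : ℕ} (h : d + e = n)
    (V W : FGProj k) (φ : PolyFunctor.Hom (E.obj d) (A.param V))
    (ψ : PolyFunctor.Hom (E.obj e) (B.param V)) (y : (E.obj n).obj W) :
    PolyFunctor.Hom.app (starProd E hE m h V φ ψ) W y =
      m.app (V.tensor W) (TensorProduct.map (φ.app W) (ψ.app W) ((E.comul hE h).app W y)) := rfl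

/-- The convolution product as a morphism of strict polynomial functors. -/
def starHom {A : PolyFunctor.{u, w} k} {B : PolyFunctor.{u, w} k} {C : PolyFunctor.{u, w} k}
    (m : PolyFunctor.Hom (tensor A B) C) {d e n : ℕ} (h : d + e = n)
    (hA : A.IsHomogeneous d) (hB : B.IsHomogeneous e) (hC : C.IsHomogeneous n) :
    PolyFunctor.Hom (tensor (paramHom (E.obj d) A hA) (paramHom (E.obj e) B hB))
      (paramHom (E.obj n) C hC) :=
  toParamHom hC (fun V => TensorProduct.lift (starProd E hE m h V)) fun W y => by
    obtain ⟨ψ, hψ⟩ := exists_tensorEval m hA hB W ((E.comul hE h).app W y)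
    refine ⟨ψ, fun V => LinearMap.congr_fun (f := ψ.app V)
      (g := evalHom (E.obj n) (C.param V) W y ∘ₗ TensorProduct.lift (starProd E hE m h V)) ?_⟩
    apply TensorProduct.ext'
    intro φ φ'
    rw [hψ, LinearMap.comp_apply, TensorProduct.lift.tmul]
    have h0 := starProd_app E hE m h V W φ φ' y
    exact h0.symm

/-- The unit of `H(E, A)`: the composite of the counit of `E` and of the unit of `A`. -/
def convUnit {A : PolyFunctor.{u, w} k} (hA : A.IsHomogeneous 0)
    (η : PolyFunctor.Hom (const k) A) : PolyFunctor.Hom (const k) (paramHom (E.obj 0) A hA) :=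
  toParamHom hA (fun V => LinearMap.toSpanSingleton k (PolyFunctor.Hom (E.obj 0) (A.param V))
      (PolyFunctor.Hom.comp (G := const k) (paramMap η V) (E.counit hE))) fun W y =>
    ⟨PolyFunctor.Hom.comp (G := const k) (paramLeftMap η W)
        ((((E.counit hE).app W y : k)) • PolyFunctor.Hom.id (const k)), fun V c => by
      rw [LinearMap.toSpanSingleton_apply]
      change η.app (V.tensor W) (((E.counit hE).app W y : k) • (c : k)) =
          (c : k) • η.app (V.tensor W) ((E.counit hE).app W y)
      rw [← map_smul, smul_eq_mul, smul_eq_mul, mul_comm]⟩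

/-- The augmentation of `H(E, A)`: the value at the unit of `E`, followed by that of `A`. -/
def convAug {A : PolyFunctor.{u, w} k} (hA : A.IsHomogeneous 0)
    (ε : PolyFunctor.Hom A (const k)) : PolyFunctor.Hom (paramHom (E.obj 0) A hA) (const k) :=
  PolyFunctor.Hom.comp (G := A.paramLeft (FGProj.unit k)) (paramLeftMap ε (FGProj.unit k))
    (evalParamHom (E.obj 0) hA (FGProj.unit k) (E.unit.app (FGProj.unit k) (1 : k)))

theorem convAug_convUnit {A : PolyFunctor.{u, w} k} (hA : A.IsHomogeneous 0)
    (η : PolyFunctor.Hom (const k) A) (ε : PolyFunctor.Hom A (const k))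
    (h : ∀ (V : FGProj k) (c : k), ε.app V (η.app V c) = c) (V : FGProj k) (c : k) :
    (convAug E hA ε).app V ((convUnit E hE hA η).app V c) = c := by
  have h1 : (E.counit hE).app (FGProj.unit k) (E.unit.app (FGProj.unit k) (1 : k)) = (1 : k) :=
    (LinearEquiv.ofBijective _ (hE.unit_bijective (FGProj.unit k))).symm_apply_apply (1 : k)
  have h2 : (convAug E hA ε).app V ((convUnit E hE hA η).app V c) =
      ε.app (V.tensor (FGProj.unit k)) ((c : k) • η.app (V.tensor (FGProj.unit k))
        ((E.counit hE).app (FGProj.unit k) (E.unit.app (FGProj.unit k) (1 : k)))) := rfl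
  rw [h2, map_smul, h, h1]
  exact mul_one c

/-- The convolution algebra `H(E, A)` of an exponential functor `E` (with its comultiplication) and
an algebra `A`. Its component of degree `i` and weight `d` is `V ↦ Hom(E_d, A_{i,d}(V ⊗ -))`. -/
def convAlg (A : PolyDga.{u, w} k) : PolyDga.{u, max (u + 1) v w} k where
  obj i d := paramHom (E.obj d) (A.obj i d) (A.homogeneous i d)
  homogeneous i d := IsHomogeneous.paramHom (E.obj d) (A.homogeneous i d)
  unit := convUnit E hE (A.homogeneous 0 0) A.unit
  mul hi hd := starHom E hE (A.mul hi hd) hd _ _ _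
  diff hi d := paramHomPost (E.obj d) _ _ (A.diff hi d)
  aug := convAug E (A.homogeneous 0 0) A.aug
  aug_unit := convAug_convUnit E hE (A.homogeneous 0 0) A.unit A.aug A.aug_unit

/-- The map `H(E, A) → H(E, B)` induced by a family of morphisms `A_{i,d} → B_{i,d}`. -/
def convMap {A B : PolyDga.{u, w} k} (g : ∀ i d, PolyFunctor.Hom (A.obj i d) (B.obj i d))
    (i : ℤ) (d : ℕ) : PolyFunctor.Hom ((convAlg E hE A).obj i d) ((convAlg E hE B).obj i d) :=
  paramHomPost (E.obj d) (A.homogeneous i d) (B.homogeneous i d) (g i d)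

end Conv

end PolyDga

namespace PolyDga

variable {k : Type u} [CommRing k]

open PolyFunctor

section Bar

variable (A : PolyDga.{u, w} k)

/-- The natural projection of `A` onto its augmentation ideal. -/
def idealProj (i : ℤ) (d : ℕ) : PolyFunctor.Hom (A.obj i d) (A.obj i d) :=
  if h : i = 0 ∧ d = 0 then by
    obtain ⟨hi, hd⟩ := h
    subst hi hd
    exact PolyFunctor.Hom.id _ - PolyFunctor.Hom.comp (G := const k) A.unit A.aug
  else PolyFunctor.Hom.id _

theorem augAt_idealProj (i : ℤ) (d : ℕ) (V : FGProj k) (x : (A.obj i d).obj V) :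
    (A.augAt i d).app V ((A.idealProj i d).app V x) = 0 := by
  by_cases h : i = 0 ∧ d = 0
  · obtain ⟨rfl, rfl⟩ := h
    have h1 : (A.augAt 0 0).app V ((A.idealProj 0 0).app V x) =
        A.aug.app V (x - A.unit.app V (A.aug.app V x)) := rfl
    rw [h1, map_sub, A.aug_unit, sub_self]
  · rw [augAt, dif_neg h]
    rfl

theorem idealProj_of_augAt (i : ℤ) (d : ℕ) (V : FGProj k) (x : (A.obj i d).obj V)
    (hx : (A.augAt i d).app V x = 0) : (A.idealProj i d).app V x = x := by
  by_cases h : i = 0 ∧ d = 0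
  · obtain ⟨rfl, rfl⟩ := h
    have h1 : (A.idealProj 0 0).app V x = x - A.unit.app V (A.aug.app V x) := rfl
    have h2 : A.aug.app V x = 0 := hx
    rw [h1, h2, map_zero, sub_zero]
  · rw [idealProj, dif_neg h]
    rfl

/-- The component of degree `a.1` and weight `a.2` of the augmentation ideal `A' = ker ε`. -/
@[reducible] def ideal (a : ℤ × ℕ) : PolyFunctor.{u, w} k :=
  splitKer (A.augAt a.1 a.2) (A.idealProj a.1 a.2) (A.augAt_idealProj a.1 a.2)
    (A.idealProj_of_augAt a.1 a.2)

/-- The inclusion of the augmentation ideal. -/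
def idealι (a : ℤ × ℕ) : PolyFunctor.Hom (A.ideal a) (A.obj a.1 a.2) :=
  splitKerι (A.augAt a.1 a.2) (A.idealProj a.1 a.2) (A.augAt_idealProj a.1 a.2)
    (A.idealProj_of_augAt a.1 a.2)

/-- The projection onto the augmentation ideal. -/
def idealπ (a : ℤ × ℕ) : PolyFunctor.Hom (A.obj a.1 a.2) (A.ideal a) :=
  splitKerπ (A.augAt a.1 a.2) (A.idealProj a.1 a.2) (A.augAt_idealProj a.1 a.2)
    (A.idealProj_of_augAt a.1 a.2)

/-- The multiplication of the augmentation ideal. (The product of two elements of `A'` lies in `A'`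
when `A` satisfies the axioms, and then the projection onto `A'` does not change it.) -/
def idealMul (a b : ℤ × ℕ) :
    PolyFunctor.Hom (tensor (A.ideal a) (A.ideal b)) (A.ideal (a + b)) :=
  PolyFunctor.Hom.comp (A.idealπ (a + b)) (PolyFunctor.Hom.comp
    (A.mul (l := (a + b).1) (n := (a + b).2) rfl rfl) (tensorHom (A.idealι a) (A.idealι b)))

/-- The differential of the augmentation ideal. -/
def idealDiff (a : ℤ × ℕ) : PolyFunctor.Hom (A.ideal a) (A.ideal (a.1 - 1, a.2)) :=
  PolyFunctor.Hom.comp (A.idealπ (a.1 - 1, a.2))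
    (PolyFunctor.Hom.comp (A.diff (sub_add_cancel a.1 1) a.2) (A.idealι a))

end Bar

/-- The constant functor with value `k`, in a larger universe. -/
@[reducible] def constUp (k : Type u) [CommRing k] : PolyFunctor.{u, max u w} k where
  obj _ := ULift.{w} k
  map R _ _ _ _ _ := LinearMap.id
  map_id _ _ _ _ := rfl
  map_comp _ _ _ _ _ _ _ _ := rfl
  map_extScalars _ _ _ _ _ _ _ := rfl

/-- The canonical isomorphism between the two versions of the constant functor. -/
def constToUp (k : Type u) [CommRing k] : PolyFunctor.Hom (const k) (constUp.{u, w} k) :=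
  ⟨fun _ => ULift.moduleEquiv.symm.toLinearMap, fun _ _ _ _ _ _ => rfl⟩

/-- The inverse isomorphism. -/
def constDown (k : Type u) [CommRing k] : PolyFunctor.Hom (constUp.{u, w} k) (const k) :=
  ⟨fun _ => ULift.moduleEquiv.toLinearMap, fun _ _ _ _ _ _ => rfl⟩

/-- The degree of `[a₁|…|aₙ]`, where `aᵢ` has degree and weight given by the `i`-th letter. -/
def wordDeg (w : List (ℤ × ℕ)) : ℤ := (w.map fun a => a.1 + 1).sum

/-- The weight of `[a₁|…|aₙ]`. -/
def wordWt (w : List (ℤ × ℕ)) : ℕ := (w.map Prod.snd).sum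

section Bar

variable (A : PolyDga.{u, w} k)

/-- The functor `A'_{a₁} ⊗ (A'_{a₂} ⊗ ⋯ ⊗ (A'_{aₙ} ⊗ k))`, the summand of the bar construction
spanned by the elements `[x₁|…|xₙ]` where `xᵢ` has degree and weight given by `aᵢ`. -/
@[reducible] def word : List (ℤ × ℕ) → PolyFunctor.{u, max u w} k
  | [] => constUp k
  | a :: t => tensor (A.ideal a) (word t)

theorem word_homogeneous : ∀ t : List (ℤ × ℕ), (A.word t).IsHomogeneous (wordWt t)
  | [] => fun _ _ _ V W r f => by
      rw [wordWt, List.map_nil, List.sum_nil, pow_zero, one_smul]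
  | a :: t => by
      have h1 : (A.ideal a).IsHomogeneous a.2 := IsHomogeneous.splitKer (A.homogeneous a.1 a.2)
      have h := IsHomogeneous.tensor h1 (word_homogeneous t)
      rw [wordWt, List.map_cons, List.sum_cons]
      exact h

/-- The bar construction as an ungraded functor, the direct sum of all the `word t`. -/
@[reducible] def barTotal : PolyFunctor.{u, max u w} k := directSum A.word

/-- The inclusion of a summand. -/
def wordι (t : List (ℤ × ℕ)) : PolyFunctor.Hom (A.word t) A.barTotal := directSumι A.word t

/-- The map `x ⊗ [y₁|…|yₙ] ↦ [x|y₁|…|yₙ]`. -/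
def barCons (a : ℤ × ℕ) : PolyFunctor.Hom (tensor (A.ideal a) A.barTotal) A.barTotal :=
  tensorSumDesc fun t => A.wordι (a :: t)

/-- The map `x ⊗ [y₁|y₂|…|yₙ] ↦ [x y₁|y₂|…|yₙ]`, zero for `n = 0`. -/
def barContract (a : ℤ × ℕ) :
    ∀ t : List (ℤ × ℕ), PolyFunctor.Hom (tensor (A.ideal a) (A.word t)) A.barTotal
  | [] => 0
  | b :: t => PolyFunctor.Hom.comp (A.wordι ((a + b) :: t)) (PolyFunctor.Hom.comp
      (tensorHom (A.idealMul a b) (PolyFunctor.Hom.id (A.word t)))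
      (tensorAssocInv (A.ideal a) (A.ideal b) (A.word t)))

/-- The differential of the bar construction:
`∂[x|y] = -[∂x|y] + (-1) ^ (|x| + 1) [x|∂y] + (-1) ^ (|x| + 1) [x y₁|y₂|…|yₙ]`, where
`[y] = [y₁|…|yₙ]`. -/
def wordDiff : ∀ t : List (ℤ × ℕ), PolyFunctor.Hom (A.word t) A.barTotal
  | [] => 0
  | a :: t =>
      -(PolyFunctor.Hom.comp (A.wordι ((a.1 - 1, a.2) :: t))
          (tensorHom (A.idealDiff a) (PolyFunctor.Hom.id (A.word t)))) +
        ksign k (a.1 + 1) • PolyFunctor.Hom.comp (A.barCons a)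
          (tensorHom (PolyFunctor.Hom.id (A.ideal a)) (wordDiff t)) +
        ksign k (a.1 + 1) • A.barContract a t

/-- The map `(x ⊗ [y]) ⊗ [z] ↦ [x|f([y] ⊗ [z])]`. -/
def shuffleLeft (a : ℤ × ℕ) (s t : List (ℤ × ℕ))
    (f : PolyFunctor.Hom (tensor (A.word s) (A.word t)) A.barTotal) :
    PolyFunctor.Hom (tensor (A.word (a :: s)) (A.word t)) A.barTotal :=
  PolyFunctor.Hom.comp (A.barCons a) (PolyFunctor.Hom.comp
    (tensorHom (PolyFunctor.Hom.id (A.ideal a)) f)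
    (tensorAssoc (A.ideal a) (A.word s) (A.word t)))

/-- The map `[y] ⊗ (x ⊗ [z]) ↦ (-1) ^ (|[y]| (|x| + 1)) [x|f([y] ⊗ [z])]`. -/
def shuffleRight (b : ℤ × ℕ) (s t : List (ℤ × ℕ))
    (f : PolyFunctor.Hom (tensor (A.word s) (A.word t)) A.barTotal) :
    PolyFunctor.Hom (tensor (A.word s) (A.word (b :: t))) A.barTotal :=
  ksign k (wordDeg s * (b.1 + 1)) • PolyFunctor.Hom.comp (A.barCons b) (PolyFunctor.Hom.comp
    (tensorHom (PolyFunctor.Hom.id (A.ideal b)) f)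
    (PolyFunctor.Hom.comp (tensorAssoc (A.ideal b) (A.word s) (A.word t))
      (PolyFunctor.Hom.comp
        (tensorHom (tensorComm (A.word s) (A.ideal b)) (PolyFunctor.Hom.id (A.word t)))
        (tensorAssocInv (A.word s) (A.ideal b) (A.word t)))))

/-- The shuffle product. It is the sum over all the shuffles of two words, with the Koszul sign for
letters of degree `|x| + 1`, according to the word which the first letter of the shuffle comes
from: `[x|y] * [x'|z] = [x|[y] * [x'|z]] + (-1) ^ (|[x|y]| (|x'| + 1)) [x'|[x|y] * [z]]`. -/
def shuffle : ∀ s t : List (ℤ × ℕ),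
    PolyFunctor.Hom (tensor (A.word s) (A.word t)) A.barTotal
  | [], t => PolyFunctor.Hom.comp (A.wordι t) (PolyFunctor.Hom.comp (tensorLid (A.word t))
      (tensorHom (constDown k) (PolyFunctor.Hom.id (A.word t))))
  | a :: s, [] => PolyFunctor.Hom.comp (A.wordι (a :: s)) (PolyFunctor.Hom.comp
      (tensorLid (A.word (a :: s))) (PolyFunctor.Hom.comp
        (tensorHom (constDown k) (PolyFunctor.Hom.id (A.word (a :: s))))
        (tensorComm (A.word (a :: s)) (A.word []))))
  | a :: s, b :: t =>
      A.shuffleLeft a s (b :: t) (shuffle s (b :: t)) +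
        A.shuffleRight b (a :: s) t (shuffle (a :: s) t)
termination_by s t => s.length + t.length

/-- The words of degree `i` and weight `d`. -/
abbrev WordIn (i : ℤ) (d : ℕ) : Type :=
  {t : List (ℤ × ℕ) // wordDeg t = i ∧ wordWt t = d}

/-- The component of degree `i` and weight `d` of the bar construction. -/
@[reducible] def barObj (i : ℤ) (d : ℕ) : PolyFunctor.{u, max u w} k :=
  directSum fun t : WordIn i d => A.word t.1

/-- The inclusion of a homogeneous component. -/
def barIncl (i : ℤ) (d : ℕ) : PolyFunctor.Hom (A.barObj i d) A.barTotal :=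
  directSumDesc fun t => A.wordι t.1

/-- The projection onto a homogeneous component. -/
def barProj (i : ℤ) (d : ℕ) : PolyFunctor.Hom A.barTotal (A.barObj i d) :=
  directSumDesc fun t => if h : wordDeg t = i ∧ wordWt t = d then
    directSumι (fun t : WordIn i d => A.word t.1) ⟨t, h⟩ else 0

/-- The differential of the bar construction, on the direct sum of all components. -/
def barDiffTotal : PolyFunctor.Hom A.barTotal A.barTotal := directSumDesc A.wordDiff

/-- The shuffle product of the bar construction, on the direct sum of all components. -/
def barMulTotal : PolyFunctor.Hom (tensor A.barTotal A.barTotal) A.barTotal :=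
  tensorSumDesc fun t => PolyFunctor.Hom.comp
    (tensorSumDesc fun s => PolyFunctor.Hom.comp (A.shuffle s t)
      (tensorComm (A.word t) (A.word s)))
    (tensorComm A.barTotal (A.word t))

theorem directSumDesc_ι {ι : Type} [DecidableEq ι] {F : ι → PolyFunctor.{u, w} k}
    {G : PolyFunctor.{u, w'} k} (φ : ∀ i, PolyFunctor.Hom (F i) G) (i : ι) (V : FGProj k)
    (x : (F i).obj V) : (directSumDesc φ).app V ((directSumι F i).app V x) = (φ i).app V x :=
  DirectSum.toModule_lof k (M := fun i => (F i).obj V) i x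

theorem barProj_nil (V : FGProj k) (x : (A.word []).obj V) :
    (A.barProj 0 0).app V ((A.wordι []).app V x) =
      (directSumι (fun t : WordIn 0 0 => A.word t.1) ⟨[], rfl, rfl⟩).app V x := by
  rw [barProj, wordι, directSumDesc_ι, dif_pos ⟨rfl, rfl⟩]

theorem barIncl_nil (V : FGProj k) (x : (A.word []).obj V) :
    (A.barIncl 0 0).app V
        ((directSumι (fun t : WordIn 0 0 => A.word t.1) ⟨[], rfl, rfl⟩).app V x) =
      (A.wordι []).app V x := by
  rw [barIncl, directSumDesc_ι]

theorem directSumπ_nil (V : FGProj k) (x : (A.word []).obj V) :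
    (directSumπ A.word []).app V ((A.wordι []).app V x) = x := by
  rw [directSumπ, wordι, directSumDesc_ι, dif_pos rfl]
  rfl

/-- The reduced bar construction of `A`, with the shuffle product. Its unit and its augmentation
are the inclusion of and the projection onto the summand `k[]` spanned by the empty word. -/
def bar : PolyDga.{u, max u w} k where
  obj := A.barObj
  homogeneous i d := IsHomogeneous.directSum fun t => by
    have h := A.word_homogeneous t.1
    rwa [t.2.2] at h
  unit := PolyFunctor.Hom.comp (A.barProj 0 0) (PolyFunctor.Hom.comp (A.wordι []) (constToUp k))
  mul {i j l} {d e n} _ _ := PolyFunctor.Hom.comp (A.barProj l n) (PolyFunctor.Hom.comp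
    A.barMulTotal (tensorHom (A.barIncl i d) (A.barIncl j e)))
  diff {i j} _ d := PolyFunctor.Hom.comp (A.barProj j d) (PolyFunctor.Hom.comp A.barDiffTotal
    (A.barIncl i d))
  aug := PolyFunctor.Hom.comp (constDown k) (PolyFunctor.Hom.comp (directSumπ A.word [])
    (A.barIncl 0 0))
  aug_unit V c := by
    rw [PolyFunctor.Hom.comp_app, PolyFunctor.Hom.comp_app, PolyFunctor.Hom.comp_app,
      PolyFunctor.Hom.comp_app, barProj_nil, barIncl_nil, directSumπ_nil]
    rfl

end Bar

variable {A B : PolyDga.{u, w} k}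

/-- The map `A' → B'` induced by a family of morphisms `A_{i,d} → B_{i,d}`. -/
def idealMap (g : ∀ i d, PolyFunctor.Hom (A.obj i d) (B.obj i d)) (a : ℤ × ℕ) :
    PolyFunctor.Hom (A.ideal a) (B.ideal a) :=
  PolyFunctor.Hom.comp (B.idealπ a) (PolyFunctor.Hom.comp (g a.1 a.2) (A.idealι a))

/-- The map `[x₁|…|xₙ] ↦ [g x₁|…|g xₙ]`. -/
def wordMap (g : ∀ i d, PolyFunctor.Hom (A.obj i d) (B.obj i d)) :
    ∀ t : List (ℤ × ℕ), PolyFunctor.Hom (A.word t) (B.word t)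
  | [] => PolyFunctor.Hom.id _
  | a :: t => tensorHom (idealMap g a) (wordMap g t)

/-- The map induced on bar constructions by a family of morphisms `A_{i,d} → B_{i,d}`. -/
def barMap (g : ∀ i d, PolyFunctor.Hom (A.obj i d) (B.obj i d)) (i : ℤ) (d : ℕ) :
    PolyFunctor.Hom ((bar A).obj i d) ((bar B).obj i d) :=
  directSumDesc fun t => PolyFunctor.Hom.comp
    (directSumι (fun t : WordIn i d => B.word t.1) t) (wordMap g t.1)

end PolyDga

end

universe w''

noncomputable section

/-! The comparison goes from `B H(E, A)` to `H(E, B A)`: it sends `[φ₁|…|φₙ]` to the convolution `φ₁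
⋆ ⋯ ⋆ φₙ`, a morphism from `E_d` to the word `A' ⊗ ⋯ ⊗ A'`, where `d` is the total weight. It is
called `barConv`, and the isomorphism of the theorem is its inverse.

Bijectivity rests on a Künneth formula, `Hom(E_d, F) ⊗ Hom(E_e, G) ≃ Hom(E_{d+e}, F ⊗ G)`
(`star_injective`, `star_surjective`). By the exponential property, a morphism `E_{d+e} → F ⊗ G`
amounts to maps `E_{d'}(V) ⊗ E_{e'}(W) → F(V) ⊗ G(W)` natural in `V` and `W`, and only `d' = d`
contributes, because there are no nonzero morphisms between different weights. Morphisms `E_e → M ⊗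
G` are elements of `M ⊗ Hom(E_e, G)` when `M` is projective (`exists_tensor_hom`,
`tensor_hom_eq_zero`). This is applied twice, to `M = F(V)` and to `M = Hom(E_e, G)`, and these are
the two places where projectivity is needed. Iteration gives the bijection on each word
(`wordConv_bijective`). The bar construction is an infinite direct sum of words, and `Hom(E_d, -)`
commutes with direct sums (`homDirectSum_bijective`). Both this and `exists_tensor_hom` rely on a
finiteness property: a morphism out of a functor of weight `d` is determined by its value at `k^d`
(`Hom.eq_zero_of_app_free`), and `E_d(k^d)` is finitely generated.

Compatibility with the structure is a computation with convolutions of linear maps (`starLin`). The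
comultiplication of `E` is coassociative because `E` is associative, and cocommutative because `E`
is commutative. Coassociativity handles the contraction of adjacent letters and the shuffles
beginning in the left word. Cocommutativity handles the shuffles beginning in the right word, and
since `E` sits in degree `0` it produces no sign. So the signs on both sides are the same Koszul
signs.

The bar construction of a commutative dg algebra is one again (`IsCdga.bar`). The delicate axiom is
the Leibniz rule for shuffles, where graded commutativity of `A` cancels the products of letters
taken from different words. The convolution algebra inherits the axioms of `A` through the coalgebra
structure of `E` (`IsCdga.convAlg`). -/

/-! ### Signs. -/

theorem ksign_add (k : Type u) [CommRing k] (m n : ℤ) :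
    ksign k (m + n) = ksign k m * ksign k n := by
  simp [ksign, Int.negOnePow_add]

theorem ksign_eq_ite (k : Type u) [CommRing k] (n : ℤ) [Decidable (Even n)] :
    ksign k n = if Even n then 1 else -1 := by
  split_ifs with h
  · simp [ksign, Int.negOnePow_even n h]
  · simp [ksign, Int.negOnePow_odd n (Int.not_even_iff_odd.1 h)]

theorem ksign_zero (k : Type u) [CommRing k] : ksign k 0 = 1 := by
  simp [ksign]

/-- This reduces an identity of Koszul signs to an equivalence of parities, which is propositional
once sums and products are expanded. -/
theorem ksign_congr (k : Type u) [CommRing k] {m n : ℤ} (h : Even m ↔ Even n) :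
    ksign k m = ksign k n := by
  classical
  simp only [ksign_eq_ite, h]

theorem ksign_one (k : Type u) [CommRing k] : ksign k 1 = -1 := by
  simp [ksign]

theorem ksign_eq_or (k : Type u) [CommRing k] (n : ℤ) : ksign k n = 1 ∨ ksign k n = -1 := by
  classical
  rw [ksign_eq_ite]
  split_ifs <;> simp

/-! ### Degrees of words and the augmentation ideal. -/

namespace PolyDga

open PolyFunctor

theorem wordDeg_nil : wordDeg [] = 0 := rfl

theorem wordDeg_cons (a : ℤ × ℕ) (t : List (ℤ × ℕ)) :
    wordDeg (a :: t) = a.1 + 1 + wordDeg t := rfl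

theorem wordWt_nil : wordWt [] = 0 := rfl

theorem wordWt_cons (a : ℤ × ℕ) (t : List (ℤ × ℕ)) : wordWt (a :: t) = a.2 + wordWt t := rfl

section Ideal

variable {k : Type u} [CommRing k] (A : PolyDga.{u, w} k) (V : FGProj k)

theorem augAt_idealι (a : ℤ × ℕ) (x : (A.ideal a).obj V) :
    (A.augAt a.1 a.2).app V ((A.idealι a).app V x) = 0 := x.2

theorem idealι_injective (a : ℤ × ℕ) : Function.Injective ((A.idealι a).app V) :=
  Subtype.val_injective

theorem idealι_idealπ_of_augAt (a : ℤ × ℕ) {z : (A.obj a.1 a.2).obj V}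
    (h : (A.augAt a.1 a.2).app V z = 0) : (A.idealι a).app V ((A.idealπ a).app V z) = z :=
  A.idealProj_of_augAt a.1 a.2 V z h

theorem idealπ_idealι (a : ℤ × ℕ) (x : (A.ideal a).obj V) :
    (A.idealπ a).app V ((A.idealι a).app V x) = x :=
  A.idealι_injective V a (A.idealι_idealπ_of_augAt V a (A.augAt_idealι V a x))

-- `idealMul` is defined with a projection onto `A'`. The augmentation is multiplicative, so it
-- vanishes on the product and the projection changes nothing: identities in `A'` can be checked in
-- `A`.
variable {A} in
theorem IsCdga.idealι_idealMul (hA : A.IsCdga) (a b : ℤ × ℕ) (x : (A.ideal a).obj V)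
    (y : (A.ideal b).obj V) : (A.idealι (a + b)).app V ((A.idealMul a b).app V (x ⊗ₜ y)) =
      (A.mul (l := (a + b).1) (n := (a + b).2) rfl rfl).app V
        ((A.idealι a).app V x ⊗ₜ (A.idealι b).app V y) := by
  apply A.idealι_idealπ_of_augAt
  refine (hA.aug_mul _ _ V _ _).trans ?_
  rw [augAt_idealι]
  exact zero_mul _

theorem augAt_of_ne {i : ℤ} {d : ℕ} (h : ¬ (i = 0 ∧ d = 0)) (x : (A.obj i d).obj V) :
    (A.augAt i d).app V x = 0 := by
  rw [augAt, dif_neg h]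
  rfl

variable {A} in
theorem IsCdga.augAt_diff (hA : A.IsCdga) {i j : ℤ} (h : j + 1 = i) (d : ℕ)
    (x : (A.obj i d).obj V) : (A.augAt j d).app V ((A.diff h d).app V x) = 0 := by
  by_cases hj : j = 0 ∧ d = 0
  · obtain ⟨rfl, rfl⟩ := hj
    obtain rfl : i = 1 := by omega
    exact hA.aug_diff V x
  · exact A.augAt_of_ne V hj _

variable {A} in
theorem IsCdga.idealι_idealDiff (hA : A.IsCdga) (a : ℤ × ℕ) (x : (A.ideal a).obj V) :
    (A.idealι (a.1 - 1, a.2)).app V ((A.idealDiff a).app V x) =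
      (A.diff (sub_add_cancel a.1 1) a.2).app V ((A.idealι a).app V x) :=
  A.idealι_idealπ_of_augAt V _ (hA.augAt_diff V _ _ _)

end Ideal

/-! ### The bar construction before grading: words, homogeneous parts and recursion formulas. -/

section Bar

variable {k : Type u} [CommRing k] (A : PolyDga.{u, w} k) (V : FGProj k)

/-- The empty word `[]`. -/
def barNil : A.barTotal.obj V := (A.wordι []).app V (ULift.up (1 : k))

/-- The map `x, u ↦ [x|u]`. -/
def cons (a : ℤ × ℕ) : (A.ideal a).obj V →ₗ[k] A.barTotal.obj V →ₗ[k] A.barTotal.obj V :=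
  TensorProduct.curry ((A.barCons a).app V)

/-- The map `x, [y|u] ↦ [x y|u]`, zero on the empty word. -/
def contract (a : ℤ × ℕ) : (A.ideal a).obj V →ₗ[k] A.barTotal.obj V →ₗ[k] A.barTotal.obj V :=
  TensorProduct.curry ((tensorSumDesc fun t => A.barContract a t).app V)

/-- The shuffle product as a bilinear map. -/
def shuffleMul : A.barTotal.obj V →ₗ[k] A.barTotal.obj V →ₗ[k] A.barTotal.obj V :=
  TensorProduct.curry (A.barMulTotal.app V)

theorem tensorSumDesc_ι {ι : Type} [DecidableEq ι] {F : PolyFunctor.{u, v'} k}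
    {G : ι → PolyFunctor.{u, v} k} {H : PolyFunctor.{u, w'} k}
    (φ : ∀ i, PolyFunctor.Hom (tensor F (G i)) H) (i : ι) (x : F.obj V) (y : (G i).obj V) :
    (tensorSumDesc φ).app V (x ⊗ₜ (directSumι G i).app V y) = (φ i).app V (x ⊗ₜ y) := by
  simp [tensorSumDesc, PolyFunctor.Hom.app, directSumι]

variable {V}

theorem cons_wordι (a : ℤ × ℕ) (t : List (ℤ × ℕ)) (x : (A.ideal a).obj V)
    (u : (A.word t).obj V) :
    A.cons V a x ((A.wordι t).app V u) = (A.wordι (a :: t)).app V (x ⊗ₜ u) :=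
  tensorSumDesc_ι V (fun t => A.wordι (a :: t)) t x u

theorem contract_wordι (a : ℤ × ℕ) (t : List (ℤ × ℕ)) (x : (A.ideal a).obj V)
    (u : (A.word t).obj V) :
    A.contract V a x ((A.wordι t).app V u) = (A.barContract a t).app V (x ⊗ₜ u) :=
  tensorSumDesc_ι V (fun t => A.barContract a t) t x u

/-- `u` is of the form `[x₁|…|xₙ]`, where `xᵢ` has degree and weight given by the `i`-th letter. -/
inductive IsWord : List (ℤ × ℕ) → A.barTotal.obj V → Prop
  | nil : IsWord [] (A.barNil V)
  | cons (a : ℤ × ℕ) (x : (A.ideal a).obj V) {t : List (ℤ × ℕ)} {u : A.barTotal.obj V} :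
      IsWord t u → IsWord (a :: t) (A.cons V a x u)

/-- Since words span, every linear identity on the bar construction is reduced to an induction on
`IsWord`, one letter at a time, without unfolding iterated tensor products. -/
theorem wordι_mem_span : ∀ (t : List (ℤ × ℕ)) (u : (A.word t).obj V),
    (A.wordι t).app V u ∈ Submodule.span k {z | A.IsWord t z}
  | [], u => by
    have : u = (u.down : k) • (ULift.up 1 : ULift k) := by ext; simp
    rw [this, map_smul]
    exact Submodule.smul_mem _ _ (Submodule.subset_span IsWord.nil)
  | a :: t, u => by
    induction u using TensorProduct.induction_on with
    | zero => rw [map_zero]; exact Submodule.zero_mem _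
    | add x y hx hy => rw [map_add]; exact Submodule.add_mem _ hx hy
    | tmul x u =>
      rw [← cons_wordι]
      have h := Submodule.mem_map_of_mem (f := A.cons V a x) (wordι_mem_span t u)
      rw [Submodule.map_span] at h
      refine Submodule.span_mono ?_ h
      rintro _ ⟨z, hz, rfl⟩
      exact IsWord.cons a x hz

theorem IsWord.exists_wordι {t : List (ℤ × ℕ)} {z : A.barTotal.obj V} (h : A.IsWord t z) :
    ∃ u, z = (A.wordι t).app V u := by
  induction h with
  | nil => exact ⟨_, rfl⟩
  | cons a x _ ih =>
    obtain ⟨u, rfl⟩ := ih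
    exact ⟨_, A.cons_wordι a _ x u⟩

theorem wordι_ext {Q : Type*} [AddCommGroup Q] [Module k Q] (f g : A.barTotal.obj V →ₗ[k] Q)
    (t : List (ℤ × ℕ)) (h : ∀ z, A.IsWord t z → f z = g z) (u : (A.word t).obj V) :
    f ((A.wordι t).app V u) = g ((A.wordι t).app V u) :=
  LinearMap.eqOn_span (f := f) (g := g) (fun z hz => h z hz) (A.wordι_mem_span t u)

theorem barTotal_induction {P : A.barTotal.obj V → Prop} (h0 : P 0)
    (hadd : ∀ x y, P x → P y → P (x + y)) (h : ∀ t u, P ((A.wordι t).app V u)) (z) : P z := by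
  induction z using DirectSum.induction_on with
  | zero => exact h0
  | add x y hx hy => exact hadd _ _ hx hy
  | of t u => exact h t u

theorem barTotal_ext {Q : Type*} [AddCommGroup Q] [Module k Q] {f g : A.barTotal.obj V →ₗ[k] Q}
    (h : ∀ t z, A.IsWord t z → f z = g z) : f = g := by
  apply LinearMap.ext
  intro z
  induction z using A.barTotal_induction with
  | h0 => rw [map_zero, map_zero]
  | hadd x y hx hy => rw [map_add, hx, hy, map_add]
  | h t u => exact A.wordι_ext f g t (h t) u

/-- The elements of degree `i` and weight `d` of the bar construction. -/
def barPart (V : FGProj k) (i : ℤ) (d : ℕ) : Submodule k (A.barTotal.obj V) :=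
  Submodule.span k {z | ∃ t, wordDeg t = i ∧ wordWt t = d ∧ A.IsWord t z}

theorem IsWord.mem_barPart {t : List (ℤ × ℕ)} {z : A.barTotal.obj V} (h : A.IsWord t z) :
    z ∈ A.barPart V (wordDeg t) (wordWt t) := Submodule.subset_span ⟨t, rfl, rfl, h⟩

theorem wordι_mem_barPart (t : List (ℤ × ℕ)) (u : (A.word t).obj V) :
    (A.wordι t).app V u ∈ A.barPart V (wordDeg t) (wordWt t) :=
  Submodule.span_mono (s := {z | A.IsWord t z})
    (t := {z | ∃ s, wordDeg s = wordDeg t ∧ wordWt s = wordWt t ∧ A.IsWord s z})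
    (fun _ hz => ⟨t, rfl, rfl, hz⟩) (A.wordι_mem_span t u)

variable {A} in
theorem barPart_ext {Q : Type*} [AddCommGroup Q] [Module k Q] {f g : A.barTotal.obj V →ₗ[k] Q}
    {i : ℤ} {d : ℕ} (h : ∀ t z, wordDeg t = i → wordWt t = d → A.IsWord t z → f z = g z)
    {z : A.barTotal.obj V} (hz : z ∈ A.barPart V i d) : f z = g z := by
  refine LinearMap.eqOn_span (f := f) (g := g) ?_ hz
  rintro z ⟨t, h1, h2, h3⟩
  exact h t z h1 h2 h3

variable {A} in
theorem map_mem_of_mem_barPart {Q : Type*} [AddCommGroup Q] [Module k Q]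
    (f : A.barTotal.obj V →ₗ[k] Q) (N : Submodule k Q) {i : ℤ} {d : ℕ}
    (h : ∀ t z, wordDeg t = i → wordWt t = d → A.IsWord t z → f z ∈ N)
    {z : A.barTotal.obj V} (hz : z ∈ A.barPart V i d) : f z ∈ N := by
  have : A.barPart V i d ≤ N.comap f := by
    rw [barPart, Submodule.span_le]
    rintro z ⟨t, h1, h2, h3⟩
    exact h t z h1 h2 h3
  exact this hz

theorem cons_mem_barPart (a : ℤ × ℕ) (x : (A.ideal a).obj V) {i : ℤ} {d : ℕ}
    {z : A.barTotal.obj V} (hz : z ∈ A.barPart V i d) {j : ℤ} {e : ℕ} (hj : a.1 + 1 + i = j)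
    (he : a.2 + d = e) : A.cons V a x z ∈ A.barPart V j e := by
  subst hj he
  refine map_mem_of_mem_barPart _ _ (fun t z h1 h2 h => ?_) hz
  exact Submodule.subset_span ⟨a :: t, by rw [wordDeg_cons, h1], by rw [wordWt_cons, h2],
    IsWord.cons a x h⟩

theorem barNil_mem_barPart : A.barNil V ∈ A.barPart V 0 0 :=
  Submodule.subset_span ⟨[], rfl, rfl, IsWord.nil⟩

theorem barIncl_ι (i : ℤ) (d : ℕ) (t : WordIn i d) (u : (A.word t.1).obj V) :
    (A.barIncl i d).app V ((directSumι (fun t : WordIn i d => A.word t.1) t).app V u) =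
      (A.wordι t.1).app V u :=
  directSumDesc_ι _ _ _ _

theorem barIncl_mem (i : ℤ) (d : ℕ) (z : (A.barObj i d).obj V) :
    (A.barIncl i d).app V z ∈ A.barPart V i d := by
  induction z using DirectSum.induction_on with
  | zero => rw [map_zero]; exact Submodule.zero_mem _
  | add x y hx hy => rw [map_add]; exact Submodule.add_mem _ hx hy
  | of t u =>
    have h := A.wordι_mem_barPart t.1 u
    rw [t.2.1, t.2.2] at h
    rw [← A.barIncl_ι] at h
    exact h

theorem barProj_wordι {i : ℤ} {d : ℕ} (t : List (ℤ × ℕ)) (h : wordDeg t = i ∧ wordWt t = d)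
    (u : (A.word t).obj V) : (A.barProj i d).app V ((A.wordι t).app V u) =
      (directSumι (fun t : WordIn i d => A.word t.1) ⟨t, h⟩).app V u := by
  rw [barProj, wordι, directSumDesc_ι, dif_pos h]

theorem barProj_barIncl (i : ℤ) (d : ℕ) (z : (A.barObj i d).obj V) :
    (A.barProj i d).app V ((A.barIncl i d).app V z) = z := by
  induction z using DirectSum.induction_on with
  | zero => rw [map_zero, map_zero]
  | add x y hx hy => rw [map_add, map_add, hx, hy]
  | of t u =>
    exact (congrArg _ (A.barIncl_ι i d t u)).trans (A.barProj_wordι t.1 t.2 u)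

theorem barIncl_injective (i : ℤ) (d : ℕ) : Function.Injective ((A.barIncl i d).app V) :=
  Function.LeftInverse.injective (A.barProj_barIncl i d)

/-- The operations of `bar` are the ungraded ones followed by `barProj`. Once an ungraded operation
is known to respect `barPart`, this shows that the projection loses nothing, so that the axioms can
be proved in `barTotal`, where there are no indices to match. -/
theorem barIncl_barProj {i : ℤ} {d : ℕ} {z : A.barTotal.obj V} (hz : z ∈ A.barPart V i d) :
    (A.barIncl i d).app V ((A.barProj i d).app V z) = z := by
  refine barPart_ext (f := (A.barIncl i d).app V ∘ₗ (A.barProj i d).app V) (g := LinearMap.id)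
    (fun t z h1 h2 h => ?_) hz
  obtain ⟨u, rfl⟩ := h.exists_wordι
  rw [LinearMap.comp_apply, A.barProj_wordι t ⟨h1, h2⟩, barIncl_ι]
  rfl

theorem contract_nil (a : ℤ × ℕ) (x : (A.ideal a).obj V) :
    A.contract V a x (A.barNil V) = 0 := A.contract_wordι a [] x _

theorem contract_cons (a b : ℤ × ℕ) (x : (A.ideal a).obj V) (y : (A.ideal b).obj V)
    (z : A.barTotal.obj V) : A.contract V a x (A.cons V b y z) =
      A.cons V (a + b) ((A.idealMul a b).app V (x ⊗ₜ y)) z := by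
  induction z using A.barTotal_induction with
  | h0 => simp only [map_zero]
  | hadd x y hx hy => simp only [map_add, hx, hy]
  | h t u => rw [cons_wordι, contract_wordι, cons_wordι]; rfl

theorem barDiffTotal_nil : A.barDiffTotal.app V (A.barNil V) = 0 := by
  rw [barDiffTotal, barNil, wordι, directSumDesc_ι]
  rfl

theorem barDiffTotal_cons (a : ℤ × ℕ) (x : (A.ideal a).obj V) (z : A.barTotal.obj V) :
    A.barDiffTotal.app V (A.cons V a x z) =
      - A.cons V (a.1 - 1, a.2) ((A.idealDiff a).app V x) z +
        ksign k (a.1 + 1) • A.cons V a x (A.barDiffTotal.app V z) +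
        ksign k (a.1 + 1) • A.contract V a x z := by
  induction z using A.barTotal_induction with
  | h0 => simp only [map_zero, smul_zero, add_zero, neg_zero]
  | hadd x y hx hy => simp only [map_add, hx, hy, smul_add]; abel
  | h t u =>
    rw [cons_wordι, cons_wordι, contract_wordι]
    have h : ∀ s v, A.barDiffTotal.app V ((A.wordι s).app V v) = (A.wordDiff s).app V v :=
      fun s v => directSumDesc_ι _ _ _ _
    rw [h, h]
    rfl

theorem shuffleMul_apply (x y : A.barTotal.obj V) :
    A.shuffleMul V x y = A.barMulTotal.app V (x ⊗ₜ y) := rfl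

theorem shuffleMul_wordι (s t : List (ℤ × ℕ)) (u : (A.word s).obj V) (v : (A.word t).obj V) :
    A.shuffleMul V ((A.wordι s).app V u) ((A.wordι t).app V v) =
      (A.shuffle s t).app V (u ⊗ₜ v) := by
  rw [shuffleMul_apply, barMulTotal, wordι, wordι, tensorSumDesc_ι, PolyFunctor.Hom.comp_app]
  change (tensorSumDesc fun s => _).app V (v ⊗ₜ (directSumι A.word s).app V u) = _
  rw [tensorSumDesc_ι]
  rfl

theorem shuffleMul_nil_left (z : A.barTotal.obj V) : A.shuffleMul V (A.barNil V) z = z := by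
  induction z using A.barTotal_induction with
  | h0 => simp only [map_zero]
  | hadd x y hx hy => simp only [map_add, hx, hy]
  | h t u =>
    rw [barNil, shuffleMul_wordι, shuffle]
    exact congrArg ((A.wordι t).app V) (one_smul k u)

theorem shuffleMul_nil_right (z : A.barTotal.obj V) : A.shuffleMul V z (A.barNil V) = z := by
  induction z using A.barTotal_induction with
  | h0 => simp only [map_zero, LinearMap.zero_apply]
  | hadd x y hx hy => simp only [map_add, hx, hy, LinearMap.add_apply]
  | h t u =>
    cases t with
    | nil =>
      rw [barNil, shuffleMul_wordι, shuffle]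
      refine congrArg ((A.wordι []).app V) ?_
      ext
      exact mul_one _
    | cons a t =>
      rw [barNil, shuffleMul_wordι, shuffle]
      exact congrArg ((A.wordι (a :: t)).app V) (one_smul k u)

/-- The sign moves `y` past `[x|z]`, so `z` must have a known degree. The degree of `z'` does not
enter, and `z'` stays arbitrary. -/
theorem shuffleMul_cons_cons (a b : ℤ × ℕ) (x : (A.ideal a).obj V) (y : (A.ideal b).obj V)
    {i : ℤ} {d : ℕ} {z : A.barTotal.obj V} (hz : z ∈ A.barPart V i d) (z' : A.barTotal.obj V) :
    A.shuffleMul V (A.cons V a x z) (A.cons V b y z') =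
      A.cons V a x (A.shuffleMul V z (A.cons V b y z')) +
        ksign k ((a.1 + 1 + i) * (b.1 + 1)) •
          A.cons V b y (A.shuffleMul V (A.cons V a x z) z') := by
  induction z' using A.barTotal_induction with
  | h0 => simp only [map_zero, smul_zero, add_zero]
  | hadd x y hx hy => simp only [map_add, hx, hy, smul_add]; abel
  | h t u =>
    refine barPart_ext (f := (A.shuffleMul V).flip (A.cons V b y ((A.wordι t).app V u)) ∘ₗ
        A.cons V a x)
      (g := A.cons V a x ∘ₗ (A.shuffleMul V).flip (A.cons V b y ((A.wordι t).app V u)) +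
        ksign k ((a.1 + 1 + i) * (b.1 + 1)) • A.cons V b y ∘ₗ
          (A.shuffleMul V).flip ((A.wordι t).app V u) ∘ₗ A.cons V a x)
      (fun s z h1 h2 h => ?_) hz
    obtain ⟨v, rfl⟩ := h.exists_wordι
    subst h1
    simp only [LinearMap.comp_apply, LinearMap.flip_apply, LinearMap.add_apply,
      LinearMap.smul_apply]
    rw [cons_wordι, cons_wordι, shuffleMul_wordι, shuffleMul_wordι, shuffleMul_wordι, shuffle]
    rfl
end Bar
end PolyDga

/-! ### The bar construction is a commutative dg algebra. -/

namespace PolyDga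

open PolyFunctor

variable {k : Type u} [CommRing k] {A : PolyDga.{u, w} k} {V : FGProj k}

/-- The nested induction mirrors the recursion of the shuffle product. The outer hypothesis, valid
for all second words, treats the shuffles that begin in the first word; the inner one treats those
that begin in the second. The next proofs have the same pattern. -/
theorem IsWord.shuffleMul_mem {s t : List (ℤ × ℕ)} {z z' : A.barTotal.obj V} (h : A.IsWord s z)
    (h' : A.IsWord t z') : A.shuffleMul V z z' ∈
      A.barPart V (wordDeg s + wordDeg t) (wordWt s + wordWt t) := by
  induction h generalizing t z' with
  | nil =>
    rw [shuffleMul_nil_left, wordDeg_nil, wordWt_nil, zero_add, zero_add]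
    exact h'.mem_barPart
  | @cons a x s z h ih =>
    induction h' with
    | nil =>
      rw [shuffleMul_nil_right, wordDeg_nil, wordWt_nil, add_zero, add_zero]
      exact (h.cons a x).mem_barPart
    | @cons b y t z' h' ih' =>
      rw [shuffleMul_cons_cons A a b x y h.mem_barPart]
      refine Submodule.add_mem _ ?_ (Submodule.smul_mem _ _ ?_)
      · exact A.cons_mem_barPart a x (ih (h'.cons b y)) (by simp only [wordDeg_cons]; ring)
          (by simp only [wordWt_cons]; ring)
      · exact A.cons_mem_barPart b y ih' (by simp only [wordDeg_cons]; ring)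
          (by simp only [wordWt_cons]; ring)

theorem shuffleMul_mem {i j : ℤ} {d e : ℕ} {z z' : A.barTotal.obj V} (hz : z ∈ A.barPart V i d)
    (hz' : z' ∈ A.barPart V j e) : A.shuffleMul V z z' ∈ A.barPart V (i + j) (d + e) := by
  refine map_mem_of_mem_barPart ((A.shuffleMul V).flip z') _ (fun s z h1 h2 h => ?_) hz
  refine map_mem_of_mem_barPart (A.shuffleMul V z) _ (fun t z' h1' h2' h' => ?_) hz'
  subst h1 h2 h1' h2'
  exact h.shuffleMul_mem h'

theorem IsWord.shuffleMul_comm {s t : List (ℤ × ℕ)} {z z' : A.barTotal.obj V} (h : A.IsWord s z)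
    (h' : A.IsWord t z') : A.shuffleMul V z z' =
      ksign k (wordDeg s * wordDeg t) • A.shuffleMul V z' z := by
  induction h generalizing t z' with
  | nil =>
    rw [shuffleMul_nil_left, shuffleMul_nil_right, wordDeg_nil, zero_mul, ksign_zero, one_smul]
  | @cons a x s z h ih =>
    induction h' with
    | nil =>
      rw [shuffleMul_nil_left, shuffleMul_nil_right, wordDeg_nil, mul_zero, ksign_zero, one_smul]
    | @cons b y t z' h' ih' =>
      rw [shuffleMul_cons_cons A a b x y h.mem_barPart,
        shuffleMul_cons_cons A b a y x h'.mem_barPart, ih (h'.cons b y), ih']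
      simp only [map_smul, smul_add, smul_smul, wordDeg_cons, ← ksign_add]
      -- Exchanging the factors exchanges the two kinds of shuffles, so the two sums have the same
      -- terms in opposite order.
      rw [add_comm]
      congr 2 <;> apply ksign_congr <;>
        simp only [Int.even_add, Int.even_mul, Int.not_even_one] <;> grind

theorem shuffleMul_comm {i j : ℤ} {d e : ℕ} {z z' : A.barTotal.obj V} (hz : z ∈ A.barPart V i d)
    (hz' : z' ∈ A.barPart V j e) :
    A.shuffleMul V z z' = ksign k (i * j) • A.shuffleMul V z' z := by
  refine barPart_ext (f := (A.shuffleMul V).flip z')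
    (g := ksign k (i * j) • A.shuffleMul V z') (fun s z h1 h2 h => ?_) hz
  refine barPart_ext (f := A.shuffleMul V z)
    (g := ksign k (i * j) • (A.shuffleMul V).flip z) (fun t z' h1' h2' h' => ?_) hz'
  subst h1 h2 h1' h2'
  exact h.shuffleMul_comm h'

/-- A shuffle of three words begins with a letter of the first, second or third word; removing this
letter leads to `ih`, `ih'` or `ih''`. -/
theorem IsWord.shuffleMul_assoc {r s t : List (ℤ × ℕ)} {z z' z'' : A.barTotal.obj V}
    (h : A.IsWord r z) (h' : A.IsWord s z') (h'' : A.IsWord t z'') :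
    A.shuffleMul V (A.shuffleMul V z z') z'' = A.shuffleMul V z (A.shuffleMul V z' z'') := by
  induction h generalizing s t z' z'' with
  | nil => rw [shuffleMul_nil_left, shuffleMul_nil_left]
  | @cons a x r z h ih =>
    induction h' generalizing t z'' with
    | nil => rw [shuffleMul_nil_left, shuffleMul_nil_right]
    | @cons b y s z' h' ih' =>
      induction h'' with
      | nil => rw [shuffleMul_nil_right, shuffleMul_nil_right]
      | @cons c w t z'' h'' ih'' =>
        have hX := h.cons a x
        have hY := h'.cons b y
        have hZ := h''.cons c w
        -- On the left, the shuffles beginning in the third word arrive in two pieces, one for each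
        -- term of the product of the first two words. So `ih''` is expanded in the same way, to be
        -- used from right to left.
        rw [shuffleMul_cons_cons A a b x y h.mem_barPart] at ih'' ⊢
        rw [shuffleMul_cons_cons A b c y w h'.mem_barPart]
        simp only [map_add, map_smul, LinearMap.add_apply, LinearMap.smul_apply] at ih'' ⊢
        rw [shuffleMul_cons_cons A a c x w (h.shuffleMul_mem hY),
          shuffleMul_cons_cons A b c y w (hX.shuffleMul_mem h'),
          shuffleMul_cons_cons A a b x y h.mem_barPart,
          shuffleMul_cons_cons A a c x w h.mem_barPart, ih hY hZ, ih' hZ,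
          shuffleMul_cons_cons A b c y w h'.mem_barPart, ← ih'']
        simp only [map_add, map_smul, smul_add, smul_smul, wordDeg_cons, ← ksign_add]
        simp only [add_mul, ksign_add]
        module

theorem shuffleMul_assoc (z z' z'' : A.barTotal.obj V) :
    A.shuffleMul V (A.shuffleMul V z z') z'' = A.shuffleMul V z (A.shuffleMul V z' z'') := by
  refine LinearMap.congr_fun (f := (A.shuffleMul V).flip z'' ∘ₗ (A.shuffleMul V).flip z')
    (g := (A.shuffleMul V).flip (A.shuffleMul V z' z'')) (A.barTotal_ext fun r z h => ?_) z
  refine LinearMap.congr_fun (f := (A.shuffleMul V).flip z'' ∘ₗ A.shuffleMul V z)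
    (g := A.shuffleMul V z ∘ₗ (A.shuffleMul V).flip z'') (A.barTotal_ext fun s z' h' => ?_) z'
  refine LinearMap.congr_fun (f := A.shuffleMul V (A.shuffleMul V z z'))
    (g := A.shuffleMul V z ∘ₗ A.shuffleMul V z') (A.barTotal_ext fun t z'' h'' => ?_) z''
  exact h.shuffleMul_assoc h' h''

variable (A V) in
/-- The map `x, u ↦ [x|u]`, where `x` is first projected onto the augmentation ideal. -/
def consObj (i : ℤ) (d : ℕ) : (A.obj i d).obj V →ₗ[k] A.barTotal.obj V →ₗ[k] A.barTotal.obj V :=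
  A.cons V (i, d) ∘ₗ (A.idealπ (i, d)).app V

theorem consObj_idealι (a : ℤ × ℕ) (x : (A.ideal a).obj V) :
    A.consObj V a.1 a.2 ((A.idealι a).app V x) = A.cons V a x :=
  congrArg (A.cons V a) (A.idealπ_idealι V a x)

/-- The axioms of `A` relate letters whose indices, such as `a + b + c` and `a + (b + c)`, are equal
but not syntactically so. `consObj` accepts any indices `l`, `n` with proofs and lands in
`barTotal`, so both sides get a common type and the axiom of `A` applies directly. -/
theorem IsCdga.cons_idealMul (hA : A.IsCdga) (a b : ℤ × ℕ) (x : (A.ideal a).obj V) (y : (A.ideal b).obj V)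
    {l : ℤ} {n : ℕ} (hl : a.1 + b.1 = l) (hn : a.2 + b.2 = n) :
    A.cons V (a + b) ((A.idealMul a b).app V (x ⊗ₜ y)) = A.consObj V l n ((A.mul hl hn).app V
      ((A.idealι a).app V x ⊗ₜ (A.idealι b).app V y)) := by
  subst hl hn
  rw [← consObj_idealι, hA.idealι_idealMul]
  rfl

theorem IsCdga.cons_mul_assoc (hA : A.IsCdga) (a b c : ℤ × ℕ) (x : (A.ideal a).obj V)
    (y : (A.ideal b).obj V) (w : (A.ideal c).obj V) :
    A.cons V (a + b + c) ((A.idealMul (a + b) c).app V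
        ((A.idealMul a b).app V (x ⊗ₜ y) ⊗ₜ w)) =
      A.cons V (a + (b + c)) ((A.idealMul a (b + c)).app V
        (x ⊗ₜ (A.idealMul b c).app V (y ⊗ₜ w))) := by
  rw [hA.cons_idealMul _ _ _ _ rfl rfl,
    hA.cons_idealMul a (b + c) _ _ (add_assoc a.1 b.1 c.1).symm (add_assoc a.2 b.2 c.2).symm,
    hA.idealι_idealMul, hA.idealι_idealMul]
  exact congrArg _ (hA.mul_assoc _ _ _ _ _ _ _ _ V _ _ _)

theorem IsCdga.cons_mul_comm (hA : A.IsCdga) (a b : ℤ × ℕ) (x : (A.ideal a).obj V) (y : (A.ideal b).obj V) :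
    A.cons V (a + b) ((A.idealMul a b).app V (x ⊗ₜ y)) = ksign k (a.1 * b.1) •
      A.cons V (b + a) ((A.idealMul b a).app V (y ⊗ₜ x)) := by
  rw [hA.cons_idealMul a b _ _ rfl rfl,
    hA.cons_idealMul b a _ _ (add_comm b.1 a.1) (add_comm b.2 a.2), ← map_smul]
  exact congrArg _ (hA.mul_comm _ _ _ _ V _ _)

theorem IsCdga.cons_diff_mul (hA : A.IsCdga) (a b : ℤ × ℕ) (x : (A.ideal a).obj V) (y : (A.ideal b).obj V) :
    A.cons V ((a + b).1 - 1, (a + b).2) ((A.idealDiff (a + b)).app V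
        ((A.idealMul a b).app V (x ⊗ₜ y))) =
      A.cons V ((a.1 - 1, a.2) + b) ((A.idealMul (a.1 - 1, a.2) b).app V
        ((A.idealDiff a).app V x ⊗ₜ y)) +
      ksign k a.1 • A.cons V (a + (b.1 - 1, b.2)) ((A.idealMul a (b.1 - 1, b.2)).app V
        (x ⊗ₜ (A.idealDiff b).app V y)) := by
  have h1 : a.1 - 1 + b.1 = (a + b).1 - 1 := by rw [Prod.fst_add]; ring
  have h2 : a.1 + (b.1 - 1) = (a + b).1 - 1 := by rw [Prod.fst_add]; ring
  rw [hA.cons_idealMul (a.1 - 1, a.2) b _ _ h1 rfl, hA.cons_idealMul a (b.1 - 1, b.2) _ _ h2 rfl,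
    ← consObj_idealι, hA.idealι_idealDiff, hA.idealι_idealDiff, hA.idealι_idealDiff,
    hA.idealι_idealMul, ← map_smul, ← map_add]
  exact congrArg _ (hA.diff_mul _ _ _ _ _ _ _ V _ _)

theorem IsCdga.cons_diff_diff (hA : A.IsCdga) (a : ℤ × ℕ) (x : (A.ideal a).obj V) :
    A.cons V (a.1 - 1 - 1, a.2) ((A.idealDiff (a.1 - 1, a.2)).app V ((A.idealDiff a).app V x)) =
      0 := by
  rw [← consObj_idealι]
  refine (congrArg (A.consObj V (a.1 - 1 - 1) a.2) ?_).trans (map_zero _)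
  refine (hA.idealι_idealDiff V (a.1 - 1, a.2) _).trans ?_
  rw [hA.idealι_idealDiff, hA.diff_diff]

theorem IsCdga.contract_contract (hA : A.IsCdga) (a b : ℤ × ℕ) (x : (A.ideal a).obj V) (y : (A.ideal b).obj V)
    (z : A.barTotal.obj V) : A.contract V a x (A.contract V b y z) =
      A.contract V (a + b) ((A.idealMul a b).app V (x ⊗ₜ y)) z := by
  refine LinearMap.congr_fun (f := A.contract V a x ∘ₗ A.contract V b y)
    (g := A.contract V (a + b) ((A.idealMul a b).app V (x ⊗ₜ y)))
    (A.barTotal_ext fun r z h => ?_) z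
  rw [LinearMap.comp_apply]
  cases h with
  | nil => rw [contract_nil, contract_nil, map_zero]
  | cons c w h => rw [contract_cons, contract_cons, contract_cons, hA.cons_mul_assoc]

theorem IsWord.barDiffTotal_mem {t : List (ℤ × ℕ)} {z : A.barTotal.obj V} (h : A.IsWord t z) :
    A.barDiffTotal.app V z ∈ A.barPart V (wordDeg t - 1) (wordWt t) := by
  induction h with
  | nil => rw [barDiffTotal_nil]; exact Submodule.zero_mem _
  | @cons a x t z h ih =>
    rw [barDiffTotal_cons]
    refine Submodule.add_mem _ (Submodule.add_mem _ (Submodule.neg_mem _ ?_)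
      (Submodule.smul_mem _ _ ?_)) (Submodule.smul_mem _ _ ?_)
    · exact A.cons_mem_barPart _ _ h.mem_barPart (by simp only [wordDeg_cons]; ring) rfl
    · exact A.cons_mem_barPart _ _ ih (by simp only [wordDeg_cons]; ring) rfl
    -- Two letters contribute `(|x| + 1) + (|y| + 1)` to the degree and their product only `|x| +
    -- |y| + 1`, which accounts for the drop by one.
    · cases h with
      | nil => rw [contract_nil]; exact Submodule.zero_mem _
      | cons b y h =>
        rw [contract_cons]
        exact A.cons_mem_barPart _ _ h.mem_barPart
          (by simp only [wordDeg_cons, Prod.fst_add]; ring)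
          (by simp only [wordWt_cons, Prod.snd_add]; ring)

theorem barDiffTotal_mem {i j : ℤ} {d : ℕ} (hj : j + 1 = i) {z : A.barTotal.obj V}
    (hz : z ∈ A.barPart V i d) : A.barDiffTotal.app V z ∈ A.barPart V j d := by
  obtain rfl : j = i - 1 := by omega
  refine map_mem_of_mem_barPart _ _ (fun t z h1 h2 h => ?_) hz
  subst h1 h2
  exact h.barDiffTotal_mem

/-- Double contractions cancel by associativity, mixed terms by the Leibniz rule of `A`, and double
differentials of a letter vanish. The second letter has to be exposed, since contraction depends on
it. -/
theorem IsCdga.barDiffTotal_barDiffTotal (hA : A.IsCdga) (z : A.barTotal.obj V) :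
    A.barDiffTotal.app V (A.barDiffTotal.app V z) = 0 := by
  refine LinearMap.congr_fun (f := A.barDiffTotal.app V ∘ₗ A.barDiffTotal.app V)
    (g := 0) (A.barTotal_ext fun r z h => ?_) z
  rw [LinearMap.comp_apply, LinearMap.zero_apply]
  induction h with
  | nil => rw [barDiffTotal_nil, map_zero]
  | @cons a x t z h ih =>
    rw [barDiffTotal_cons]
    simp only [map_add, map_neg, map_smul]
    rw [barDiffTotal_cons, barDiffTotal_cons, ih, hA.cons_diff_diff]
    simp only [LinearMap.zero_apply, map_zero, smul_zero, neg_zero, zero_add, add_zero]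
    cases h with
    | nil =>
      rw [barDiffTotal_nil, contract_nil, contract_nil]
      simp only [map_zero, smul_zero, neg_zero, add_zero]
    | @cons b y t z h =>
      rw [contract_cons, contract_cons, barDiffTotal_cons, barDiffTotal_cons]
      simp only [map_add, map_neg, map_smul]
      rw [contract_cons, contract_cons, hA.contract_contract, hA.cons_diff_mul]
      simp only [LinearMap.add_apply, LinearMap.smul_apply]
      simp only [ksign_one, Prod.fst_add, sub_add_cancel, ksign_add]
      -- Squares of this sign occur, and `module` does not know that they are `1`.
      rcases ksign_eq_or k a.1 with ha | ha <;> rw [ha] <;> module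

/-- The letter `x` merges with the first letter of a shuffle of `z` and `[y|z']`. If that letter is
in `z`, the result is a shuffle of the contracted word with `[y|z']` that does not begin with `y`:
all shuffles, minus those beginning with `y`. If it is `y`, the last term arises. -/
theorem contract_shuffleMul_left (a b : ℤ × ℕ) (x : (A.ideal a).obj V) (y : (A.ideal b).obj V)
    {s : List (ℤ × ℕ)} {z z' : A.barTotal.obj V} (h : A.IsWord s z) :
    A.contract V a x (A.shuffleMul V z (A.cons V b y z')) =
      A.shuffleMul V (A.contract V a x z) (A.cons V b y z') -
        ksign k ((a.1 + wordDeg s) * (b.1 + 1)) •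
          A.cons V b y (A.shuffleMul V (A.contract V a x z) z') +
        ksign k (wordDeg s * (b.1 + 1)) • A.cons V (a + b)
          ((A.idealMul a b).app V (x ⊗ₜ y)) (A.shuffleMul V z z') := by
  cases h with
  | nil =>
    rw [shuffleMul_nil_left, shuffleMul_nil_left, contract_nil, contract_cons, wordDeg_nil,
      zero_mul, ksign_zero, one_smul, map_zero, LinearMap.zero_apply, LinearMap.zero_apply,
      map_zero, smul_zero, sub_zero, zero_add]
  | @cons c w s z h =>
    rw [shuffleMul_cons_cons A c b w y h.mem_barPart, map_add, map_smul, contract_cons,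
      contract_cons, contract_cons, shuffleMul_cons_cons A (a + c) b _ y h.mem_barPart]
    simp only [wordDeg_cons, Prod.fst_add, add_mul, ksign_add]
    module

/-- The mirror image of the previous lemma: a merged first letter coming from `z'` gives all
shuffles with the contracted second word, minus those beginning with `x`. The prefactor is the
Koszul sign for moving `y`, with its unsuspended degree, past `[x|z]`. -/
theorem contract_shuffleMul_right (a b : ℤ × ℕ) (x : (A.ideal a).obj V) (y : (A.ideal b).obj V)
    {s t : List (ℤ × ℕ)} {z z' : A.barTotal.obj V} (h : A.IsWord s z) (h' : A.IsWord t z') :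
    A.contract V b y (A.shuffleMul V (A.cons V a x z) z') =
      ksign k ((a.1 + 1 + wordDeg s) * b.1) •
          (A.shuffleMul V (A.cons V a x z) (A.contract V b y z') -
        A.cons V a x (A.shuffleMul V z (A.contract V b y z'))) +
        A.cons V (b + a) ((A.idealMul b a).app V (y ⊗ₜ x)) (A.shuffleMul V z z') := by
  cases h' with
  | nil =>
    rw [shuffleMul_nil_right, shuffleMul_nil_right, contract_nil, contract_cons,
      map_zero, map_zero, map_zero, sub_zero, smul_zero, zero_add]
  | @cons c w t z' h' =>
    rw [shuffleMul_cons_cons A a c x w h.mem_barPart, map_add, map_smul, contract_cons,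
      contract_cons, contract_cons, shuffleMul_cons_cons A a (b + c) x _ h.mem_barPart]
    simp only [Prod.fst_add, add_sub_cancel_left, smul_smul, ← ksign_add]
    rw [add_comm, ksign_congr k (m := (a.1 + 1 + wordDeg s) * b.1 + _)
      (n := (a.1 + 1 + wordDeg s) * (c.1 + 1))]
    simp only [Int.even_add, Int.even_mul, Int.not_even_one]
    grind

/-- Differentials of letters and contractions inside one word match on the two sides. The terms in
which a letter of one word merges with a letter of the other exist only on the left, in pairs `x y`
and `y x`, and they cancel because `A` is graded commutative. -/
theorem IsWord.barDiffTotal_shuffleMul (hA : A.IsCdga) {s t : List (ℤ × ℕ)}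
    {z z' : A.barTotal.obj V} (h : A.IsWord s z) (h' : A.IsWord t z') :
    A.barDiffTotal.app V (A.shuffleMul V z z') =
      A.shuffleMul V (A.barDiffTotal.app V z) z' +
        ksign k (wordDeg s) • A.shuffleMul V z (A.barDiffTotal.app V z') := by
  induction h generalizing t z' with
  | nil =>
    rw [shuffleMul_nil_left, shuffleMul_nil_left, barDiffTotal_nil, wordDeg_nil, ksign_zero,
      one_smul, map_zero, LinearMap.zero_apply, zero_add]
  | @cons a x s z h ih =>
    induction h' with
    | nil =>
      rw [shuffleMul_nil_right, shuffleMul_nil_right, barDiffTotal_nil, map_zero, smul_zero,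
        add_zero]
    | @cons b y t z' h' ih' =>
      have hX := h.cons a x
      -- Everything is expanded down to terms beginning with one explicit letter. The final
      -- `cons_mul_comm` turns `y x` into a multiple of `x y`, so that the two mixed terms become
      -- comparable.
      rw [shuffleMul_cons_cons A a b x y h.mem_barPart, map_add, map_smul, barDiffTotal_cons,
        barDiffTotal_cons, ih (h'.cons b y), ih', contract_shuffleMul_left a b x y h,
        contract_shuffleMul_right a b x y h h', barDiffTotal_cons, barDiffTotal_cons,
        hA.cons_mul_comm b a y x]
      simp only [map_add, map_neg, map_smul, LinearMap.add_apply, LinearMap.neg_apply,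
        LinearMap.smul_apply]
      rw [shuffleMul_cons_cons A (a.1 - 1, a.2) b _ y h.mem_barPart,
        shuffleMul_cons_cons A a b x y h.barDiffTotal_mem,
        shuffleMul_cons_cons A a b x y h.mem_barPart,
        shuffleMul_cons_cons A a (b.1 - 1, b.2) x _ h.mem_barPart]
      have h1 : a.1 - 1 + 1 = a.1 := by ring
      have h2 : b.1 - 1 + 1 = b.1 := by ring
      simp only [wordDeg_cons, h1, h2]
      -- All signs depend only on the parities of `a.1`, `b.1` and `m`, which leaves eight linear
      -- identities.
      generalize wordDeg s = m
      by_cases ha : Even a.1 <;> by_cases hb : Even b.1 <;> by_cases hm : Even m <;>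
        simp only [ksign_eq_ite, Int.even_add, Int.even_sub, Int.even_mul, Int.not_even_one, ha,
          hb, hm, iff_true, iff_false, not_true_eq_false, or_true, or_false,
          ite_true, ite_false] <;> module

theorem barDiffTotal_shuffleMul (hA : A.IsCdga) {i : ℤ} {d : ℕ} {z : A.barTotal.obj V}
    (hz : z ∈ A.barPart V i d) (z' : A.barTotal.obj V) :
    A.barDiffTotal.app V (A.shuffleMul V z z') =
      A.shuffleMul V (A.barDiffTotal.app V z) z' +
        ksign k i • A.shuffleMul V z (A.barDiffTotal.app V z') := by
  refine barPart_ext (f := A.barDiffTotal.app V ∘ₗ (A.shuffleMul V).flip z')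
    (g := (A.shuffleMul V).flip z' ∘ₗ A.barDiffTotal.app V +
      ksign k i • (A.shuffleMul V).flip (A.barDiffTotal.app V z')) (fun s z h1 h2 h => ?_) hz
  refine LinearMap.congr_fun (f := A.barDiffTotal.app V ∘ₗ A.shuffleMul V z)
    (g := A.shuffleMul V (A.barDiffTotal.app V z) +
      ksign k i • A.shuffleMul V z ∘ₗ A.barDiffTotal.app V) (A.barTotal_ext fun t z' h' => ?_) z'
  subst h1
  exact h.barDiffTotal_shuffleMul hA h'

variable (A V) in
/-- The coefficient of the empty word. -/
def nilCoeff : A.barTotal.obj V →ₗ[k] k :=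
  (constDown k).app V ∘ₗ (directSumπ A.word []).app V

theorem nilCoeff_nil : A.nilCoeff V (A.barNil V) = 1 :=
  congrArg ((constDown k).app V) (A.directSumπ_nil V _)

theorem nilCoeff_cons (a : ℤ × ℕ) (x : (A.ideal a).obj V) (z : A.barTotal.obj V) :
    A.nilCoeff V (A.cons V a x z) = 0 := by
  induction z using A.barTotal_induction with
  | h0 => simp only [map_zero]
  | hadd x y hx hy => simp only [map_add, hx, hy, add_zero]
  | h t u =>
    rw [cons_wordι, nilCoeff, LinearMap.comp_apply, directSumπ, wordι, directSumDesc_ι,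
      dif_neg (List.cons_ne_nil a t), PolyFunctor.Hom.zero_app, map_zero]

theorem nilCoeff_shuffleMul (z z' : A.barTotal.obj V) :
    A.nilCoeff V (A.shuffleMul V z z') = A.nilCoeff V z * A.nilCoeff V z' := by
  refine LinearMap.congr_fun (f := A.nilCoeff V ∘ₗ (A.shuffleMul V).flip z')
    (g := LinearMap.mulRight k (A.nilCoeff V z') ∘ₗ A.nilCoeff V)
    (A.barTotal_ext fun s z h => ?_) z
  refine LinearMap.congr_fun (f := A.nilCoeff V ∘ₗ A.shuffleMul V z)
    (g := LinearMap.mulLeft k (A.nilCoeff V z) ∘ₗ A.nilCoeff V)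
    (A.barTotal_ext fun t z' h' => ?_) z'
  simp only [LinearMap.comp_apply, LinearMap.mulLeft_apply]
  cases h with
  | nil => rw [shuffleMul_nil_left, nilCoeff_nil, one_mul]
  | cons a x h =>
    cases h' with
    | nil => rw [shuffleMul_nil_right, nilCoeff_nil, mul_one]
    | cons b y h' =>
      rw [shuffleMul_cons_cons A a b x y h.mem_barPart, map_add, map_smul, nilCoeff_cons,
        nilCoeff_cons, nilCoeff_cons, zero_mul, smul_zero, zero_add]

theorem nilCoeff_barDiffTotal (z : A.barTotal.obj V) :
    A.nilCoeff V (A.barDiffTotal.app V z) = 0 := by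
  refine LinearMap.congr_fun (f := A.nilCoeff V ∘ₗ A.barDiffTotal.app V) (g := 0)
    (A.barTotal_ext fun s z h => ?_) z
  rw [LinearMap.comp_apply, LinearMap.zero_apply]
  cases h with
  | nil => rw [barDiffTotal_nil, map_zero]
  | cons a x h =>
    rw [barDiffTotal_cons, map_add, map_add, map_neg, map_smul, map_smul, nilCoeff_cons,
      nilCoeff_cons]
    cases h with
    | nil => rw [contract_nil, map_zero, smul_zero, neg_zero, add_zero, add_zero]
    | cons b y h => rw [contract_cons, nilCoeff_cons, smul_zero, neg_zero, add_zero, add_zero]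

variable (A) in
/-- The inclusion of a homogeneous component of the bar construction. -/
def barι (i : ℤ) (d : ℕ) : PolyFunctor.Hom (A.bar.obj i d) A.barTotal := A.barIncl i d

variable (A) in
theorem barι_mem (i : ℤ) (d : ℕ) (z : (A.bar.obj i d).obj V) :
    (A.barι i d).app V z ∈ A.barPart V i d := A.barIncl_mem i d z

variable (A) in
theorem barι_injective (i : ℤ) (d : ℕ) : Function.Injective ((A.barι i d).app V) :=
  A.barIncl_injective i d

theorem bar_augAt (i : ℤ) (d : ℕ) (z : (A.bar.obj i d).obj V) :
    (A.bar.augAt i d).app V z = A.nilCoeff V ((A.barι i d).app V z) := by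
  by_cases h : i = 0 ∧ d = 0
  · obtain ⟨rfl, rfl⟩ := h
    rfl
  · rw [A.bar.augAt_of_ne V h]
    refine (barPart_ext (f := A.nilCoeff V) (g := 0) (fun t z h1 h2 hz => ?_)
      (A.barι_mem i d z)).symm
    cases hz with
    | nil => exact absurd ⟨h1.symm, h2.symm⟩ h
    | cons a x hz => exact nilCoeff_cons a x _

theorem barι_mul {i j l : ℤ} {d e n : ℕ} (hi : i + j = l) (hd : d + e = n)
    (x : (A.bar.obj i d).obj V) (y : (A.bar.obj j e).obj V) :
    (A.barι l n).app V ((A.bar.mul hi hd).app V (x ⊗ₜ y)) =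
      A.shuffleMul V ((A.barι i d).app V x) ((A.barι j e).app V y) := by
  subst hi hd
  exact A.barIncl_barProj (shuffleMul_mem (A.barι_mem i d x) (A.barι_mem j e y))

theorem barι_diff {i j : ℤ} (h : j + 1 = i) (d : ℕ) (x : (A.bar.obj i d).obj V) :
    (A.barι j d).app V ((A.bar.diff h d).app V x) =
      A.barDiffTotal.app V ((A.barι i d).app V x) :=
  A.barIncl_barProj (barDiffTotal_mem h (A.barι_mem i d x))

theorem barι_unit : (A.barι 0 0).app V (A.bar.unit.app V (1 : k)) = A.barNil V :=
  A.barIncl_barProj A.barNil_mem_barPart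

/-- The reduced bar construction of a commutative differential graded augmented algebra is again
such an algebra. -/
theorem IsCdga.bar (hA : A.IsCdga) : A.bar.IsCdga where
  one_mul i d V x := by
    apply A.barι_injective i d
    rw [barι_mul, barι_unit, shuffleMul_nil_left]
  mul_one i d V x := by
    apply A.barι_injective i d
    rw [barι_mul, barι_unit, shuffleMul_nil_right]
  mul_assoc _ _ _ _ _ _ _ _ V x y z := by
    apply A.barι_injective
    rw [barι_mul, barι_mul, barι_mul, barι_mul, shuffleMul_assoc]
  mul_comm _ _ _ _ V x y := by
    apply A.barι_injective
    rw [map_smul, barι_mul, barι_mul]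
    exact shuffleMul_comm (A.barι_mem _ _ x) (A.barι_mem _ _ y)
  diff_diff _ _ d V x := by
    apply A.barι_injective
    rw [barι_diff, barι_diff, map_zero, hA.barDiffTotal_barDiffTotal]
  diff_mul _ _ _ _ _ _ _ V x y := by
    apply A.barι_injective
    rw [map_add, map_smul, barι_diff, barι_mul, barι_mul, barι_mul, barι_diff,
      barι_diff]
    exact barDiffTotal_shuffleMul hA (A.barι_mem _ _ x) _
  aug_mul _ _ V x y := by
    rw [bar_augAt, bar_augAt, bar_augAt, barι_mul, nilCoeff_shuffleMul]
  aug_diff V x := by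
    have h := bar_augAt 0 0 ((A.bar.diff (zero_add 1) 0).app V x)
    rw [barι_diff, nilCoeff_barDiffTotal] at h
    exact h

end PolyDga

/-! ### The action of strict polynomial functors on `k`-linear maps. -/

namespace PolyFunctor

variable {k : Type u} [CommRing k]

theorem one_tmul_injective (M : Type*) [AddCommGroup M] [Module k M] :
    Function.Injective fun x : M => (1 : k) ⊗ₜ[k] x :=
  Function.LeftInverse.injective (g := TensorProduct.lid k M) fun x => by
    rw [TensorProduct.lid_tmul, one_smul]

/-- A characterization of `linMap` by base change to `R = k`; the functoriality rules below are read
off from those of `map`. -/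
theorem linMap_eq_of_map (F : PolyFunctor.{u, v} k) {V W : FGProj k} {g : V →ₗ[k] W}
    {l : F.obj V →ₗ[k] F.obj W} (h : F.map k (g.baseChange k) = l.baseChange k) :
    F.linMap g = l := by
  rw [map_baseChange] at h
  ext x
  apply one_tmul_injective (k := k)
  exact LinearMap.congr_fun h (1 ⊗ₜ x)

theorem linMap_id (F : PolyFunctor.{u, v} k) (V : FGProj k) :
    F.linMap (LinearMap.id : V →ₗ[k] V) = LinearMap.id :=
  F.linMap_eq_of_map (by rw [LinearMap.baseChange_id, LinearMap.baseChange_id, F.map_id])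

theorem linMap_comp (F : PolyFunctor.{u, v} k) {U V W : FGProj k} (g : V →ₗ[k] W)
    (f : U →ₗ[k] V) : F.linMap (g ∘ₗ f) = F.linMap g ∘ₗ F.linMap f :=
  F.linMap_eq_of_map (by rw [LinearMap.baseChange_comp, F.map_comp, map_baseChange,
    map_baseChange, LinearMap.baseChange_comp])

theorem linMap_linMap (F : PolyFunctor.{u, v} k) {U V W : FGProj k} (g : V →ₗ[k] W)
    (f : U →ₗ[k] V) (x : F.obj U) : F.linMap g (F.linMap f x) = F.linMap (g ∘ₗ f) x := by
  rw [linMap_comp]; rfl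

theorem linMap_tensor (F : PolyFunctor.{u, v} k) (G : PolyFunctor.{u, w} k) {V W : FGProj k}
    (g : V →ₗ[k] W) :
    (tensor F G).linMap g = TensorProduct.map (F.linMap g) (G.linMap g) := by
  apply linMap_eq_of_map
  change bcTensor _ _ = _
  rw [map_baseChange, map_baseChange]
  ext
  simp [bcTensor]

theorem Hom.app_linMap {F : PolyFunctor.{u, v} k} {G : PolyFunctor.{u, w} k} (φ : Hom F G)
    {V W : FGProj k} (g : V →ₗ[k] W) (x : F.obj V) :
    φ.app W (F.linMap g x) = G.linMap g (φ.app V x) := by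
  apply one_tmul_injective (k := k)
  have h := φ.naturality_apply k (g.baseChange k) (1 ⊗ₜ x)
  rw [map_baseChange, map_baseChange] at h
  exact h

theorem linMap_const {V W : FGProj k} (g : V →ₗ[k] W) :
    (const k).linMap g = (LinearMap.id : k →ₗ[k] k) :=
  (const k).linMap_eq_of_map (by rw [LinearMap.baseChange_id])

/-- The zero map is `0` times itself, and `0 ^ d = 0` for positive weight. This is what makes the
parts of positive weight disappear in the counit axiom. -/
theorem IsHomogeneous.linMap_zero {F : PolyFunctor.{u, v} k} {d : ℕ} (hF : F.IsHomogeneous d)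
    (hd : d ≠ 0) (V W : FGProj k) : F.linMap (0 : V →ₗ[k] W) = 0 := by
  apply linMap_eq_of_map
  have h := hF k V W 0 0
  rw [zero_smul, zero_pow hd, zero_smul] at h
  rw [LinearMap.baseChange_zero, LinearMap.baseChange_zero, h]

theorem directSumπ_apply {ι : Type w} [DecidableEq ι] (F : ι → PolyFunctor.{u, v} k) (i : ι)
    (V : FGProj k) (t : (directSum F).obj V) :
    (directSumπ F i).app V t = DirectSum.component k ι (fun i => (F i).obj V) i t := by
  induction t using DirectSum.induction_on with
  | zero => rw [map_zero, map_zero]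
  | add x y hx hy => rw [map_add, map_add, hx, hy]
  | of j t =>
    have h : (directSumπ F i).app V (DirectSum.lof k ι (fun i => (F i).obj V) j t) = _ :=
      DirectSum.toModule_lof k (M := fun i => (F i).obj V) j t
    refine h.trans (Eq.trans ?_
      (DirectSum.component.of k (M := fun i => (F i).obj V) i j t).symm)
    by_cases hj : j = i
    · subst hj
      beta_reduce
      rw [dif_pos rfl, dif_pos rfl]
      rfl
    · beta_reduce
      rw [dif_neg hj, dif_neg hj]
      rfl

end PolyFunctor

/-! ### The comultiplication of an exponential functor. -/

namespace PolyAlgebra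

open PolyFunctor

variable {k : Type u} [CommRing k] (E : PolyAlgebra.{u, v} k)

theorem mul_linMap {d e n : ℕ} (h : d + e = n) {V W : FGProj k} (g : V →ₗ[k] W)
    (x : (E.obj d).obj V) (y : (E.obj e).obj V) :
    (E.mul h).app W ((E.obj d).linMap g x ⊗ₜ (E.obj e).linMap g y) =
      (E.obj n).linMap g ((E.mul h).app V (x ⊗ₜ y)) := by
  rw [← PolyFunctor.Hom.app_linMap, linMap_tensor]
  rfl

theorem linMap_unit {V W : FGProj k} (g : V →ₗ[k] W) (c : k) :
    (E.obj 0).linMap g (E.unit.app V c) = E.unit.app W c := by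
  rw [← PolyFunctor.Hom.app_linMap, linMap_const]
  rfl

/-- The product `E(V) × E(W) → E(V ⊕ W)`. -/
def ext {d e n : ℕ} (h : d + e = n) (V W : FGProj k) :
    (E.obj d).obj V ⊗[k] (E.obj e).obj W →ₗ[k] (E.obj n).obj (V.prod W) :=
  (E.mul h).app (V.prod W) ∘ₗ
    TensorProduct.map ((E.obj d).linMap (W := V.prod W) (LinearMap.inl k V W))
      ((E.obj e).linMap (W := V.prod W) (LinearMap.inr k V W))

theorem linMap_ext {d e n : ℕ} (h : d + e = n) {V W U : FGProj k} (g : V.prod W →ₗ[k] U)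
    (x : (E.obj d).obj V) (y : (E.obj e).obj W) :
    (E.obj n).linMap (V := V.prod W) g (E.ext h V W (x ⊗ₜ y)) =
      (E.mul h).app U ((E.obj d).linMap (g ∘ₗ LinearMap.inl k V W) x ⊗ₜ
        (E.obj e).linMap (g ∘ₗ LinearMap.inr k V W) y) := by
  rw [ext, LinearMap.comp_apply, TensorProduct.map_tmul, ← mul_linMap, linMap_linMap,
    linMap_linMap]

theorem linMap_prodMap_ext {d e n : ℕ} (h : d + e = n) {V W V' W' : FGProj k} (f : V →ₗ[k] V')
    (g : W →ₗ[k] W') (t : (E.obj d).obj V ⊗[k] (E.obj e).obj W) :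
    (E.obj n).linMap (V := V.prod W) (W := V'.prod W') (f.prodMap g) (E.ext h V W t) =
      E.ext h V' W' (TensorProduct.map ((E.obj d).linMap f) ((E.obj e).linMap g) t) := by
  induction t with
  | zero => simp only [map_zero]
  | add x y hx hy => simp only [map_add, hx, hy]
  | tmul x y =>
    rw [linMap_ext, ext, LinearMap.comp_apply, TensorProduct.map_tmul, TensorProduct.map_tmul,
      linMap_linMap, linMap_linMap]
    congr 4 <;> ext <;> simp

variable {E} (hE : E.IsExponential)

/-- The component `E_n(V ⊕ W) → E_d(V) ⊗ E_e(W)` of the inverse of the exponential map. -/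
def IsExponential.split {d e n : ℕ} (h : d + e = n) (V W : FGProj k) :
    (E.obj n).obj (V.prod W) →ₗ[k] (E.obj d).obj V ⊗[k] (E.obj e).obj W :=
  DirectSum.component k {p : ℕ × ℕ // p.1 + p.2 = n}
    (fun p => (E.obj p.1.1).obj V ⊗[k] (E.obj p.1.2).obj W) ⟨(d, e), h⟩ ∘ₗ
    (LinearEquiv.ofBijective _ (hE.exp_bijective n V W)).symm.toLinearMap

theorem expMap_lof {n : ℕ} (p : {p : ℕ × ℕ // p.1 + p.2 = n}) (V W : FGProj k)
    (t : (E.obj p.1.1).obj V ⊗[k] (E.obj p.1.2).obj W) :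
    E.expMap n V W (DirectSum.lof k _ _ p t) = E.ext p.2 V W t :=
  DirectSum.toModule_lof k (M := fun p : {p : ℕ × ℕ // p.1 + p.2 = n} =>
    (E.obj p.1.1).obj V ⊗[k] (E.obj p.1.2).obj W) p t

theorem IsExponential.split_ext {d e n : ℕ} (h : d + e = n) {V W : FGProj k}
    (t : (E.obj d).obj V ⊗[k] (E.obj e).obj W) : hE.split h V W (E.ext h V W t) = t := by
  have h1 := expMap_lof (E := E) ⟨(d, e), h⟩ V W t
  rw [split, LinearMap.comp_apply, ← h1]
  exact (congrArg _ ((LinearEquiv.ofBijective _ (hE.exp_bijective n V W)).symm_apply_apply _)).trans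
    (DirectSum.component.lof_self k _ _)

theorem IsExponential.split_ext_of_ne {d e d' e' n : ℕ} (h : d + e = n) (h' : d' + e' = n)
    (hd : d' ≠ d) {V W : FGProj k} (t : (E.obj d').obj V ⊗[k] (E.obj e').obj W) :
    hE.split h V W (E.ext h' V W t) = 0 := by
  have h1 := expMap_lof (E := E) ⟨(d', e'), h'⟩ V W t
  rw [split, LinearMap.comp_apply, ← h1]
  refine (congrArg _ ((LinearEquiv.ofBijective _
    (hE.exp_bijective n V W)).symm_apply_apply _)).trans ?_
  rw [DirectSum.component.of, dif_neg]
  intro h2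
  exact hd (congrArg (fun p => p.1.1) h2)

/-- By surjectivity of the exponential map, identities about `split` need only be checked on
products of an element of `E_d(V)` and one of `E_e(W)`. There `split` either returns the factors or,
for the wrong weights, vanishes. -/
theorem IsExponential.ext_induction (hE : E.IsExponential) {n : ℕ} {V W : FGProj k}
    {P : (E.obj n).obj (V.prod W) → Prop} (h0 : P 0) (hadd : ∀ x y, P x → P y → P (x + y))
    (h : ∀ (d e : ℕ) (h : d + e = n) x y, P (E.ext h V W (x ⊗ₜ y))) (z) : P z := by
  obtain ⟨t, rfl⟩ := (hE.exp_bijective n V W).2 z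
  induction t using DirectSum.induction_on with
  | zero => rw [map_zero]; exact h0
  | add x y hx hy => rw [map_add]; exact hadd _ _ hx hy
  | of p t =>
    change P (E.expMap n V W (DirectSum.lof k _ _ p t))
    rw [expMap_lof]
    induction t with
    | zero => rw [map_zero]; exact h0
    | add x y hx hy => rw [map_add]; exact hadd _ _ hx hy
    | tmul x y => exact h _ _ p.2 x y

/-- The diagonal map of `V`. -/
abbrev diag {k : Type u} [CommRing k] (V : FGProj k) : V →ₗ[k] V.prod V := LinearMap.prod LinearMap.id LinearMap.id

theorem comul_app {d e n : ℕ} (h : d + e = n) (V : FGProj k) (y : (E.obj n).obj V) :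
    (E.comul hE h).app V y = hE.split h V V ((E.obj n).linMap (W := V.prod V) (diag V) y) :=
  directSumπ_apply (fun p : {p : ℕ × ℕ // p.1 + p.2 = n} =>
    tensor (E.obj p.1.1) (E.obj p.1.2)) ⟨(d, e), h⟩ V _

theorem IsExponential.split_linMap_prodMap {d e n : ℕ} (h : d + e = n) {V W V' W' : FGProj k}
    (f : V →ₗ[k] V') (g : W →ₗ[k] W') (z : (E.obj n).obj (V.prod W)) :
    hE.split h V' W' ((E.obj n).linMap (V := V.prod W) (W := V'.prod W') (f.prodMap g) z) =
      TensorProduct.map ((E.obj d).linMap f) ((E.obj e).linMap g) (hE.split h V W z) := by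
  induction z using hE.ext_induction with
  | h0 => simp only [map_zero]
  | hadd x y hx hy => simp only [map_add, hx, hy]
  | h d' e' h' x y =>
    rw [linMap_prodMap_ext]
    by_cases hd : d' = d
    · subst hd
      obtain rfl : e' = e := by omega
      rw [hE.split_ext, hE.split_ext]
    · rw [hE.split_ext_of_ne h h' hd, hE.split_ext_of_ne h h' hd, map_zero]

/-- The associativity isomorphism of the direct sum. -/
def prodAssocInv {k : Type u} [CommRing k] (U V W : FGProj k) : U.prod (V.prod W) →ₗ[k] (U.prod V).prod W :=
  (LinearEquiv.prodAssoc k U V W).symm.toLinearMap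

/-- The symmetry isomorphism of the direct sum. -/
def prodSwap {k : Type u} [CommRing k] (V W : FGProj k) : V.prod W →ₗ[k] W.prod V :=
  (LinearEquiv.prodComm k V W).toLinearMap

/-- On a triple product of weights `(a', b', c')`, both sides give the tensor of the three factors
if the weights are `(a, b, c)`, and zero otherwise. Associativity of `E` is used only to write the
triple product with either bracketing. -/
theorem IsExponential.assoc_split {a b c ab bc n : ℕ} (hab : a + b = ab) (hbc : b + c = bc)
    (h : ab + c = n) (h' : a + bc = n) {U V W : FGProj k}
    (z : (E.obj n).obj (U.prod (V.prod W))) :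
    TensorProduct.assoc k _ _ _ (TensorProduct.map (hE.split hab U V) LinearMap.id
      (hE.split h (U.prod V) W ((E.obj n).linMap (prodAssocInv U V W) z))) =
      TensorProduct.map LinearMap.id (hE.split hbc V W) (hE.split h' U (V.prod W) z) := by
  induction z using hE.ext_induction with
  | h0 => simp only [map_zero]
  | hadd x y hx hy => simp only [map_add, hx, hy]
  | h a' m h1 x w =>
  induction w using hE.ext_induction with
  | h0 => simp only [map_zero, TensorProduct.tmul_zero]
  | hadd x y hx hy => simp only [map_add, TensorProduct.tmul_add, hx, hy]
  | h b' c' h2 y t =>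
    have e1 : (E.obj n).linMap (prodAssocInv U V W)
        (E.ext h1 U (V.prod W) (x ⊗ₜ E.ext h2 V W (y ⊗ₜ t))) =
        E.ext (d := a' + b') (by omega) (U.prod V) W (E.ext rfl U V (x ⊗ₜ y) ⊗ₜ t) := by
      rw [linMap_ext, linMap_ext, ← E.mul_assoc rfl h2 (by omega) h1]
      rw [ext, LinearMap.comp_apply, TensorProduct.map_tmul, linMap_ext]
      congr 3
    rw [e1]
    by_cases hd : a' + b' = ab
    · subst hd
      obtain rfl : c' = c := by omega
      rw [hE.split_ext, TensorProduct.map_tmul]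
      by_cases ha : a' = a
      · subst ha
        obtain rfl : b' = b := by omega
        obtain rfl : m = bc := by omega
        rw [hE.split_ext, hE.split_ext, TensorProduct.map_tmul, hE.split_ext]
        rfl
      · rw [hE.split_ext_of_ne _ _ ha, hE.split_ext_of_ne _ _ ha, TensorProduct.zero_tmul, map_zero,
          map_zero]
    · rw [hE.split_ext_of_ne _ _ hd, map_zero, map_zero]
      by_cases ha : a' = a
      · subst ha
        obtain rfl : m = bc := by omega
        rw [hE.split_ext, TensorProduct.map_tmul, hE.split_ext_of_ne _ _ (by omega),
          TensorProduct.tmul_zero]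
      · rw [hE.split_ext_of_ne _ _ ha, map_zero]

/-- Duplicating either copy in the diagonal of `V` gives, up to the associativity of the direct sum,
the same map `V → V ⊕ V ⊕ V`. Naturality of `split` moves the second diagonal inside, and
`assoc_split` compares the two bracketings. -/
theorem IsExponential.comul_coassoc {a b c ab bc n : ℕ} (hab : a + b = ab) (hbc : b + c = bc)
    (h : ab + c = n) (h' : a + bc = n) {V : FGProj k} (y : (E.obj n).obj V) :
    TensorProduct.assoc k _ _ _ (TensorProduct.map ((E.comul hE hab).app V) LinearMap.id
      ((E.comul hE h).app V y)) =
      TensorProduct.map LinearMap.id ((E.comul hE hbc).app V) ((E.comul hE h').app V y) := by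
  have e : ∀ {d e n : ℕ} (h : d + e = n), (E.comul hE h).app V =
      hE.split h V V ∘ₗ (E.obj n).linMap (W := V.prod V) (diag V) :=
    fun h => LinearMap.ext (comul_app hE h V)
  rw [e, e, e, e]
  have h1 := hE.split_linMap_prodMap h (diag V) (LinearMap.id : V →ₗ[k] V)
    ((E.obj n).linMap (W := V.prod V) (diag V) y)
  have h2 := hE.split_linMap_prodMap h' (LinearMap.id : V →ₗ[k] V) (diag V)
    ((E.obj n).linMap (W := V.prod V) (diag V) y)
  rw [linMap_id] at h1 h2
  have h3 := hE.assoc_split hab hbc h h' (U := V) (V := V) (W := V)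
    ((E.obj n).linMap (V := V.prod V) (W := V.prod (V.prod V)) (LinearMap.id.prodMap (diag V))
      ((E.obj n).linMap (W := V.prod V) (diag V) y))
  rw [h2] at h3
  have h4 : (E.obj n).linMap (prodAssocInv V V V) ((E.obj n).linMap (V := V.prod V)
      (W := V.prod (V.prod V)) (LinearMap.id.prodMap (diag V))
      ((E.obj n).linMap (W := V.prod V) (diag V) y)) =
      (E.obj n).linMap (V := V.prod V) (W := (V.prod V).prod V) ((diag V).prodMap LinearMap.id)
      ((E.obj n).linMap (W := V.prod V) (diag V) y) := by
    rw [linMap_linMap, linMap_linMap, linMap_linMap]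
    rfl
  rw [h4, h1] at h3
  have m1 : TensorProduct.map (hE.split hab V V ∘ₗ (E.obj ab).linMap (W := V.prod V) (diag V))
      (LinearMap.id : (E.obj c).obj V →ₗ[k] _) =
      TensorProduct.map (hE.split hab V V) LinearMap.id ∘ₗ
        TensorProduct.map ((E.obj ab).linMap (W := V.prod V) (diag V)) LinearMap.id := by
    rw [← TensorProduct.map_comp, LinearMap.id_comp]
  have m2 : TensorProduct.map (LinearMap.id : (E.obj a).obj V →ₗ[k] _)
      (hE.split hbc V V ∘ₗ (E.obj bc).linMap (W := V.prod V) (diag V)) =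
      TensorProduct.map LinearMap.id (hE.split hbc V V) ∘ₗ
        TensorProduct.map LinearMap.id ((E.obj bc).linMap (W := V.prod V) (diag V)) := by
    rw [← TensorProduct.map_comp, LinearMap.id_comp]
  rw [m1, m2]
  exact h3

theorem IsExponential.comm_split (hcomm : E.IsCommutative) {d e n : ℕ} (h : d + e = n)
    (h' : e + d = n) {V W : FGProj k} (z : (E.obj n).obj (V.prod W)) :
    TensorProduct.comm k _ _ (hE.split h V W z) = hE.split h' W V ((E.obj n).linMap
      (prodSwap V W) z) := by
  induction z using hE.ext_induction with
  | h0 => simp only [map_zero]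
  | hadd x y hx hy => simp only [map_add, hx, hy]
  | h d' e' h1 x y =>
    have e1 : (E.obj n).linMap (prodSwap V W) (E.ext h1 V W (x ⊗ₜ y)) =
        E.ext (by omega) W V (y ⊗ₜ x) := by
      rw [linMap_ext, hcomm _ (by omega)]
      rfl
    rw [e1]
    by_cases hd : d' = d
    · subst hd
      obtain rfl : e' = e := by omega
      rw [hE.split_ext, hE.split_ext]
      rfl
    · rw [hE.split_ext_of_ne _ _ hd, hE.split_ext_of_ne _ _ (by omega), map_zero]

/-- The swap of `V ⊕ V` fixes the diagonal, so this follows from `comm_split`, where commutativity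
of `E` is used. -/
theorem IsExponential.comul_comm (hcomm : E.IsCommutative) {d e n : ℕ} (h : d + e = n)
    (h' : e + d = n) {V : FGProj k} (y : (E.obj n).obj V) :
    TensorProduct.comm k _ _ ((E.comul hE h).app V y) = (E.comul hE h').app V y := by
  rw [comul_app, comul_app, hE.comm_split hcomm h h', linMap_linMap]
  rfl

theorem counit_unit (V : FGProj k) (c : k) : (E.counit hE).app V (E.unit.app V c) = c :=
  (LinearEquiv.ofBijective _ (hE.unit_bijective V)).symm_apply_apply c

theorem unit_counit (V : FGProj k) (x : (E.obj 0).obj V) :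
    E.unit.app V ((E.counit hE).app V x) = x :=
  (LinearEquiv.ofBijective _ (hE.unit_bijective V)).apply_symm_apply x

/-- The projection to `W` kills `V`. A product `x y` with `x` of positive weight thus goes to zero,
and if `x` has weight zero it is a multiple of the unit, so `x y` goes to the counit of `x` times
`y`. -/
theorem IsExponential.lid_counit_split {n : ℕ} {V W : FGProj k}
    (z : (E.obj n).obj (V.prod W)) :
    TensorProduct.lid k _ (TensorProduct.map ((E.counit hE).app V) LinearMap.id
      (hE.split (zero_add n) V W z)) =
      (E.obj n).linMap (V := V.prod W) (LinearMap.snd k V W) z := by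
  induction z using hE.ext_induction with
  | h0 => simp only [map_zero]
  | hadd x y hx hy => simp only [map_add, hx, hy]
  | h d e h1 x y =>
    rw [linMap_ext, LinearMap.snd_comp_inl, LinearMap.snd_comp_inr, linMap_id]
    by_cases hd : d = 0
    · subst hd
      obtain rfl : e = n := by omega
      rw [hE.split_ext, ← unit_counit hE V x, linMap_unit, TensorProduct.map_tmul, counit_unit]
      have e1 : E.unit.app W ((E.counit hE).app V x) =
          ((E.counit hE).app V x : k) • E.unit.app W (1 : k) := by
        rw [← map_smul, smul_eq_mul, _root_.mul_one]
      rw [e1, ← TensorProduct.smul_tmul', map_smul]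
      exact congrArg _ (E.one_mul _ W y).symm
    · rw [hE.split_ext_of_ne _ _ hd, (E.homogeneous d).linMap_zero hd]
      simp only [LinearMap.zero_apply, TensorProduct.zero_tmul, map_zero]

theorem IsExponential.lid_counit_comul {n : ℕ} {V : FGProj k} (y : (E.obj n).obj V) :
    TensorProduct.lid k _ (TensorProduct.map ((E.counit hE).app V) LinearMap.id
      ((E.comul hE (zero_add n)).app V y)) = y := by
  rw [comul_app, hE.lid_counit_split, linMap_linMap]
  exact LinearMap.congr_fun ((E.obj n).linMap_id V) y

/-- The unit of `E(V ⊕ V)` is the product of the two units. The augmentation of the convolution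
algebra evaluates at the unit of `E`, so this is what makes it multiplicative. -/
theorem IsExponential.comul_unit (V : FGProj k) :
    (E.comul hE (zero_add 0)).app V (E.unit.app V (1 : k)) =
      E.unit.app V (1 : k) ⊗ₜ E.unit.app V (1 : k) := by
  rw [comul_app, linMap_unit]
  have h : E.unit.app (V.prod V) (1 : k) =
      E.ext (zero_add 0) V V (E.unit.app V (1 : k) ⊗ₜ E.unit.app V (1 : k)) := by
    rw [ext, LinearMap.comp_apply, TensorProduct.map_tmul, linMap_unit, linMap_unit, E.one_mul]
  rw [h, hE.split_ext]

end PolyAlgebra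

/-! ### The convolution algebra is a commutative dg algebra. -/

namespace PolyDga

open PolyFunctor

variable {k : Type u} [CommRing k] {E : PolyAlgebra.{u, v} k} (hE : E.IsExponential)
  {A : PolyDga.{u, w} k}

theorem convAlg_mul_app {i j l : ℤ} {d e n : ℕ} (hi : i + j = l) (hd : d + e = n) (V W : FGProj k)
    (φ : ((convAlg E hE A).obj i d).obj V) (ψ : ((convAlg E hE A).obj j e).obj V)
    (y : (E.obj n).obj W) :
    PolyFunctor.Hom.app (G := (A.obj l n).param V)
        (((convAlg E hE A).mul hi hd).app V (φ ⊗ₜ ψ)) W y =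
      (A.mul hi hd).app (V.tensor W) (TensorProduct.map (PolyFunctor.Hom.app φ W)
        (PolyFunctor.Hom.app ψ W) ((E.comul hE hd).app W y)) := rfl

theorem convAlg_diff_app {i j : ℤ} (h : j + 1 = i) (d : ℕ) (V W : FGProj k)
    (φ : ((convAlg E hE A).obj i d).obj V) (y : (E.obj d).obj W) :
    PolyFunctor.Hom.app (G := (A.obj j d).param V)
        (((convAlg E hE A).diff h d).app V φ) W y =
      (A.diff h d).app (V.tensor W) (PolyFunctor.Hom.app φ W y) := rfl

theorem convAlg_unit_app (V W : FGProj k) (y : (E.obj 0).obj W) :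
    PolyFunctor.Hom.app (G := (A.obj 0 0).param V)
        ((convAlg E hE A).unit.app V (1 : k)) W y =
      A.unit.app (V.tensor W) ((E.counit hE).app W y) :=
  one_smul k (A.unit.app (V.tensor W) ((E.counit hE).app W y))

theorem convAlg_aug_app (V : FGProj k) (φ : ((convAlg E hE A).obj 0 0).obj V) :
    (convAlg E hE A).aug.app V φ = A.aug.app (V.tensor (FGProj.unit k))
      (PolyFunctor.Hom.app φ (FGProj.unit k) (E.unit.app (FGProj.unit k) (1 : k))) := rfl

theorem convAlg_augAt_app (i : ℤ) (V : FGProj k) (φ : ((convAlg E hE A).obj i 0).obj V) :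
    ((convAlg E hE A).augAt i 0).app V φ = (A.augAt i 0).app (V.tensor (FGProj.unit k))
      (PolyFunctor.Hom.app φ (FGProj.unit k) (E.unit.app (FGProj.unit k) (1 : k))) := by
  by_cases h : i = 0
  · subst h; rfl
  · rw [augAt_of_ne _ _ (by tauto), augAt_of_ne _ _ (by tauto)]

theorem convAlg_ext {i : ℤ} {d : ℕ} {V : FGProj k} {φ ψ : ((convAlg E hE A).obj i d).obj V}
    (h : ∀ W y, PolyFunctor.Hom.app (G := (A.obj i d).param V) φ W y =
      PolyFunctor.Hom.app (G := (A.obj i d).param V) ψ W y) : φ = ψ :=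
  PolyFunctor.Hom.ext h

theorem IsCdga.unit_mul (hA : A.IsCdga) {i : ℤ} {d : ℕ} (V : FGProj k) (c : k)
    (x : (A.obj i d).obj V) :
    (A.mul (zero_add i) (zero_add d)).app V (A.unit.app V c ⊗ₜ x) = c • x := by
  have h : A.unit.app V c = c • A.unit.app V (1 : k) := by
    rw [← map_smul, smul_eq_mul, _root_.mul_one]
  rw [h, ← TensorProduct.smul_tmul', map_smul, hA.one_mul]

/-- After evaluation at `y ∈ E(W)`, the product depends on `y` only through its comultiplication,
and on pure tensors the axiom is the one of `A` combined with a property of the comultiplication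
(here the counit). The following axioms are treated in the same way. -/
theorem IsCdga.convAlg_one_mul (hA : A.IsCdga) (i : ℤ) (d : ℕ) (V : FGProj k)
    (φ : ((convAlg E hE A).obj i d).obj V) :
    ((convAlg E hE A).mul (zero_add i) (zero_add d)).app V
      ((convAlg E hE A).unit.app V (1 : k) ⊗ₜ φ) = φ := by
  apply convAlg_ext hE
  intro W y
  rw [convAlg_mul_app]
  have key : ∀ t : (E.obj 0).obj W ⊗[k] (E.obj d).obj W,
      (A.mul (zero_add i) (zero_add d)).app (V.tensor W) (TensorProduct.map
        (PolyFunctor.Hom.app ((convAlg E hE A).unit.app V (1 : k)) W)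
        (PolyFunctor.Hom.app φ W) t) = PolyFunctor.Hom.app φ W
        (TensorProduct.lid k _ (TensorProduct.map ((E.counit hE).app W) LinearMap.id t)) := by
    intro t
    induction t using TensorProduct.induction_on with
    | zero => simp only [map_zero]
    | add x y hx hy => simp only [map_add, hx, hy]
    | tmul x y =>
      rw [TensorProduct.map_tmul, convAlg_unit_app, TensorProduct.map_tmul]
      refine (hA.unit_mul _ _ _).trans ?_
      exact ((PolyFunctor.Hom.app φ W).map_smul _ _).symm
  rw [key, hE.lid_counit_comul]

/-- Because `E` is in degree `0`, its cocommutativity is without sign, and the only sign is the one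
of `A`. -/
theorem IsCdga.convAlg_mul_comm (hA : A.IsCdga) (hcomm : E.IsCommutative) {i j l : ℤ}
    {d e n : ℕ} (hi : i + j = l) (hi' : j + i = l) (hd : d + e = n) (hd' : e + d = n)
    (V : FGProj k) (φ : ((convAlg E hE A).obj i d).obj V)
    (ψ : ((convAlg E hE A).obj j e).obj V) :
    ((convAlg E hE A).mul hi hd).app V (φ ⊗ₜ ψ) =
      ksign k (i * j) • ((convAlg E hE A).mul hi' hd').app V (ψ ⊗ₜ φ) := by
  apply convAlg_ext hE
  intro W y
  refine Eq.trans ?_ (congrArg (ksign k (i * j) • ·) (convAlg_mul_app hE hi' hd' V W ψ φ y)).symm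
  rw [convAlg_mul_app, ← hE.comul_comm hcomm hd hd']
  generalize (E.comul hE hd).app W y = t
  induction t using TensorProduct.induction_on with
  | zero => simp only [map_zero, smul_zero]
  | add x y hx hy => simp only [map_add, hx, hy, smul_add]
  | tmul x y => exact hA.mul_comm hi hi' hd hd' _ _ _

theorem IsCdga.convAlg_mul_assoc (hA : A.IsCdga) {i₁ i₂ i₃ i₁₂ i₂₃ i : ℤ}
    {d₁ d₂ d₃ d₁₂ d₂₃ d : ℕ}
    (hi₁₂ : i₁ + i₂ = i₁₂) (hi₂₃ : i₂ + i₃ = i₂₃) (hi : i₁₂ + i₃ = i) (hi' : i₁ + i₂₃ = i)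
    (hd₁₂ : d₁ + d₂ = d₁₂) (hd₂₃ : d₂ + d₃ = d₂₃) (hd : d₁₂ + d₃ = d) (hd' : d₁ + d₂₃ = d)
    (V : FGProj k) (φ : ((convAlg E hE A).obj i₁ d₁).obj V)
    (ψ : ((convAlg E hE A).obj i₂ d₂).obj V) (χ : ((convAlg E hE A).obj i₃ d₃).obj V) :
    ((convAlg E hE A).mul hi hd).app V
        (((convAlg E hE A).mul hi₁₂ hd₁₂).app V (φ ⊗ₜ ψ) ⊗ₜ χ) =
      ((convAlg E hE A).mul hi' hd').app V
        (φ ⊗ₜ ((convAlg E hE A).mul hi₂₃ hd₂₃).app V (ψ ⊗ₜ χ)) := by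
  apply convAlg_ext hE
  intro W y
  rw [convAlg_mul_app, convAlg_mul_app]
  have h1 : ∀ t : (E.obj d₁₂).obj W ⊗[k] (E.obj d₃).obj W,
      TensorProduct.map (PolyFunctor.Hom.app
        (((convAlg E hE A).mul hi₁₂ hd₁₂).app V (φ ⊗ₜ ψ)) W) (PolyFunctor.Hom.app χ W) t =
      TensorProduct.map ((A.mul hi₁₂ hd₁₂).app (V.tensor W) ∘ₗ TensorProduct.map
        (PolyFunctor.Hom.app φ W) (PolyFunctor.Hom.app ψ W)) (PolyFunctor.Hom.app χ W)
        (TensorProduct.map ((E.comul hE hd₁₂).app W) LinearMap.id t) := by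
    intro t
    rw [← LinearMap.comp_apply, ← TensorProduct.map_comp]
    rfl
  have h2 : ∀ t : (E.obj d₁).obj W ⊗[k] (E.obj d₂₃).obj W,
      TensorProduct.map (PolyFunctor.Hom.app φ W) (PolyFunctor.Hom.app
        (((convAlg E hE A).mul hi₂₃ hd₂₃).app V (ψ ⊗ₜ χ)) W) t =
      TensorProduct.map (PolyFunctor.Hom.app φ W) ((A.mul hi₂₃ hd₂₃).app (V.tensor W) ∘ₗ
        TensorProduct.map (PolyFunctor.Hom.app ψ W) (PolyFunctor.Hom.app χ W))
        (TensorProduct.map LinearMap.id ((E.comul hE hd₂₃).app W) t) := by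
    intro t
    rw [← LinearMap.comp_apply, ← TensorProduct.map_comp]
    rfl
  rw [h1, h2, ← hE.comul_coassoc hd₁₂ hd₂₃ hd hd']
  generalize TensorProduct.map ((E.comul hE hd₁₂).app W) LinearMap.id
    ((E.comul hE hd).app W y) = t
  induction t using TensorProduct.induction_on with
  | zero => simp only [map_zero]
  | add x y hx hy => simp only [map_add, hx, hy]
  | tmul s z =>
  induction s using TensorProduct.induction_on with
  | zero => simp only [TensorProduct.zero_tmul, map_zero]
  | add x y hx hy => simp only [TensorProduct.add_tmul, map_add, hx, hy]
  | tmul x y => exact hA.mul_assoc hi₁₂ hi₂₃ hi hi' hd₁₂ hd₂₃ hd hd' _ _ _ _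

theorem IsCdga.convAlg_diff_mul (hA : A.IsCdga) {i j l i' j' l' : ℤ} {d e n : ℕ} (h : i + j = l)
    (h₁ : i' + j = l') (h₂ : i + j' = l') (hi : i' + 1 = i) (hj : j' + 1 = j) (hl : l' + 1 = l)
    (hd : d + e = n) (V : FGProj k) (φ : ((convAlg E hE A).obj i d).obj V)
    (ψ : ((convAlg E hE A).obj j e).obj V) :
    ((convAlg E hE A).diff hl n).app V (((convAlg E hE A).mul h hd).app V (φ ⊗ₜ ψ)) =
      ((convAlg E hE A).mul h₁ hd).app V (((convAlg E hE A).diff hi d).app V φ ⊗ₜ ψ) +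
        ksign k i • ((convAlg E hE A).mul h₂ hd).app V
          (φ ⊗ₜ ((convAlg E hE A).diff hj e).app V ψ) := by
  apply convAlg_ext hE
  intro W y
  have h1 := convAlg_mul_app hE h₁ hd V W (((convAlg E hE A).diff hi d).app V φ) ψ y
  have h2 := convAlg_mul_app hE h₂ hd V W φ (((convAlg E hE A).diff hj e).app V ψ) y
  refine Eq.trans ?_ (congrArg₂ (fun a b => a + ksign k i • b) h1 h2).symm
  rw [convAlg_diff_app, convAlg_mul_app]
  generalize (E.comul hE hd).app W y = t
  induction t using TensorProduct.induction_on with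
  | zero => simp only [map_zero, smul_zero, add_zero]
  | add x y hx hy => simp only [map_add, hx, hy, smul_add]; abel
  | tmul x y => exact hA.diff_mul h h₁ h₂ hi hj hl hd _ _ _

/-- In weight zero the augmentation is evaluation at the unit, which is grouplike. In positive
weight some factor has positive weight and both sides vanish. -/
theorem IsCdga.convAlg_aug_mul (hA : A.IsCdga) {i j l : ℤ} {d e n : ℕ} (hi : i + j = l)
    (hd : d + e = n) (V : FGProj k) (φ : ((convAlg E hE A).obj i d).obj V)
    (ψ : ((convAlg E hE A).obj j e).obj V) :
    ((convAlg E hE A).augAt l n).app V (((convAlg E hE A).mul hi hd).app V (φ ⊗ₜ ψ)) =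
      (((convAlg E hE A).augAt i d).app V φ * ((convAlg E hE A).augAt j e).app V ψ : k) := by
  by_cases hn : n = 0
  · subst hn
    obtain rfl : d = 0 := by omega
    obtain rfl : e = 0 := by omega
    rw [convAlg_augAt_app, convAlg_augAt_app, convAlg_augAt_app, convAlg_mul_app,
      hE.comul_unit, TensorProduct.map_tmul]
    exact hA.aug_mul hi hd _ _ _
  · rw [augAt_of_ne _ _ (by tauto)]
    by_cases hd' : d = 0
    · rw [augAt_of_ne _ V (i := j) (d := e) (by omega), mul_zero]
    · rw [augAt_of_ne _ V (i := i) (d := d) (by omega), zero_mul]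

/-- The convolution algebra of a commutative exponential functor and of a commutative differential
graded augmented algebra is a commutative differential graded augmented algebra. -/
theorem IsCdga.convAlg (hA : A.IsCdga) (hcomm : E.IsCommutative) :
    (PolyDga.convAlg E hE A).IsCdga where
  one_mul := hA.convAlg_one_mul hE
  -- The right unit follows from the left one by commutativity, with sign exponent `i * 0`.
  mul_one i d V φ := by
    rw [hA.convAlg_mul_comm hE hcomm (add_zero i) (zero_add i) (add_zero d) (zero_add d),
      hA.convAlg_one_mul hE, mul_zero, ksign_zero, one_smul]
  mul_assoc := hA.convAlg_mul_assoc hE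
  mul_comm := hA.convAlg_mul_comm hE hcomm
  diff_diff hj hl d V φ := convAlg_ext hE fun W y => hA.diff_diff hj hl d _ _
  diff_mul := hA.convAlg_diff_mul hE
  aug_mul := hA.convAlg_aug_mul hE
  aug_diff V φ := hA.aug_diff _ _

end PolyDga

/-! ### Tensor products with projective modules. -/

section Projective

variable {k : Type u} [CommRing k]

/-- The coordinates of an element of `M ⊗ N`, given coordinates on `M`. -/
def tensorCoords {M : Type*} [AddCommGroup M] [Module k M] (s : M →ₗ[k] M →₀ k) (N : Type*)
    [AddCommGroup N] [Module k N] : M ⊗[k] N →ₗ[k] M →₀ N := by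
  classical
  exact (TensorProduct.finsuppScalarLeft k N M).toLinearMap ∘ₗ LinearMap.rTensor N s

theorem tensorCoords_tmul {M N : Type*} [AddCommGroup M] [Module k M] [AddCommGroup N]
    [Module k N] (s : M →ₗ[k] M →₀ k) (m : M) (n : N) (i : M) :
    tensorCoords s N (m ⊗ₜ n) i = s m i • n := by
  classical
  exact TensorProduct.finsuppScalarLeft_apply_tmul_apply _ _ _

theorem tensorCoords_map {M N N' : Type*} [AddCommGroup M] [Module k M] [AddCommGroup N]
    [Module k N] [AddCommGroup N'] [Module k N'] (s : M →ₗ[k] M →₀ k) (l : N →ₗ[k] N')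
    (t : M ⊗[k] N) (i : M) :
    tensorCoords s N' (TensorProduct.map LinearMap.id l t) i = l (tensorCoords s N t i) := by
  induction t with
  | zero => simp only [map_zero, Finsupp.coe_zero, Pi.zero_apply]
  | add x y hx hy => simp only [map_add, Finsupp.add_apply, hx, hy]
  | tmul m n => rw [TensorProduct.map_tmul, tensorCoords_tmul, tensorCoords_tmul, map_smul]; rfl

/-- A projective module is a retract of a free module. -/
theorem exists_tensorCoords (M : Type*) [AddCommGroup M] [Module k M] [Module.Projective k M] :
    ∃ s : M →ₗ[k] M →₀ k, ∀ (N : Type w) [AddCommGroup N] [Module k N] (t : M ⊗[k] N),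
      (tensorCoords s N t).sum (fun m n => m ⊗ₜ[k] n) = t := by
  classical
  -- A section of the surjection from the free module on the set `M`: the elements `m` of `M` and
  -- the forms `s(-)(m)` make up a possibly infinite dual basis.
  obtain ⟨s, hs⟩ := Module.projective_def'.1 ‹Module.Projective k M›
  refine ⟨s, fun N _ _ t => ?_⟩
  induction t with
  | zero => simp
  | add x y hx hy =>
    rw [map_add, Finsupp.sum_add_index', hx, hy]
    · intro m; exact TensorProduct.tmul_zero _ _
    · intro m n n'; exact TensorProduct.tmul_add _ _ _
  | tmul m n =>
    have h : (s m).sum (fun i c => c • i) = m := LinearMap.congr_fun hs m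
    conv_rhs => rw [← h, Finsupp.sum, TensorProduct.sum_tmul]
    rw [Finsupp.sum_of_support_subset (s := (s m).support)]
    · refine Finset.sum_congr rfl fun i _ => ?_
      rw [tensorCoords_tmul, TensorProduct.tmul_smul, TensorProduct.smul_tmul']
    · intro i hi
      rw [Finsupp.mem_support_iff] at hi ⊢
      intro h0
      rw [tensorCoords_tmul, h0, zero_smul] at hi
      exact hi rfl
    · intro i _; exact TensorProduct.tmul_zero _ _

/-- Tensoring with a projective module preserves jointly injective families of linear maps. -/
theorem tensor_eq_zero_of_jointly_injective {M : Type*} [AddCommGroup M] [Module k M]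
    [Module.Projective k M] {N : Type w} [AddCommGroup N] [Module k N] {ι : Sort*}
    {N' : ι → Type*} [∀ i, AddCommGroup (N' i)] [∀ i, Module k (N' i)]
    (l : ∀ i, N →ₗ[k] N' i) (hl : ∀ n, (∀ i, l i n = 0) → n = 0) {t : M ⊗[k] N}
    (ht : ∀ i, TensorProduct.map LinearMap.id (l i) t = 0) : t = 0 := by
  obtain ⟨s, hs⟩ := exists_tensorCoords.{u, w} (k := k) M
  have h : tensorCoords s N t = 0 := by
    ext m
    refine hl _ fun i => ?_
    rw [← tensorCoords_map, ht, map_zero]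
    rfl
  rw [← hs N t, h, Finsupp.sum_zero_index]

end Projective

/-! ### Finiteness of morphisms out of homogeneous functors. -/

namespace PolyFunctor

variable {k : Type u} [CommRing k]

open FGProj

/-- The free module of rank `d` as an object of `V_k`. -/
@[reducible] def _root_.FGProj.free (k : Type u) [CommRing k] (d : ℕ) : FGProj k := ⟨Fin d → k⟩

/-- Each of the at most `d` possibly nonzero entries gets its own coordinate of `k^d`: `g` records
the entry times the corresponding linear form, and `h` sends the coordinate to the corresponding
generator. Only `g` involves `R`. -/
theorem ofMat_comp_baseChange {R : Type u} [CommRing R] [Algebra k R] {V W : FGProj k} {d : ℕ}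
    (S : Finset (MatIndex V W)) (hS : S.card ≤ d) (m : MatIndex V W → R)
    (hm : ∀ p, p ∉ S → m p = 0) : ∃ (g : R ⊗[k] V →ₗ[R] R ⊗[k] (free k d))
      (h : free k d →ₗ[k] W), ofMat m = h.baseChange R ∘ₗ g := by
  classical
  let e : S → Fin d := fun p => Fin.castLE hS (S.equivFin p)
  have he : Function.Injective e := fun p q h =>
    S.equivFin.injective (Fin.castLE_injective hS h)
  let h : free k d →ₗ[k] W := ∑ p : S, (LinearMap.proj (e p)).smulRight (W.gen p.1.1)
  let g : R ⊗[k] V →ₗ[R] R ⊗[k] (free k d) := LinearMap.liftBaseChange R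
    (∑ p : S, (LinearMap.toSpanSingleton k (R ⊗[k] free k d) (m p ⊗ₜ Pi.single (e p) 1)) ∘ₗ
      V.coord p.1.2)
  have hh : ∀ p : S, h (Pi.single (e p) 1) = W.gen p.1.1 := by
    intro p
    simp only [h, LinearMap.sum_apply, LinearMap.smulRight_apply, LinearMap.proj_apply]
    rw [Finset.sum_eq_single p]
    · rw [Pi.single_eq_same, one_smul]
    · intro q _ hq
      rw [Pi.single_eq_of_ne (fun hh => hq (he hh)), zero_smul]
    · intro hp; exact absurd (Finset.mem_univ p) hp
  refine ⟨g, h, ?_⟩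
  apply linearMap_ext_one
  intro x
  rw [ofMat_one_tmul, LinearMap.comp_apply, LinearMap.liftBaseChange_tmul, one_smul,
    LinearMap.sum_apply, map_sum, ← Finset.sum_subset (Finset.subset_univ S), ← Finset.sum_coe_sort]
  · refine Finset.sum_congr rfl fun p _ => ?_
    rw [LinearMap.comp_apply, LinearMap.toSpanSingleton_apply, LinearMap.map_smul_of_tower,
      LinearMap.baseChange_tmul, hh]
  · intro p _ hp
    rw [hm p hp, TensorProduct.zero_tmul, smul_zero]

/-- A morphism out of a functor of weight `d` is determined by its value on the free module of
rank `d`. -/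
theorem Hom.eq_zero_of_app_free {F : PolyFunctor.{u, v} k} {G : PolyFunctor.{u, w} k} {d : ℕ}
    (hF : F.IsHomogeneous d) (φ : Hom F G) (hφ : φ.app (free k d) = 0) : φ = 0 := by
  classical
  ext V x
  have h0 := map_eq_sum hF (LinearMap.id : k ⊗[k] V →ₗ[k] k ⊗[k] V) x
  rw [F.map_id] at h0
  have h1 : x = ∑ α ∈ exponents V V d,
      (α.prod fun p n => toMat (LinearMap.id : k ⊗[k] V →ₗ[k] k ⊗[k] V) p ^ n) •
        F.coeff V V α x := by
    have := congrArg (TensorProduct.lid k (F.obj V)) h0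
    simpa only [map_sum, LinearMap.id_apply, TensorProduct.lid_tmul, one_smul] using this
  -- The Taylor expansion of the identity writes `x` as a combination of coefficients of the generic
  -- endomorphism, so it suffices that `φ` kills each of them.
  rw [h1, map_sum]
  refine (Finset.sum_eq_zero fun α hα => ?_).trans (Hom.zero_app V _).symm
  rw [map_smul]
  -- A monomial of degree `d` involves at most `d` variables.
  have hcard : α.support.card ≤ d := by
    rw [Finset.mem_finsuppAntidiag] at hα
    rw [← hα.1, ← Finset.sum_subset (Finset.subset_univ α.support), Finset.card_eq_sum_ones]
    · refine Finset.sum_le_sum fun p hp => ?_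
      rw [Finsupp.mem_support_iff] at hp
      omega
    · intro p _ hp; simpa using hp
  let P := MvPolynomial (MatIndex V V) k
  -- The generic matrix with the variables outside `α` set to zero. The coefficient of `t ^ α` is
  -- unchanged (`e3`), while at most `d` entries survive, so the map factors through `k^d`, where
  -- `φ` vanishes (`e2`).
  let m : MatIndex V V → P := fun p => if p ∈ α.support then MvPolynomial.X p else 0
  let ρ : P →ₐ[k] P := MvPolynomial.aeval m
  obtain ⟨g, h, hgh⟩ := ofMat_comp_baseChange (R := P) α.support hcard m
    (fun p hp => if_neg hp)
  have e1 := F.map_extScalars ρ (genericMap V V) (ofMat m)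
    (fun x => ofMat_extScalars ρ _ _ (fun p => (MvPolynomial.aeval_X m p).symm) x) (1 ⊗ₜ x)
  rw [extScalars, LinearMap.rTensor_tmul, AlgHom.toLinearMap_apply, map_one] at e1
  have e2 : (φ.app V).baseChange P (F.map P (ofMat m) (1 ⊗ₜ x)) = 0 := by
    rw [hgh, F.map_comp, LinearMap.comp_apply, φ.naturality_apply, hφ, LinearMap.baseChange_zero,
      LinearMap.zero_apply, map_zero]
  have e3 : MvPolynomial.lcoeff k α ∘ₗ ρ.toLinearMap = MvPolynomial.lcoeff k α := by
    refine MvPolynomial.linearMap_ext fun β => ?_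
    ext
    simp only [LinearMap.comp_apply, AlgHom.toLinearMap_apply, MvPolynomial.lcoeff]
    change (ρ (MvPolynomial.monomial β 1)).coeff α = (MvPolynomial.monomial β 1).coeff α
    rw [MvPolynomial.aeval_monomial, map_one, one_mul]
    by_cases hβ : β.support ⊆ α.support
    · rw [MvPolynomial.monomial_eq, map_one, one_mul]
      congr 1
      refine Finset.prod_congr rfl fun p hp => ?_
      simp only [m, if_pos (hβ hp)]
    · obtain ⟨p, hp, hp'⟩ := Finset.not_subset.1 hβ
      rw [Finsupp.prod, Finset.prod_eq_zero hp, MvPolynomial.coeff_zero,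
        MvPolynomial.coeff_monomial, if_neg]
      · rintro rfl; exact hp' hp
      · simp only [m, if_neg hp']
        rw [zero_pow (Finsupp.mem_support_iff.1 hp)]
  have e4 : F.coeff V V α x = TensorProduct.lid k (F.obj V)
      (LinearMap.rTensor (F.obj V) (MvPolynomial.lcoeff k α) (F.map P (ofMat m) (1 ⊗ₜ x))) := by
    rw [e1, ← LinearMap.comp_apply (LinearMap.rTensor _ _), ← LinearMap.rTensor_comp, e3]
    rfl
  have e5 : ∀ z : P ⊗[k] F.obj V, φ.app V (TensorProduct.lid k (F.obj V)
      (LinearMap.rTensor (F.obj V) (MvPolynomial.lcoeff k α) z)) =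
      TensorProduct.lid k (G.obj V) (LinearMap.rTensor (G.obj V) (MvPolynomial.lcoeff k α)
        ((φ.app V).baseChange P z)) := by
    intro z
    induction z with
    | zero => simp only [map_zero]
    | add x y hx hy => simp only [map_add, hx, hy]
    | tmul p x =>
      rw [LinearMap.rTensor_tmul, LinearMap.baseChange_tmul, LinearMap.rTensor_tmul,
        TensorProduct.lid_tmul, TensorProduct.lid_tmul, map_smul]
  rw [e4, e5, e2, map_zero, map_zero, smul_zero]

/-- A pointwise finite family of morphisms out of a finitely generated functor is finite. -/
theorem finite_hom_ne_zero {F : PolyFunctor.{u, v} k} {d : ℕ} (hF : F.IsHomogeneous d)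
    (hfin : Module.Finite k (F.obj (free k d))) {ι : Type*} {G : ι → PolyFunctor.{u, w} k}
    (φ : ∀ i, Hom F (G i)) (hφ : ∀ V x, {i | (φ i).app V x ≠ 0}.Finite) :
    {i | φ i ≠ 0}.Finite := by
  obtain ⟨s, hs⟩ := hfin.fg_top
  -- A nonzero member of the family is nonzero on one of the finitely many generators of `F(k^d)`,
  -- and each generator is hit by only finitely many members.
  refine Set.Finite.subset (Set.Finite.biUnion s.finite_toSet
    fun x _ => hφ (free k d) x) fun i hi => ?_
  by_contra hc
  simp only [Set.mem_iUnion, Set.mem_ofPred_eq, not_exists] at hc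
  refine hi ((φ i).eq_zero_of_app_free hF ?_)
  refine LinearMap.ext_on_range (v := fun x : s => x.1) (by simpa using hs) fun x => ?_
  by_contra h
  exact hc x x.2 h

/-- There are no nonzero morphisms between functors of different weights. -/
theorem Hom.eq_zero_of_weight_ne {F : PolyFunctor.{u, v} k} {G : PolyFunctor.{u, w} k} {d e : ℕ}
    (hF : F.IsHomogeneous d) (hG : G.IsHomogeneous e) (hde : d ≠ e) (φ : Hom F G) : φ = 0 := by
  ext V x
  -- Naturality for the scalar `X` on `k[X] ⊗ V` says that `X ^ d` and `X ^ e` act in the same way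
  -- on the value of `φ`; the coefficient of `X ^ d` gives the claim.
  have h := φ.naturality_apply (Polynomial k)
    ((Polynomial.X : Polynomial k) • (LinearMap.id : _ →ₗ[Polynomial k] Polynomial k ⊗[k] V)) (1 ⊗ₜ x)
  rw [hF, hG, F.map_id, G.map_id, LinearMap.smul_apply, LinearMap.smul_apply, LinearMap.id_apply,
    LinearMap.id_apply, map_smul, LinearMap.baseChange_tmul] at h
  have h2 := congrArg (fun t => TensorProduct.lid k _ (LinearMap.rTensor (G.obj V)
    (Polynomial.lcoeff k d) t)) h
  rw [Hom.zero_app]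
  simpa [TensorProduct.smul_tmul', Polynomial.coeff_X_pow, hde] using h2

end PolyFunctor

/-! ### Morphisms into direct sums and into tensor products with a fixed module. -/

namespace PolyFunctor

variable {k : Type u} [CommRing k]

open FGProj

/-- The canonical map `⨁ Hom(F, Gᵢ) → Hom(F, ⨁ Gᵢ)`. -/
def homDirectSum {ι : Type w'} [DecidableEq ι] (F : PolyFunctor.{u, v} k)
    (G : ι → PolyFunctor.{u, w} k) :
    DirectSum ι (fun i => Hom F (G i)) →ₗ[k] Hom F (directSum G) :=
  DirectSum.toModule k ι _ fun i => Hom.comp (directSumι G i)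

theorem directSumπ_homDirectSum {ι : Type w'} [DecidableEq ι] {F : PolyFunctor.{u, v} k}
    {G : ι → PolyFunctor.{u, w} k} (i : ι) (t : DirectSum ι (fun i => Hom F (G i))) :
    Hom.comp (directSumπ G i) (homDirectSum F G t) = t i := by
  induction t using DirectSum.induction_on with
  | zero => rw [map_zero, map_zero]; rfl
  | add x y hx hy => rw [map_add, map_add, hx, hy]; rfl
  | of j φ =>
    have h : homDirectSum F G (DirectSum.of (fun i => Hom F (G i)) j φ) =
      Hom.comp (directSumι G j) φ :=
      DirectSum.toModule_lof k (M := fun i => Hom F (G i)) j φ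
    rw [h]
    ext V x
    rw [Hom.comp_app, Hom.comp_app, directSumπ_apply]
    refine (DirectSum.component.of k (M := fun i => (G i).obj V) i j _).trans ?_
    by_cases hj : j = i
    · subst hj
      rw [dif_pos rfl, DirectSum.of_eq_same]
    · rw [dif_neg hj, DirectSum.of_eq_of_ne _ _ _ (Ne.symm hj), Hom.zero_app]

/-- Morphisms out of a finitely generated homogeneous functor commute with direct sums. -/
theorem homDirectSum_bijective {ι : Type w'} [DecidableEq ι] {F : PolyFunctor.{u, v} k} {d : ℕ}
    (hF : F.IsHomogeneous d) (hfin : Module.Finite k (F.obj (free k d)))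
    (G : ι → PolyFunctor.{u, w} k) : Function.Bijective (homDirectSum F G) := by
  constructor
  · rw [injective_iff_map_eq_zero]
    intro t ht
    refine DFinsupp.ext fun i => ?_
    rw [← directSumπ_homDirectSum i t, ht, map_zero]
    rfl
  · intro φ
    -- Each value of `φ` has finite support, so the components of `φ` form a pointwise finite
    -- family. Hence only finitely many are nonzero, and their sum is the preimage.
    have hS := finite_hom_ne_zero hF hfin (fun i => Hom.comp (directSumπ G i) φ) fun V x => by
      classical
      refine (DFinsupp.support (φ.app V x : DirectSum ι fun i => (G i).obj V)).finite_toSet.subset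
        fun i hi => ?_
      rw [Set.mem_ofPred_eq, Hom.comp_app, directSumπ_apply] at hi
      exact DFinsupp.mem_support_iff.2 hi
    refine ⟨∑ i ∈ hS.toFinset, DirectSum.lof k ι (fun i => Hom F (G i)) i
      (Hom.comp (directSumπ G i) φ), ?_⟩
    refine Hom.ext fun V x => DFinsupp.ext fun i => ?_
    have e : ∀ z : (directSum G).obj V, z i = (directSumπ G i).app V z := fun z => by
      rw [directSumπ_apply]; rfl
    rw [e, e]
    have h2 : ∀ ψ : Hom F (directSum G), (directSumπ G i).app V (ψ.app V x) =
      (Hom.comp (directSumπ G i) ψ).app V x := fun _ => rfl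
    rw [h2, h2, directSumπ_homDirectSum]
    congr 2
    rw [DFinsupp.finsetSum_apply]
    by_cases hi : Hom.comp (directSumπ G i) φ = 0
    · rw [hi]
      refine Finset.sum_eq_zero fun j _ => ?_
      by_cases hj : j = i
      · subst hj; rw [hi, map_zero]; rfl
      · exact DirectSum.of_eq_of_ne _ _ _ (Ne.symm hj)
    · rw [Finset.sum_eq_single i]
      · exact DirectSum.of_eq_same _ _
      · intro j _ hj; exact DirectSum.of_eq_of_ne _ _ _ (Ne.symm hj)
      · intro h; exact absurd (hS.mem_toFinset.2 hi) h

/-- The constant functor with value `M`. -/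
@[reducible] def constMod (M : Type w) [AddCommGroup M] [Module k M] : PolyFunctor.{u, w} k where
  obj _ := M
  map R _ _ _ _ _ := LinearMap.id
  map_id _ _ _ _ := rfl
  map_comp _ _ _ _ _ _ _ _ := rfl
  map_extScalars _ _ _ _ _ _ _ := rfl

theorem IsHomogeneous.constMod (M : Type w) [AddCommGroup M] [Module k M] :
    IsHomogeneous (constMod (k := k) M) 0 := by
  intro _ _ _ V W r f
  rw [pow_zero, one_smul]

theorem map_baseChange_eq_bcTensor {M M' N N' : Type*} [AddCommGroup M] [AddCommGroup M']
    [AddCommGroup N] [AddCommGroup N'] [Module k M] [Module k M'] [Module k N] [Module k N']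
    (f : M →ₗ[k] M') (g : N →ₗ[k] N') (R : Type u) [CommRing R] [Algebra k R] :
    (TensorProduct.map f g).baseChange R = bcTensor (f.baseChange R) (g.baseChange R) := by
  ext
  simp [bcTensor]

/-- A linear map `M → M'` as a morphism of constant functors. -/
def constModMap {M : Type w} {M' : Type w'} [AddCommGroup M] [Module k M] [AddCommGroup M']
    [Module k M'] (l : M →ₗ[k] M') : Hom (constMod (k := k) M) (constMod M') :=
  ⟨fun _ => l, fun _ _ _ _ _ _ => rfl⟩

/-- The `m`-th coordinate of a morphism with values in `M ⊗ G`. -/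
def coordHom {F : PolyFunctor.{u, v} k} {G : PolyFunctor.{u, w} k} {M : Type w'} [AddCommGroup M]
    [Module k M] (s : M →ₗ[k] M →₀ k) (φ : Hom F (tensor (constMod M) G)) (m : M) : Hom F G :=
  Hom.comp (tensorLid G) (Hom.comp (G := tensor (constMod M) G)
    (tensorHom (constModMap (M' := k) (Finsupp.lapply m ∘ₗ s) : Hom (constMod M) (const k))
      (Hom.id G)) φ)

theorem coordHom_app {F : PolyFunctor.{u, v} k} {G : PolyFunctor.{u, w} k} {M : Type w'}
    [AddCommGroup M] [Module k M] (s : M →ₗ[k] M →₀ k) (φ : Hom F (tensor (constMod M) G)) (m : M)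
    (V : FGProj k) (x : F.obj V) :
    (coordHom s φ m).app V x = tensorCoords s (G.obj V) (φ.app V x) m := by
  have h : ∀ t : M ⊗[k] G.obj V, TensorProduct.lid k (G.obj V)
      (TensorProduct.map (Finsupp.lapply m ∘ₗ s) LinearMap.id t) =
      tensorCoords s (G.obj V) t m := by
    intro t
    induction t with
    | zero => simp only [map_zero, Finsupp.coe_zero, Pi.zero_apply]
    | add x y hx hy => simp only [map_add, Finsupp.add_apply, hx, hy]
    | tmul m n => rw [tensorCoords_tmul]; rfl
  exact h (φ.app V x)

/-- Morphisms with values in `M ⊗ G`, for `M` projective, come from `M ⊗ Hom(F, G)`. -/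
theorem exists_tensor_hom {F : PolyFunctor.{u, v} k} {d : ℕ}
    (hF : F.IsHomogeneous d) (hfin : Module.Finite k (F.obj (free k d))) {G : PolyFunctor.{u, w} k}
    {M : Type w'} [AddCommGroup M] [Module k M] [Module.Projective k M]
    (φ : Hom F (tensor (constMod M) G)) :
    ∃ t : M ⊗[k] Hom F G, ∀ V x, TensorProduct.map LinearMap.id (evalHom F G V x) t =
      φ.app V x := by
  classical
  obtain ⟨s, hs⟩ := exists_tensorCoords.{u, w} (k := k) M
  have hS := finite_hom_ne_zero hF hfin (coordHom s φ) fun V x =>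
    (tensorCoords s (G.obj V) (φ.app V x)).support.finite_toSet.subset fun m hm => by
      rw [Set.mem_ofPred_eq, coordHom_app] at hm
      exact Finsupp.mem_support_iff.2 hm
  -- The morphism is rebuilt from its coordinates with respect to the dual basis of `M`; `hS` makes
  -- the sum finite.
  refine ⟨∑ m ∈ hS.toFinset, m ⊗ₜ coordHom s φ m, fun V x => ?_⟩
  rw [map_sum, ← hs _ (φ.app V x), Finsupp.sum_of_support_subset _ (s := hS.toFinset)]
  · refine Finset.sum_congr rfl fun m _ => ?_
    rw [TensorProduct.map_tmul, ← coordHom_app]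
    rfl
  · intro m hm
    rw [Finsupp.mem_support_iff, ← coordHom_app] at hm
    rw [hS.mem_toFinset]
    intro h
    rw [h, Hom.zero_app] at hm
    exact hm rfl
  · intro m _; exact TensorProduct.tmul_zero _ _

/-- Evaluations are jointly injective on `Hom(F, G)`, and projectivity of `M` allows an element of
`M ⊗ Hom(F, G)` to be tested on one evaluation at a time. This is the uniqueness that complements
`exists_tensor_hom`. -/
theorem tensor_hom_eq_zero {F : PolyFunctor.{u, v} k} {G : PolyFunctor.{u, w} k}
    {M : Type w'} [AddCommGroup M] [Module k M] [Module.Projective k M] {t : M ⊗[k] Hom F G}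
    (h : ∀ V x, TensorProduct.map LinearMap.id (evalHom F G V x) t = 0) : t = 0 :=
  tensor_eq_zero_of_jointly_injective
    (ι := Σ V : FGProj k, F.obj V) (N' := fun i => G.obj i.1)
    (fun i => evalHom F G i.1 i.2) (fun _ hφ => Hom.ext fun V x => hφ ⟨V, x⟩) fun i => h i.1 i.2

end PolyFunctor

/-! ### Direct sums of maps over `R`. -/

namespace PolyFunctor

variable {k : Type u} [CommRing k]

open FGProj

section BcProd

variable {R : Type u} [CommRing R] [Algebra k R]
  {M M' N N' : Type*} [AddCommGroup M] [AddCommGroup M'] [AddCommGroup N] [AddCommGroup N']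
  [Module k M] [Module k M'] [Module k N] [Module k N']
  (f : R ⊗[k] M →ₗ[R] R ⊗[k] M') (g : R ⊗[k] N →ₗ[R] R ⊗[k] N')

theorem fst_prodRight (x : R ⊗[k] (M × N)) :
    (TensorProduct.prodRight k R R M N x).1 = (LinearMap.fst k M N).baseChange R x := by
  induction x with
  | zero => simp only [map_zero]; rfl
  | add x y hx hy => simp only [map_add, Prod.fst_add, hx, hy]
  | tmul r m => simp

theorem snd_prodRight (x : R ⊗[k] (M × N)) :
    (TensorProduct.prodRight k R R M N x).2 = (LinearMap.snd k M N).baseChange R x := by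
  induction x with
  | zero => simp only [map_zero]; rfl
  | add x y hx hy => simp only [map_add, Prod.snd_add, hx, hy]
  | tmul r m => simp

theorem fst_comp_bcProd : (LinearMap.fst k M' N').baseChange R ∘ₗ bcProd f g =
    f ∘ₗ (LinearMap.fst k M N).baseChange R := by
  apply LinearMap.ext
  intro x
  rw [LinearMap.comp_apply, LinearMap.comp_apply, ← fst_prodRight, ← fst_prodRight]
  simp [bcProd]

theorem snd_comp_bcProd : (LinearMap.snd k M' N').baseChange R ∘ₗ bcProd f g =
    g ∘ₗ (LinearMap.snd k M N).baseChange R := by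
  apply LinearMap.ext
  intro x
  rw [LinearMap.comp_apply, LinearMap.comp_apply, ← snd_prodRight, ← snd_prodRight]
  simp [bcProd]

theorem prodRight_inl (x : R ⊗[k] M) :
    TensorProduct.prodRight k R R M N ((LinearMap.inl k M N).baseChange R x) = (x, 0) := by
  induction x with
  | zero => simp only [map_zero]; rfl
  | add x y hx hy => simp only [map_add, hx, hy, Prod.mk_add_mk, add_zero]
  | tmul r m => simp

theorem prodRight_inr (x : R ⊗[k] N) :
    TensorProduct.prodRight k R R M N ((LinearMap.inr k M N).baseChange R x) = (0, x) := by
  induction x with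
  | zero => simp only [map_zero]; rfl
  | add x y hx hy => simp only [map_add, hx, hy, Prod.mk_add_mk, add_zero]
  | tmul r m => simp

theorem bcProd_comp_inl : bcProd f g ∘ₗ (LinearMap.inl k M N).baseChange R =
    (LinearMap.inl k M' N').baseChange R ∘ₗ f := by
  apply LinearMap.ext
  intro x
  apply (TensorProduct.prodRight k R R M' N').injective
  simp [bcProd, prodRight_inl]

theorem bcProd_comp_inr : bcProd f g ∘ₗ (LinearMap.inr k M N).baseChange R =
    (LinearMap.inr k M' N').baseChange R ∘ₗ g := by
  apply LinearMap.ext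
  intro x
  apply (TensorProduct.prodRight k R R M' N').injective
  simp [bcProd, prodRight_inr]

end BcProd

end PolyFunctor

/-! ### The external form of a morphism from an exponential functor to a tensor product. -/

namespace PolyAlgebra

open PolyFunctor

variable {k : Type u} [CommRing k] {E : PolyAlgebra.{u, v} k}

theorem ext_naturality {d e n : ℕ} (h : d + e = n) (R : Type u) [CommRing R] [Algebra k R]
    {V V' W W' : FGProj k} (f : R ⊗[k] V →ₗ[R] R ⊗[k] V') (g : R ⊗[k] W →ₗ[R] R ⊗[k] W') :
    (E.ext h V' W').baseChange R ∘ₗ bcTensor ((E.obj d).map R f) ((E.obj e).map R g) =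
      (E.obj n).map R (V := V.prod W) (W := V'.prod W') (bcProd f g) ∘ₗ
        (E.ext h V W).baseChange R := by
  have h1 := (E.mul h).naturality R (V := V.prod W) (W := V'.prod W') (bcProd f g)
  rw [ext, ext, LinearMap.baseChange_comp, LinearMap.baseChange_comp, ← LinearMap.comp_assoc,
    ← h1, map_baseChange_eq_bcTensor, map_baseChange_eq_bcTensor, ← map_baseChange,
    ← map_baseChange, ← map_baseChange, ← map_baseChange, LinearMap.comp_assoc,
    LinearMap.comp_assoc, ← bcTensor_comp]
  change _ = _ ∘ₗ bcTensor _ _ ∘ₗ _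
  rw [← bcTensor_comp, ← (E.obj d).map_comp, ← (E.obj e).map_comp, ← (E.obj d).map_comp,
    ← (E.obj e).map_comp]
  congr 3
  · exact (bcProd_comp_inl f g).symm
  · exact (bcProd_comp_inr f g).symm

variable {F : PolyFunctor.{u, w} k} {G : PolyFunctor.{u, w'} k}

/-- The external form `E_d(V) ⊗ E_e(W) → F(V) ⊗ G(W)` of a morphism `E_n → F ⊗ G`. -/
def extApp {n : ℕ} (φ : PolyFunctor.Hom (E.obj n) (tensor F G)) {d e : ℕ} (h : d + e = n)
    (V W : FGProj k) :
    (E.obj d).obj V ⊗[k] (E.obj e).obj W →ₗ[k] F.obj V ⊗[k] G.obj W :=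
  TensorProduct.map (F.linMap (V := V.prod W) (LinearMap.fst k V W))
    (G.linMap (V := V.prod W) (LinearMap.snd k V W)) ∘ₗ φ.app (V.prod W) ∘ₗ E.ext h V W

/-- Naturality of `φ` along `f ⊕ g` gives naturality in both variables. Taking `f` or `g` to be the
identity freezes one variable, which is how `extLeft` and `extRight` become morphisms in the other.
-/
theorem extApp_naturality {n : ℕ} (φ : PolyFunctor.Hom (E.obj n) (tensor F G)) {d e : ℕ}
    (h : d + e = n) (R : Type u) [CommRing R] [Algebra k R]
    {V V' W W' : FGProj k} (f : R ⊗[k] V →ₗ[R] R ⊗[k] V') (g : R ⊗[k] W →ₗ[R] R ⊗[k] W') :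
    (extApp φ h V' W').baseChange R ∘ₗ bcTensor ((E.obj d).map R f) ((E.obj e).map R g) =
      bcTensor (F.map R f) (G.map R g) ∘ₗ (extApp φ h V W).baseChange R := by
  have h1 := φ.naturality R (V := V.prod W) (W := V'.prod W') (bcProd f g)
  have hF : F.map R (V := V'.prod W') ((LinearMap.fst k V' W').baseChange R) ∘ₗ
      F.map R (V := V.prod W) (W := V'.prod W') (bcProd f g) = F.map R f ∘ₗ
        F.map R (V := V.prod W) ((LinearMap.fst k V W).baseChange R) :=
    (F.map_comp R (V := V'.prod W') _ _).symm.trans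
      ((congrArg (F.map R (V := V.prod W)) (fst_comp_bcProd f g)).trans
        (F.map_comp R (U := V.prod W) _ _))
  have hG : G.map R (V := V'.prod W') ((LinearMap.snd k V' W').baseChange R) ∘ₗ
      G.map R (V := V.prod W) (W := V'.prod W') (bcProd f g) = G.map R g ∘ₗ
        G.map R (V := V.prod W) ((LinearMap.snd k V W).baseChange R) :=
    (G.map_comp R (V := V'.prod W') _ _).symm.trans
      ((congrArg (G.map R (V := V.prod W)) (snd_comp_bcProd f g)).trans
        (G.map_comp R (U := V.prod W) _ _))
  have h2 : bcTensor (F.map R (V := V'.prod W') ((LinearMap.fst k V' W').baseChange R))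
      (G.map R (V := V'.prod W') ((LinearMap.snd k V' W').baseChange R)) ∘ₗ
      bcTensor (F.map R (V := V.prod W) (W := V'.prod W') (bcProd f g))
        (G.map R (V := V.prod W) (W := V'.prod W') (bcProd f g)) =
      bcTensor (F.map R f) (G.map R g) ∘ₗ
        bcTensor (F.map R (V := V.prod W) ((LinearMap.fst k V W).baseChange R))
          (G.map R (V := V.prod W) ((LinearMap.snd k V W).baseChange R)) := by
    rw [← bcTensor_comp, ← bcTensor_comp, hF, hG]
  rw [extApp, extApp, LinearMap.baseChange_comp, LinearMap.baseChange_comp,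
    LinearMap.baseChange_comp, LinearMap.baseChange_comp, LinearMap.comp_assoc,
    LinearMap.comp_assoc, ext_naturality, map_baseChange_eq_bcTensor, map_baseChange_eq_bcTensor,
    ← map_baseChange, ← map_baseChange, ← map_baseChange, ← map_baseChange]
  apply LinearMap.ext
  intro z
  have h1' := LinearMap.congr_fun h1 ((E.ext h V W).baseChange R z)
  have h2' := LinearMap.congr_fun h2 ((φ.app (V.prod W)).baseChange R
    ((E.ext h V W).baseChange R z))
  exact (congrArg (bcTensor (F.map R (V := V'.prod W') ((LinearMap.fst k V' W').baseChange R))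
    (G.map R (V := V'.prod W') ((LinearMap.snd k V' W').baseChange R))) h1').trans h2'

/-- The external form for a fixed element of `E_e(W)`. -/
def extLeft {n : ℕ} (φ : PolyFunctor.Hom (E.obj n) (tensor F G)) {d e : ℕ} (h : d + e = n)
    (W : FGProj k) (y : (E.obj e).obj W) :
    PolyFunctor.Hom (E.obj d) (tensor F (constMod (G.obj W))) :=
  ⟨fun V => extApp φ h V W ∘ₗ (TensorProduct.mk k _ _).flip y, fun R _ _ V V' f => by
    have e1 : ∀ (V : FGProj k) (z : R ⊗[k] (E.obj d).obj V),
        ((TensorProduct.mk k _ ((E.obj e).obj W)).flip y).baseChange R z =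
          bcMul z (1 ⊗ₜ y) := by
      intro V z
      induction z with
      | zero => rw [map_zero, bcMul_zero_left]
      | add x y hx hy => rw [map_add, bcMul_add_left, hx, hy]
      | tmul r m => rw [bcMul, distrib_symm_tmul, _root_.mul_one]; rfl
    apply LinearMap.ext
    intro z
    have h1 := LinearMap.congr_fun (extApp_naturality φ h R f
      (LinearMap.id : R ⊗[k] W →ₗ[R] R ⊗[k] W)) (bcMul z (1 ⊗ₜ y))
    rw [LinearMap.comp_apply, LinearMap.comp_apply, bcTensor_bcMul, (E.obj e).map_id,
      G.map_id] at h1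
    rw [LinearMap.baseChange_comp, LinearMap.baseChange_comp, LinearMap.comp_apply,
      LinearMap.comp_apply, LinearMap.comp_apply, LinearMap.comp_apply, e1, e1]
    exact h1⟩

/-- The external form for a fixed element of `E_d(V)`. -/
def extRight {n : ℕ} (φ : PolyFunctor.Hom (E.obj n) (tensor F G)) {d e : ℕ} (h : d + e = n)
    (V : FGProj k) (x : (E.obj d).obj V) :
    PolyFunctor.Hom (E.obj e) (tensor (constMod (F.obj V)) G) :=
  ⟨fun W => extApp φ h V W ∘ₗ TensorProduct.mk k _ _ x, fun R _ _ W W' g => by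
    have e1 : ∀ (W : FGProj k) (z : R ⊗[k] (E.obj e).obj W),
        (TensorProduct.mk k ((E.obj d).obj V) _ x).baseChange R z =
          bcMul (1 ⊗ₜ x) z := by
      intro W z
      induction z with
      | zero => rw [map_zero, bcMul_zero_right]
      | add x y hx hy => rw [map_add, bcMul_add_right, hx, hy]
      | tmul r m => rw [bcMul, distrib_symm_tmul, _root_.one_mul]; rfl
    apply LinearMap.ext
    intro z
    have h1 := LinearMap.congr_fun (extApp_naturality φ h R
      (LinearMap.id : R ⊗[k] V →ₗ[R] R ⊗[k] V) g) (bcMul (1 ⊗ₜ x) z)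
    rw [LinearMap.comp_apply, LinearMap.comp_apply, bcTensor_bcMul, (E.obj d).map_id,
      F.map_id] at h1
    rw [LinearMap.baseChange_comp, LinearMap.baseChange_comp, LinearMap.comp_apply,
      LinearMap.comp_apply, LinearMap.comp_apply, LinearMap.comp_apply, e1, e1]
    exact h1⟩

theorem extLeft_app {n : ℕ} (φ : PolyFunctor.Hom (E.obj n) (tensor F G)) {d e : ℕ}
    (h : d + e = n) (V W : FGProj k) (x : (E.obj d).obj V) (y : (E.obj e).obj W) :
    (extLeft φ h W y).app V x = extApp φ h V W (x ⊗ₜ y) := rfl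

/-- A morphism `E_n → F ⊗ G` is determined by its external form in the weights of `F` and `G`. -/
theorem IsExponential.hom_ext (hE : E.IsExponential) {d e n : ℕ} (h : d + e = n)
    (hF : F.IsHomogeneous d) {φ φ' : PolyFunctor.Hom (E.obj n) (tensor F G)}
    (hφ : ∀ V W, extApp φ h V W = extApp φ' h V W) : φ = φ' := by
  -- Both projections of `V ⊕ V` are left inverse to the diagonal, so `ψ` is recovered from its
  -- value on `V ⊕ V` followed by the projections.
  have key : ∀ (ψ : PolyFunctor.Hom (E.obj n) (tensor F G)) (V : FGProj k) (x : (E.obj n).obj V),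
      ψ.app V x = TensorProduct.map (F.linMap (V := V.prod V) (LinearMap.fst k V V))
        (G.linMap (V := V.prod V) (LinearMap.snd k V V))
        (ψ.app (V.prod V) ((E.obj n).linMap (W := V.prod V) (diag V) x)) := by
    intro ψ V x
    rw [PolyFunctor.Hom.app_linMap, linMap_tensor, ← LinearMap.comp_apply,
      ← TensorProduct.map_comp, ← linMap_comp, ← linMap_comp]
    have e1 : LinearMap.fst k V V ∘ₗ diag V = LinearMap.id := rfl
    have e2 : LinearMap.snd k V V ∘ₗ diag V = LinearMap.id := rfl
    rw [e1, e2, linMap_id, linMap_id, TensorProduct.map_id]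
    rfl
  ext V x
  rw [key φ, key φ']
  generalize (E.obj n).linMap (W := V.prod V) (diag V) x = z
  induction z using hE.ext_induction with
  | h0 => simp only [map_zero]
  | hadd x y hx hy => simp only [map_add, hx, hy]
  | h d' e' h' x y =>
    have e1 : ∀ ψ : PolyFunctor.Hom (E.obj n) (tensor F G),
      TensorProduct.map (F.linMap (V := V.prod V) (LinearMap.fst k V V))
        (G.linMap (V := V.prod V) (LinearMap.snd k V V))
        (ψ.app (V.prod V) (E.ext h' V V (x ⊗ₜ y))) = (extLeft ψ h' V y).app V x := fun _ => rfl
    rw [e1, e1]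
    by_cases hd : d' = d
    · subst hd
      obtain rfl : e' = e := by omega
      rw [extLeft_app, extLeft_app, hφ]
    -- With the element of `E_{e'}` frozen, the target has the weight `d` of `F`, different from
    -- `d'`: such parts of the external form vanish automatically.
    · have h3 : ∀ ψ : PolyFunctor.Hom (E.obj d') (tensor F (constMod (G.obj V))), ψ = 0 :=
        PolyFunctor.Hom.eq_zero_of_weight_ne (E.homogeneous d')
          (hF.tensor (IsHomogeneous.constMod _)) (by omega)
      rw [h3 (extLeft φ h' V y), h3 (extLeft φ' h' V y)]

end PolyAlgebra

/-! ### The Künneth formula. -/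

namespace PolyAlgebra

open PolyFunctor

variable {k : Type u} [CommRing k] {E : PolyAlgebra.{u, v} k} (hE : E.IsExponential)

section Star

variable {F : PolyFunctor.{u, w} k} {G : PolyFunctor.{u, w'} k} {C : PolyFunctor.{u, w''} k}

/-- The convolution product of `φ : E_d → F` and `ψ : E_e → G` along `m : F ⊗ G → C`. -/
def IsExponential.star (m : PolyFunctor.Hom (tensor F G) C) {d e n : ℕ} (h : d + e = n) :
    PolyFunctor.Hom (E.obj d) F →ₗ[k] PolyFunctor.Hom (E.obj e) G →ₗ[k]
      PolyFunctor.Hom (E.obj n) C :=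
  LinearMap.mk₂ k (fun φ ψ => PolyFunctor.Hom.comp m
      (PolyFunctor.Hom.comp (tensorHom φ ψ) (E.comul hE h)))
    (fun φ φ' ψ => by
      rw [show tensorHom (φ + φ') ψ = tensorHom φ ψ + tensorHom φ' ψ from
        PolyFunctor.Hom.ext fun V x =>
          LinearMap.congr_fun (TensorProduct.map_add_left (φ.app V) (φ'.app V) (ψ.app V)) x]
      simp only [map_add, LinearMap.add_apply])
    (fun c φ ψ => by
      rw [show tensorHom (c • φ) ψ = c • tensorHom φ ψ from
        PolyFunctor.Hom.ext fun V x =>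
          LinearMap.congr_fun (TensorProduct.map_smul_left c (φ.app V) (ψ.app V)) x]
      simp only [map_smul, LinearMap.smul_apply])
    (fun φ ψ ψ' => by
      rw [show tensorHom φ (ψ + ψ') = tensorHom φ ψ + tensorHom φ ψ' from
        PolyFunctor.Hom.ext fun V x =>
          LinearMap.congr_fun (TensorProduct.map_add_right (φ.app V) (ψ.app V) (ψ'.app V)) x]
      simp only [map_add, LinearMap.add_apply])
    (fun c φ ψ => by
      rw [show tensorHom φ (c • ψ) = c • tensorHom φ ψ from
        PolyFunctor.Hom.ext fun V x =>
          LinearMap.congr_fun (TensorProduct.map_smul_right c (φ.app V) (ψ.app V)) x]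
      simp only [map_smul, LinearMap.smul_apply])

theorem IsExponential.star_app (m : PolyFunctor.Hom (tensor F G) C) {d e n : ℕ} (h : d + e = n)
    (φ : PolyFunctor.Hom (E.obj d) F) (ψ : PolyFunctor.Hom (E.obj e) G) (W : FGProj k)
    (y : (E.obj n).obj W) : (hE.star m h φ ψ).app W y =
      m.app W (TensorProduct.map (φ.app W) (ψ.app W) ((E.comul hE h).app W y)) := rfl

/-- The diagonal of `V ⊕ W` followed by the two projections is the identity of `V ⊕ W`. As a
consequence, the external form of a convolution `φ ⋆ ψ` is simply `φ ⊗ ψ`. -/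
theorem IsExponential.map_fst_snd_comul {d e n : ℕ} (h : d + e = n) {V W : FGProj k}
    (z : (E.obj n).obj (V.prod W)) :
    TensorProduct.map ((E.obj d).linMap (V := V.prod W) (LinearMap.fst k V W))
      ((E.obj e).linMap (V := V.prod W) (LinearMap.snd k V W))
      ((E.comul hE h).app (V.prod W) z) = hE.split h V W z := by
  have h1 := hE.split_linMap_prodMap h (V := V.prod W) (W := V.prod W) (LinearMap.fst k V W)
    (LinearMap.snd k V W)
    ((E.obj n).linMap (V := V.prod W) (W := (V.prod W).prod (V.prod W)) (diag (V.prod W)) z)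
  rw [comul_app, ← h1, linMap_linMap]
  have h2 : (LinearMap.fst k V W).prodMap (LinearMap.snd k V W) ∘ₗ diag (V.prod W) =
    (LinearMap.id : V.prod W →ₗ[k] V.prod W) := rfl
  rw [h2, linMap_id]
  rfl

theorem extApp_zero {d e n : ℕ} (h : d + e = n) (V W : FGProj k)
    (t : (E.obj d).obj V ⊗[k] (E.obj e).obj W) :
    extApp (0 : PolyFunctor.Hom (E.obj n) (tensor F G)) h V W t = 0 :=
  LinearMap.map_zero (TensorProduct.map (F.linMap (V := V.prod W) (LinearMap.fst k V W))
    (G.linMap (V := V.prod W) (LinearMap.snd k V W)))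

/-- The external form of a convolution product. -/
theorem IsExponential.extApp_star {d e n : ℕ} (h : d + e = n)
    (z : PolyFunctor.Hom (E.obj d) F ⊗[k] PolyFunctor.Hom (E.obj e) G) (V W : FGProj k)
    (x : (E.obj d).obj V) (y : (E.obj e).obj W) :
    extApp (TensorProduct.lift (hE.star (PolyFunctor.Hom.id (tensor F G)) h) z) h V W (x ⊗ₜ y) =
      TensorProduct.map (evalHom (E.obj d) F V x) (evalHom (E.obj e) G W y) z := by
  induction z with
  | zero =>
    rw [map_zero, map_zero]
    exact extApp_zero h V W _
  | add z z' hz hz' =>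
    rw [map_add, map_add, ← hz, ← hz']
    exact map_add (TensorProduct.map _ _) _ _
  | tmul φ ψ =>
    rw [TensorProduct.lift.tmul, extApp, LinearMap.comp_apply, LinearMap.comp_apply, star_app]
    change TensorProduct.map _ _ (TensorProduct.map _ _ _) = φ.app V x ⊗ₜ ψ.app W y
    have e1 : (F.linMap (V := V.prod W) (LinearMap.fst k V W)) ∘ₗ φ.app (V.prod W) =
        φ.app V ∘ₗ (E.obj d).linMap (V := V.prod W) (LinearMap.fst k V W) :=
      LinearMap.ext fun t => (PolyFunctor.Hom.app_linMap φ (V := V.prod W) _ t).symm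
    have e2 : (G.linMap (V := V.prod W) (LinearMap.snd k V W)) ∘ₗ ψ.app (V.prod W) =
        ψ.app W ∘ₗ (E.obj e).linMap (V := V.prod W) (LinearMap.snd k V W) :=
      LinearMap.ext fun t => (PolyFunctor.Hom.app_linMap ψ (V := V.prod W) _ t).symm
    rw [← LinearMap.comp_apply, ← TensorProduct.map_comp, e1, e2, TensorProduct.map_comp,
      LinearMap.comp_apply, hE.map_fst_snd_comul, hE.split_ext, TensorProduct.map_tmul]

/-- The Künneth isomorphism `Hom(E_d, F) ⊗ Hom(E_e, G) ≃ Hom(E_{d+e}, F ⊗ G)`. -/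
theorem IsExponential.star_injective {d e n : ℕ} (h : d + e = n)
    (hF : ∀ V, Module.Projective k (F.obj V))
    (hH : Module.Projective k (PolyFunctor.Hom (E.obj e) G)) :
    Function.Injective (TensorProduct.lift (hE.star (PolyFunctor.Hom.id (tensor F G)) h)) := by
  rw [injective_iff_map_eq_zero]
  intro z hz
  have h1 : ∀ V W x y,
      TensorProduct.map (evalHom (E.obj d) F V x) (evalHom (E.obj e) G W y) z = 0 := by
    intro V W x y
    rw [← hE.extApp_star h, hz]
    exact extApp_zero h V W _
  -- The two factors are tested separately: the second after the first has been evaluated in the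
  -- projective module `F(V)`, the first against the projective module `Hom(E_e, G)`.
  have h2 : ∀ V x, TensorProduct.map (evalHom (E.obj d) F V x)
      (LinearMap.id : PolyFunctor.Hom (E.obj e) G →ₗ[k] _) z = 0 := by
    intro V x
    have := hF V
    refine tensor_hom_eq_zero fun W y => ?_
    rw [← LinearMap.comp_apply, ← TensorProduct.map_comp]
    exact h1 V W x y
  have h3 : TensorProduct.comm k _ _ z = 0 := by
    refine tensor_hom_eq_zero fun V x => ?_
    rw [TensorProduct.map_comm, h2, map_zero]
  exact (TensorProduct.comm k _ _).map_eq_zero_iff.1 h3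

/-- For fixed `x ∈ E_d(V)`, the external form of `φ` is a morphism `E_e → F(V) ⊗ G`, hence an
element of `F(V) ⊗ Hom(E_e, G)`. In its dependence on `x` this element is a morphism `E_d → F ⊗
Hom(E_e, G)`, hence an element of `Hom(E_d, F) ⊗ Hom(E_e, G)`. Its convolution has the same external
form as `φ`. -/
theorem IsExponential.star_surjective {d e n : ℕ} (h : d + e = n) (hFd : F.IsHomogeneous d)
    (hF : ∀ V, Module.Projective k (F.obj V))
    (hH : Module.Projective k (PolyFunctor.Hom (E.obj e) G)) :
    Function.Surjective (TensorProduct.lift (hE.star (PolyFunctor.Hom.id (tensor F G)) h)) := by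
  intro φ
  have h1 : ∀ V x, ∃ t : F.obj V ⊗[k] PolyFunctor.Hom (E.obj e) G, ∀ W y,
      TensorProduct.map LinearMap.id (evalHom (E.obj e) G W y) t = extApp φ h V W (x ⊗ₜ y) := by
    intro V x
    have := hF V
    exact exists_tensor_hom (E.homogeneous e) (hE.finite e _) (extRight φ h V x)
  -- The choice is in fact unique (`huniq`), and uniqueness makes `b` linear.
  choose b hb using h1
  have huniq : ∀ V (t t' : F.obj V ⊗[k] PolyFunctor.Hom (E.obj e) G),
      (∀ W y, TensorProduct.map LinearMap.id (evalHom (E.obj e) G W y) t =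
        TensorProduct.map LinearMap.id (evalHom (E.obj e) G W y) t') → t = t' := by
    intro V t t' ht
    have := hF V
    rw [← sub_eq_zero]
    exact tensor_hom_eq_zero fun W y => by rw [map_sub, ht, sub_self]
  let β : ∀ V, (E.obj d).obj V →ₗ[k] F.obj V ⊗[k] PolyFunctor.Hom (E.obj e) G := fun V =>
    { toFun := b V
      map_add' := fun x x' => huniq V _ _ fun W y => by
        rw [map_add, hb, hb, hb, TensorProduct.add_tmul, map_add]
      map_smul' := fun c x => huniq V _ _ fun W y => by
        rw [map_smul, hb, hb, ← TensorProduct.smul_tmul', map_smul]; rfl }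
  have hβ : ∀ V W y, TensorProduct.map LinearMap.id (evalHom (E.obj e) G W y) ∘ₗ β V =
      (extLeft φ h W y).app V := fun V W y => LinearMap.ext fun x => hb V x W y
  -- Naturality need only be checked over polynomial rings. These are free over `k`, so that
  -- evaluations at elements `y` of `E_e(W)` stay jointly injective, and after evaluation it is the
  -- naturality of `extLeft`.
  let B : PolyFunctor.Hom (E.obj d) (tensor F (constMod (PolyFunctor.Hom (E.obj e) G))) :=
    ⟨β, map_induction _ fun σ V V' f => by
      apply LinearMap.ext
      intro x
      have := hF V'
      rw [← sub_eq_zero]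
      refine tensor_eq_zero_of_jointly_injective
        (ι := Σ W : FGProj k, (E.obj e).obj W) (N' := fun i => F.obj V' ⊗[k] G.obj i.1)
        (fun i => TensorProduct.map LinearMap.id (evalHom (E.obj e) G i.1 i.2))
        (fun t ht => tensor_hom_eq_zero fun W y => ht ⟨W, y⟩) fun i => ?_
      rw [map_sub, sub_eq_zero]
      have e1 := (extLeft φ h i.1 i.2).naturality_apply (MvPolynomial σ k) f x
      rw [← hβ, ← hβ, LinearMap.baseChange_comp, LinearMap.baseChange_comp] at e1
      refine e1.trans ?_
      change bcTensor _ _ _ = (TensorProduct.map LinearMap.id _).baseChange _ (bcTensor _ _ _)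
      rw [LinearMap.comp_apply]
      generalize (β V).baseChange (MvPolynomial σ k) x = z
      rw [map_baseChange_eq_bcTensor, map_baseChange_eq_bcTensor, ← LinearMap.comp_apply,
        ← LinearMap.comp_apply, ← bcTensor_comp, ← bcTensor_comp]
      simp only [LinearMap.baseChange_id, LinearMap.comp_id, LinearMap.id_comp]⟩
  -- The factors are swapped because `exists_tensor_hom` expects the fixed projective module, here
  -- `Hom(E_e, G)`, on the left.
  obtain ⟨t, ht⟩ := exists_tensor_hom (E.homogeneous d) (hE.finite d _)
    (PolyFunctor.Hom.comp (tensorComm F (constMod (PolyFunctor.Hom (E.obj e) G))) B)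
  refine ⟨TensorProduct.comm k _ _ t, hE.hom_ext h hFd fun V W => ?_⟩
  apply TensorProduct.ext'
  intro x y
  rw [hE.extApp_star, ← extLeft_app, ← hβ]
  have e2 : B.app V x = TensorProduct.map (evalHom (E.obj d) F V x) LinearMap.id
      (TensorProduct.comm k _ _ t) := by
    have e3 := congrArg (TensorProduct.comm k _ _) (ht V x)
    rw [← TensorProduct.map_comm] at e3
    exact ((TensorProduct.comm k _ _).symm_apply_apply (B.app V x)).symm.trans e3.symm
  change _ = TensorProduct.map LinearMap.id (evalHom (E.obj e) G W y) (B.app V x)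
  rw [e2, ← LinearMap.comp_apply, ← TensorProduct.map_comp]
  rfl

end Star

end PolyAlgebra

/-! ### Calculus of convolutions, and the Künneth map with a parameter. -/

namespace PolyAlgebra

open PolyFunctor

variable {k : Type u} [CommRing k] {E : PolyAlgebra.{u, v} k} (hE : E.IsExponential)

section StarLin

variable {W : FGProj k} {X Y Z T T' : Type*} [AddCommGroup X] [AddCommGroup Y] [AddCommGroup Z]
  [AddCommGroup T] [AddCommGroup T'] [Module k X] [Module k Y] [Module k Z] [Module k T]
  [Module k T'] {U U' : Type*} [AddCommGroup U] [Module k U] [AddCommGroup U'] [Module k U']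

/-- The convolution product of linear maps `E_d(W) → X` and `E_e(W) → Y` along a bilinear map. -/
def IsExponential.starLin {d e n : ℕ} (h : d + e = n) (b : X →ₗ[k] Y →ₗ[k] Z)
    (p : (E.obj d).obj W →ₗ[k] X) (q : (E.obj e).obj W →ₗ[k] Y) : (E.obj n).obj W →ₗ[k] Z :=
  TensorProduct.lift b ∘ₗ TensorProduct.map p q ∘ₗ (E.comul hE h).app W

/-- Only the values of the bilinear map on the images of `p` and `q` matter; this lets linear maps
be moved freely between `b`, `p` and `q`. -/
theorem IsExponential.starLin_congr {d e n : ℕ} (h : d + e = n) {b : X →ₗ[k] Y →ₗ[k] Z}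
    {X' Y' : Type*} [AddCommGroup X'] [Module k X'] [AddCommGroup Y'] [Module k Y']
    {b' : X' →ₗ[k] Y' →ₗ[k] Z}
    {p : (E.obj d).obj W →ₗ[k] X} {q : (E.obj e).obj W →ₗ[k] Y}
    {p' : (E.obj d).obj W →ₗ[k] X'} {q' : (E.obj e).obj W →ₗ[k] Y'}
    (hb : ∀ x y, b (p x) (q y) = b' (p' x) (q' y)) :
    hE.starLin h b p q = hE.starLin h b' p' q' := by
  rw [starLin, starLin, ← LinearMap.comp_assoc, ← LinearMap.comp_assoc]
  congr 1
  exact TensorProduct.ext' fun x y => hb x y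

theorem IsExponential.starLin_add {d e n : ℕ} (h : d + e = n) (b b' : X →ₗ[k] Y →ₗ[k] Z)
    (p : (E.obj d).obj W →ₗ[k] X) (q : (E.obj e).obj W →ₗ[k] Y) :
    hE.starLin h (b + b') p q = hE.starLin h b p q + hE.starLin h b' p q := by
  rw [starLin, starLin, starLin, ← LinearMap.add_comp]
  congr 1
  exact TensorProduct.ext' fun x y => rfl

theorem IsExponential.starLin_smul {d e n : ℕ} (h : d + e = n) (c : k) (b : X →ₗ[k] Y →ₗ[k] Z)
    (p : (E.obj d).obj W →ₗ[k] X) (q : (E.obj e).obj W →ₗ[k] Y) :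
    hE.starLin h (c • b) p q = c • hE.starLin h b p q := by
  rw [starLin, starLin, ← LinearMap.smul_comp]
  congr 1
  exact TensorProduct.ext' fun x y => rfl

theorem IsExponential.starLin_add_right {d e n : ℕ} (h : d + e = n) (b : X →ₗ[k] Y →ₗ[k] Z)
    (p : (E.obj d).obj W →ₗ[k] X) (q q' : (E.obj e).obj W →ₗ[k] Y) :
    hE.starLin h b p (q + q') = hE.starLin h b p q + hE.starLin h b p q' := by
  rw [starLin, TensorProduct.map_add_right, LinearMap.add_comp, LinearMap.comp_add]
  rfl

theorem IsExponential.starLin_add_left {d e n : ℕ} (h : d + e = n) (b : X →ₗ[k] Y →ₗ[k] Z)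
    (p p' : (E.obj d).obj W →ₗ[k] X) (q : (E.obj e).obj W →ₗ[k] Y) :
    hE.starLin h b (p + p') q = hE.starLin h b p q + hE.starLin h b p' q := by
  rw [starLin, TensorProduct.map_add_left, LinearMap.add_comp, LinearMap.comp_add]
  rfl

theorem IsExponential.starLin_zero_right {d e n : ℕ} (h : d + e = n) (b : X →ₗ[k] Y →ₗ[k] Z)
    (p : (E.obj d).obj W →ₗ[k] X) :
    hE.starLin h b p (0 : (E.obj e).obj W →ₗ[k] Y) = 0 := by
  rw [starLin, TensorProduct.map_zero_right, LinearMap.zero_comp, LinearMap.comp_zero]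

theorem IsExponential.starLin_zero_left {d e n : ℕ} (h : d + e = n) (b : X →ₗ[k] Y →ₗ[k] Z)
    (q : (E.obj e).obj W →ₗ[k] Y) :
    hE.starLin h b (0 : (E.obj d).obj W →ₗ[k] X) q = 0 := by
  rw [starLin, TensorProduct.map_zero_left, LinearMap.zero_comp, LinearMap.comp_zero]

theorem IsExponential.comp_starLin {d e n : ℕ} (h : d + e = n) (l : Z →ₗ[k] T)
    (b : X →ₗ[k] Y →ₗ[k] Z) (p : (E.obj d).obj W →ₗ[k] X) (q : (E.obj e).obj W →ₗ[k] Y) :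
    l ∘ₗ hE.starLin h b p q = hE.starLin h (b.compr₂ l) p q := by
  rw [starLin, starLin, ← LinearMap.comp_assoc]
  congr 1
  exact TensorProduct.ext' fun x y => rfl

/-- Associativity of convolution. -/
theorem IsExponential.starLin_assoc {a b c ab bc n : ℕ} (hab : a + b = ab) (hbc : b + c = bc)
    (h : ab + c = n) (h' : a + bc = n) {b₁ : U →ₗ[k] Z →ₗ[k] T} {b₂ : X →ₗ[k] Y →ₗ[k] U}
    {b₃ : X →ₗ[k] U' →ₗ[k] T} {b₄ : Y →ₗ[k] Z →ₗ[k] U'} {p : (E.obj a).obj W →ₗ[k] X}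
    {q : (E.obj b).obj W →ₗ[k] Y} {r : (E.obj c).obj W →ₗ[k] Z}
    (hb : ∀ x y z, b₁ (b₂ (p x) (q y)) (r z) = b₃ (p x) (b₄ (q y) (r z))) :
    hE.starLin h b₁ (hE.starLin hab b₂ p q) r = hE.starLin h' b₃ p (hE.starLin hbc b₄ q r) := by
  ext y
  have h1 : ∀ t : ((E.obj a).obj W ⊗[k] (E.obj b).obj W) ⊗[k] (E.obj c).obj W,
      TensorProduct.lift b₁ (TensorProduct.map (TensorProduct.lift b₂ ∘ₗ TensorProduct.map p q)
        r t) = TensorProduct.lift b₃ (TensorProduct.map p (TensorProduct.lift b₄ ∘ₗ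
        TensorProduct.map q r) (TensorProduct.assoc k _ _ _ t)) := fun t =>
    LinearMap.congr_fun (f := TensorProduct.lift b₁ ∘ₗ TensorProduct.map (TensorProduct.lift b₂ ∘ₗ
        TensorProduct.map p q) r)
      (g := TensorProduct.lift b₃ ∘ₗ TensorProduct.map p (TensorProduct.lift b₄ ∘ₗ
        TensorProduct.map q r) ∘ₗ (TensorProduct.assoc k _ _ _).toLinearMap)
      (TensorProduct.ext_threefold fun x y z => hb x y z) t
  have h2 := h1 (TensorProduct.map ((E.comul hE hab).app W) LinearMap.id
    ((E.comul hE h).app W y))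
  rw [hE.comul_coassoc hab hbc h h'] at h2
  have h3 : ∀ t, TensorProduct.map (TensorProduct.lift b₂ ∘ₗ TensorProduct.map p q) r
      (TensorProduct.map ((E.comul hE hab).app W) LinearMap.id t) =
      TensorProduct.map (hE.starLin hab b₂ p q) r t := fun t => by
    rw [← LinearMap.comp_apply, ← TensorProduct.map_comp, LinearMap.comp_id]; rfl
  have h4 : ∀ t, TensorProduct.map p (TensorProduct.lift b₄ ∘ₗ TensorProduct.map q r)
      (TensorProduct.map LinearMap.id ((E.comul hE hbc).app W) t) =
      TensorProduct.map p (hE.starLin hbc b₄ q r) t := fun t => by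
    rw [← LinearMap.comp_apply, ← TensorProduct.map_comp, LinearMap.comp_id]; rfl
  rw [h3, h4] at h2
  exact h2

theorem IsExponential.starLin_comm (hcomm : E.IsCommutative) {d e n : ℕ} (h : d + e = n)
    (h' : e + d = n) {b : X →ₗ[k] Y →ₗ[k] Z} {b' : Y →ₗ[k] X →ₗ[k] Z}
    {p : (E.obj d).obj W →ₗ[k] X} {q : (E.obj e).obj W →ₗ[k] Y}
    (hb : ∀ x y, b (p x) (q y) = b' (q y) (p x)) :
    hE.starLin h b p q = hE.starLin h' b' q p := by
  ext y
  have h1 : ∀ t : (E.obj d).obj W ⊗[k] (E.obj e).obj W,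
      TensorProduct.lift b (TensorProduct.map p q t) =
        TensorProduct.lift b' (TensorProduct.map q p (TensorProduct.comm k _ _ t)) := fun t =>
    LinearMap.congr_fun (f := TensorProduct.lift b ∘ₗ TensorProduct.map p q)
      (g := TensorProduct.lift b' ∘ₗ TensorProduct.map q p ∘ₗ
        (TensorProduct.comm k _ _).toLinearMap) (TensorProduct.ext' fun x y => hb x y) t
  have h2 := h1 ((E.comul hE h).app W y)
  rw [hE.comul_comm hcomm h h'] at h2
  exact h2

/-- Left commutativity of convolution. -/
theorem IsExponential.starLin_left_comm (hcomm : E.IsCommutative) {a b c ac bc n : ℕ}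
    (hbc : b + c = bc) (h : a + bc = n) (hac : a + c = ac) (h' : b + ac = n)
    {b₁ : X →ₗ[k] U →ₗ[k] T} {b₂ : Y →ₗ[k] Z →ₗ[k] U} {b₃ : Y →ₗ[k] U' →ₗ[k] T}
    {b₄ : X →ₗ[k] Z →ₗ[k] U'} {p : (E.obj a).obj W →ₗ[k] X}
    {q : (E.obj b).obj W →ₗ[k] Y} {r : (E.obj c).obj W →ₗ[k] Z}
    (hb : ∀ x y z, b₁ (p x) (b₂ (q y) (r z)) = b₃ (q y) (b₄ (p x) (r z))) :
    hE.starLin h b₁ p (hE.starLin hbc b₂ q r) = hE.starLin h' b₃ q (hE.starLin hac b₄ p r) := by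
  -- A trilinear map regrouped so that `p` and `q` come together. Left commutativity is then
  -- associativity, commutativity for the universal convolution of `p` and `q`, and associativity
  -- again.
  let m : X ⊗[k] Y →ₗ[k] Z →ₗ[k] T := TensorProduct.lift
    (LinearMap.mk₂ k (fun x y => b₁ x ∘ₗ b₂ y)
      (fun _ _ _ => by ext; simp) (fun _ _ _ => by ext; simp) (fun _ _ _ => by ext; simp)
      (fun _ _ _ => by ext; simp))
  have e1 : hE.starLin h b₁ p (hE.starLin hbc b₂ q r) =
      hE.starLin (show (a + b) + c = n by omega) m
        (hE.starLin rfl (TensorProduct.mk k X Y) p q) r :=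
    (hE.starLin_assoc rfl hbc _ h fun x y z => rfl).symm
  have e2 : hE.starLin rfl (TensorProduct.mk k X Y) p q =
      hE.starLin (add_comm b a) (TensorProduct.mk k X Y).flip q p :=
    hE.starLin_comm hcomm _ _ fun x y => rfl
  rw [e1, e2]
  exact hE.starLin_assoc _ hac _ h' fun y x z => hb x y z

end StarLin

/-- The Künneth map as a morphism of strict polynomial functors. -/
def IsExponential.starParam {F : PolyFunctor.{u, w} k} {G : PolyFunctor.{u, w'} k} {d e n : ℕ}
    (h : d + e = n) (hF : F.IsHomogeneous d) (hG : G.IsHomogeneous e)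
    (hFG : (tensor F G).IsHomogeneous n) :
    PolyFunctor.Hom (tensor (paramHom (E.obj d) F hF) (paramHom (E.obj e) G hG))
      (paramHom (E.obj n) (tensor F G) hFG) :=
  toParamHom hFG (fun V => TensorProduct.lift
    (hE.star (F := F.param V) (G := G.param V)
      (PolyFunctor.Hom.id (tensor (F.param V) (G.param V))) h)) fun W y => by
    -- On a pure tensor `a ⊗ b` the value is `φ(a) ⊗ φ'(b)`, a tensor product of two evaluations,
    -- which are morphisms in `V`. Sums give the value on the comultiplication of any `y`.
    have key : ∀ t : (E.obj d).obj W ⊗[k] (E.obj e).obj W,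
        ∃ ψ : PolyFunctor.Hom (tensor (paramHom (E.obj d) F hF) (paramHom (E.obj e) G hG))
          ((tensor F G).paramLeft W), ∀ (V : FGProj k) (φ : PolyFunctor.Hom (E.obj d) (F.param V))
            (φ' : PolyFunctor.Hom (E.obj e) (G.param V)), ψ.app V (φ ⊗ₜ φ') =
              TensorProduct.map (φ.app W) (φ'.app W) t := by
      intro t
      induction t with
      | zero => exact ⟨0, fun V φ φ' => by rw [map_zero, PolyFunctor.Hom.zero_app]⟩
      | add t t' ht ht' =>
        obtain ⟨ψ, hψ⟩ := ht
        obtain ⟨ψ', hψ'⟩ := ht'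
        refine ⟨ψ + ψ', fun V φ φ' => ?_⟩
        rw [PolyFunctor.Hom.add_app, LinearMap.add_apply, hψ, hψ', map_add]
      | tmul a b =>
        exact ⟨tensorHom (F' := F.paramLeft W) (G' := G.paramLeft W)
          (evalParamHom (E.obj d) hF W a) (evalParamHom (E.obj e) hG W b), fun V φ φ' => rfl⟩
    obtain ⟨ψ, hψ⟩ := key ((E.comul hE h).app W y)
    refine ⟨ψ, fun V => LinearMap.congr_fun (f := ψ.app V)
      (g := evalHom (E.obj n) ((tensor F G).param V) W y ∘ₗ TensorProduct.lift
        (hE.star (F := F.param V) (G := G.param V)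
          (PolyFunctor.Hom.id (tensor (F.param V) (G.param V))) h)) ?_⟩
    apply TensorProduct.ext'
    intro φ φ'
    rw [hψ]
    rfl

theorem IsExponential.starParam_app {F : PolyFunctor.{u, w} k} {G : PolyFunctor.{u, w'} k}
    {d e n : ℕ} (h : d + e = n) (hF : F.IsHomogeneous d) (hG : G.IsHomogeneous e)
    (hFG : (tensor F G).IsHomogeneous n) (V W : FGProj k)
    (φ : PolyFunctor.Hom (E.obj d) (F.param V)) (ψ : PolyFunctor.Hom (E.obj e) (G.param V)) :
    PolyFunctor.Hom.app (G := (tensor F G).param V)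
      ((hE.starParam h hF hG hFG).app V (φ ⊗ₜ ψ)) W =
      hE.starLin h (TensorProduct.mk k _ _) (φ.app W) (ψ.app W) := by
  rw [starLin, TensorProduct.lift_mk, LinearMap.id_comp]
  rfl

theorem IsHomogeneous.param {F : PolyFunctor.{u, w} k} {d : ℕ} (hF : F.IsHomogeneous d)
    (V : FGProj k) : (F.param V).IsHomogeneous d := by
  intro R _ _ W W' r g
  have h := bcTensor_smul 1 r (LinearMap.id : R ⊗[k] V →ₗ[R] R ⊗[k] V) g
  rw [one_smul, _root_.one_mul] at h
  change F.map R _ = _ • F.map R _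
  rw [h]
  exact hF R _ _ r _

theorem IsExponential.starParam_bijective {F : PolyFunctor.{u, w} k} {G : PolyFunctor.{u, w'} k}
    {d e n : ℕ} (h : d + e = n) (hF : F.IsHomogeneous d) (hG : G.IsHomogeneous e)
    (hFG : (tensor F G).IsHomogeneous n) (V : FGProj k)
    (hpF : ∀ V, Module.Projective k (F.obj V))
    (hH : Module.Projective k (PolyFunctor.Hom (E.obj e) (G.param V))) :
    Function.Bijective ((hE.starParam h hF hG hFG).app V) :=
  ⟨hE.star_injective h (F := F.param V) (G := G.param V) (fun W => hpF (V.tensor W)) hH,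
    hE.star_surjective h (F := F.param V) (G := G.param V) (IsHomogeneous.param hF V)
      (fun W => hpF (V.tensor W)) hH⟩

end PolyAlgebra

/-! ### The comparison map and its bijectivity. -/

namespace PolyFunctor

variable {k : Type u} [CommRing k]

theorem IsHomogeneous.constUp : IsHomogeneous (PolyDga.constUp.{u, w} k) 0 := by
  intro _ _ _ V W r f
  rw [pow_zero, one_smul]

theorem linMap_param_constUp (V : FGProj k) {W W' : FGProj k} (g : W →ₗ[k] W') :
    ((PolyDga.constUp.{u, w} k).param V).linMap g = (LinearMap.id : ULift.{w} k →ₗ[k] ULift k) :=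
  ((PolyDga.constUp.{u, w} k).param V).linMap_eq_of_map (by rw [LinearMap.baseChange_id])

theorem homDirectSum_lof {ι : Type w'} [DecidableEq ι] {F : PolyFunctor.{u, v} k}
    {G : ι → PolyFunctor.{u, w} k} (i : ι) (φ : PolyFunctor.Hom F (G i)) :
    homDirectSum F G (DirectSum.lof k ι (fun i => PolyFunctor.Hom F (G i)) i φ) =
      PolyFunctor.Hom.comp (directSumι G i) φ :=
  DirectSum.toModule_lof k (M := fun i => PolyFunctor.Hom F (G i)) i φ

end PolyFunctor

namespace PolyAlgebra

open PolyFunctor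

variable {k : Type u} [CommRing k] {E : PolyAlgebra.{u, v} k} (hE : E.IsExponential)

/-- Every element of `E₀(W)` is a multiple of the image of the unit of `E₀(k)`. Hence a morphism out
of `E₀` is determined by its value at that unit, which is the only value that the augmentation of
the convolution algebra sees. -/
theorem eq_counit_smul_linMap (W : FGProj k) (y : (E.obj 0).obj W) :
    y = (((E.counit hE).app W y : k)) • (E.obj 0).linMap (0 : FGProj.unit k →ₗ[k] W)
      (E.unit.app (FGProj.unit k) (1 : k)) := by
  rw [linMap_unit, ← map_smul, smul_eq_mul, _root_.mul_one, unit_counit]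

end PolyAlgebra

namespace PolyDga

open PolyFunctor

variable {k : Type u} [CommRing k] {E : PolyAlgebra.{u, v} k} (hE : E.IsExponential)
  (A : PolyDga.{u, w} k)

theorem word_isHomogeneous (t : List (ℤ × ℕ)) {n : ℕ} (h : wordWt t = n) :
    (A.word t).IsHomogeneous n := h ▸ A.word_homogeneous t

theorem ideal_isHomogeneous (a : ℤ × ℕ) : (A.ideal a).IsHomogeneous a.2 :=
  IsHomogeneous.splitKer (A.homogeneous a.1 a.2)

/-- The map `φ ↦ φ` from the augmentation ideal of `H(E, A)` to `H(E, A')`. -/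
def idealConv (a : ℤ × ℕ) : PolyFunctor.Hom ((convAlg E hE A).ideal a)
    (paramHom (E.obj a.2) (A.ideal a) (A.ideal_isHomogeneous a)) :=
  PolyFunctor.Hom.comp (paramHomPost (E.obj a.2) (A.homogeneous a.1 a.2)
    (A.ideal_isHomogeneous a) (A.idealπ a)) ((convAlg E hE A).idealι a)

/-- The map `[φ₁|…|φₙ] ↦ φ₁ ⋆ ⋯ ⋆ φₙ`. -/
def wordConv : ∀ (t : List (ℤ × ℕ)) (n : ℕ) (h : wordWt t = n),
    PolyFunctor.Hom ((convAlg E hE A).word t)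
      (paramHom (E.obj n) (A.word t) (A.word_isHomogeneous t h))
  | [], _, rfl => PolyFunctor.Hom.comp (convUnit E hE IsHomogeneous.constUp (constToUp k))
      (constDown k)
  | a :: t, _, h => PolyFunctor.Hom.comp
      (hE.starParam h (A.ideal_isHomogeneous a) (A.word_homogeneous t)
        (A.word_isHomogeneous (a :: t) h))
      (tensorHom (idealConv hE A a) (wordConv t _ rfl))

variable {A} {V : FGProj k}

/-- The augmentation of `H(E, A)` only evaluates at `W = k`. Composing `φ` with the augmentation of
`A` gives a morphism from `E₀` to a constant functor, so vanishing at the unit implies vanishing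
everywhere. It follows that the augmentation ideal of `H(E, A)` is `H(E, A')`. -/
theorem augAt_app_eq_zero (i : ℤ) (d : ℕ) (φ : ((convAlg E hE A).obj i d).obj V) :
    ((convAlg E hE A).augAt i d).app V φ = 0 ↔ ∀ W y, (A.augAt i d).app (V.tensor W)
      (PolyFunctor.Hom.app (G := (A.obj i d).param V) φ W y) = 0 := by
  by_cases h : i = 0 ∧ d = 0
  · obtain ⟨rfl, rfl⟩ := h
    constructor
    · intro h W y
      let ψ : PolyFunctor.Hom (E.obj 0) ((const k).param V) :=
        PolyFunctor.Hom.comp (G := (A.obj 0 0).param V) (paramMap A.aug V) φ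
      have h1 : ψ.app (FGProj.unit k) (E.unit.app (FGProj.unit k) (1 : k)) = 0 := h
      have h2 : ψ.app W y = 0 := by
        rw [PolyAlgebra.eq_counit_smul_linMap hE W y, map_smul, PolyFunctor.Hom.app_linMap, h1,
          map_zero, smul_zero]
      exact h2
    · intro h
      exact h _ _
  · constructor
    · intro _ W y
      exact A.augAt_of_ne _ h _
    · intro _
      exact (convAlg E hE A).augAt_of_ne _ h _

theorem idealι_idealConv (a : ℤ × ℕ) (x : ((convAlg E hE A).ideal a).obj V) (W : FGProj k)
    (y : (E.obj a.2).obj W) :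
    (A.idealι a).app (V.tensor W)
      (PolyFunctor.Hom.app (G := (A.ideal a).param V) ((idealConv hE A a).app V x) W y) =
      PolyFunctor.Hom.app (G := (A.obj a.1 a.2).param V)
        (((convAlg E hE A).idealι a).app V x) W y :=
  A.idealι_idealπ_of_augAt _ a
    ((augAt_app_eq_zero hE a.1 a.2 _).1 ((convAlg E hE A).augAt_idealι V a x) W y)

theorem idealConv_bijective (a : ℤ × ℕ) : Function.Bijective ((idealConv hE A a).app V) := by
  constructor
  · intro x x' h
    apply (convAlg E hE A).idealι_injective V a
    apply convAlg_ext hE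
    intro W y
    rw [← idealι_idealConv, ← idealι_idealConv, h]
  · intro ψ
    let φ : ((convAlg E hE A).obj a.1 a.2).obj V :=
      PolyFunctor.Hom.comp (G := (A.ideal a).param V) (paramMap (A.idealι a) V) ψ
    have hφ : ((convAlg E hE A).augAt a.1 a.2).app V φ = 0 :=
      (augAt_app_eq_zero hE a.1 a.2 _).2 fun W y => A.augAt_idealι (V.tensor W) a _
    refine ⟨((convAlg E hE A).idealπ a).app V φ, ?_⟩
    refine PolyFunctor.Hom.ext (G := (A.ideal a).param V) fun W y => ?_
    apply A.idealι_injective (V.tensor W) a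
    rw [idealι_idealConv, (convAlg E hE A).idealι_idealπ_of_augAt V a hφ]
    rfl

theorem ideal_projective (hA : A.HasProjectiveValues) (a : ℤ × ℕ) (V : FGProj k) :
    Module.Projective k ((A.ideal a).obj V) := by
  have := hA a.1 a.2 V
  exact Module.Projective.of_split ((A.idealι a).app V) ((A.idealπ a).app V)
    (LinearMap.ext fun x => A.idealπ_idealι V a x)

theorem word_projective (hA : A.HasProjectiveValues) (V : FGProj k) : ∀ t : List (ℤ × ℕ),
    Module.Projective k ((A.word t).obj V)
  | [] => Module.Projective.of_equiv (ULift.moduleEquiv (R := k) (M := k)).symm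
  | a :: t => by
    have := ideal_projective hA a V
    have := word_projective hA V t
    exact inferInstanceAs (Module.Projective k ((A.ideal a).obj V ⊗[k] (A.word t).obj V))

theorem wordConv_nil_app (c : ((convAlg E hE A).word []).obj V) (W : FGProj k)
    (y : (E.obj 0).obj W) :
    PolyFunctor.Hom.app (G := (A.word []).param V) ((wordConv hE A [] 0 rfl).app V c) W y =
      ULift.up (c.down * ((E.counit hE).app W y : k)) := rfl

/-- Each letter is split off by the Künneth formula, and the empty word amounts to `Hom(E₀, k) ≃ k`.
-/
theorem wordConv_bijective (hA : A.HasProjectiveValues)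
    (hH : (convAlg E hE A).HasProjectiveValues) (V : FGProj k) :
    ∀ (t : List (ℤ × ℕ)) (n : ℕ) (h : wordWt t = n),
      Function.Bijective ((wordConv hE A t n h).app V)
  | [], _, rfl => by
    constructor
    · intro c c' h
      have h1 := congrArg (fun φ => PolyFunctor.Hom.app (G := (A.word []).param V) φ
        (FGProj.unit k) (E.unit.app (FGProj.unit k) (1 : k))) h
      have h2 : ∀ c, PolyFunctor.Hom.app (G := (A.word []).param V)
        ((wordConv hE A [] 0 rfl).app V c) (FGProj.unit k)
          (E.unit.app (FGProj.unit k) (1 : k)) = ULift.up c.down := by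
        intro c
        rw [wordConv_nil_app, PolyAlgebra.counit_unit]
        exact congrArg ULift.up (_root_.mul_one _)
      have h3 := (h2 c).symm.trans (h1.trans (h2 c'))
      exact ULift.ext _ _ (ULift.up.inj h3)
    · intro φ
      let ψ : PolyFunctor.Hom (E.obj 0) ((constUp.{u, w} k).param V) := φ
      refine ⟨ULift.up (ψ.app (FGProj.unit k) (E.unit.app (FGProj.unit k) (1 : k))).down, ?_⟩
      refine PolyFunctor.Hom.ext (G := (A.word []).param V) fun W y => ?_
      have h1 : ψ.app W y = (((E.counit hE).app W y : k)) •
          ψ.app (FGProj.unit k) (E.unit.app (FGProj.unit k) (1 : k)) := by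
        conv_lhs => rw [PolyAlgebra.eq_counit_smul_linMap hE W y, map_smul,
          PolyFunctor.Hom.app_linMap, linMap_param_constUp]
        rfl
      refine Eq.trans ?_ h1.symm
      exact congrArg ULift.up (mul_comm _ _)
  | a :: t, n, h => by
    have ih := wordConv_bijective hA hH V t (wordWt t) rfl
    -- The Künneth formula requires `Hom(E, A'_{a₂} ⊗ ⋯ ⊗ A'_{aₙ})` to be projective. The induction
    -- hypothesis identifies it with a word of `H(E, A)`, which is projective by assumption.
    have hp := word_projective hH V t
    have hq : Module.Projective k (PolyFunctor.Hom (E.obj (wordWt t)) ((A.word t).param V)) :=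
      Module.Projective.of_equiv (LinearEquiv.ofBijective _ ih)
    have h1 := hE.starParam_bijective h (A.ideal_isHomogeneous a) (A.word_homogeneous t)
      (A.word_isHomogeneous (a :: t) h) V (ideal_projective hA a) hq
    exact h1.comp (TensorProduct.congr (LinearEquiv.ofBijective _ (idealConv_bijective hE a))
      (LinearEquiv.ofBijective _ ih)).bijective

variable (A) in
/-- The isomorphism from `B H(E, A)` to `H(E, B A)`. -/
def barConv (i : ℤ) (d : ℕ) :
    PolyFunctor.Hom ((convAlg E hE A).bar.obj i d) ((convAlg E hE A.bar).obj i d) :=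
  directSumDesc fun t : WordIn i d => PolyFunctor.Hom.comp
    (paramHomPost (E.obj d) (A.word_isHomogeneous t.1 t.2.2) (A.bar.homogeneous i d)
      (directSumι (fun t : WordIn i d => A.word t.1) t)) (wordConv hE A t.1 d t.2.2)

theorem barConv_ι (i : ℤ) (d : ℕ) (t : WordIn i d) (z : ((convAlg E hE A).word t.1).obj V) :
    (barConv hE A i d).app V
        ((directSumι (fun t : WordIn i d => (convAlg E hE A).word t.1) t).app V z) =
      PolyFunctor.Hom.comp (G := (A.word t.1).param V)
        (paramMap (directSumι (fun t : WordIn i d => A.word t.1) t) V)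
        ((wordConv hE A t.1 d t.2.2).app V z) :=
  directSumDesc_ι (F := fun t : WordIn i d => (convAlg E hE A).word t.1) _ t V z

/-- The map is the direct sum of the bijections on words followed by `⨁ Hom(E_d, Gₜ) → Hom(E_d, ⨁
Gₜ)`. A bidegree contains infinitely many words, since letters may have weight zero and any degree,
so the finiteness of `E_d` is really needed here. -/
theorem barConv_bijective (hA : A.HasProjectiveValues)
    (hH : (convAlg E hE A).HasProjectiveValues) (i : ℤ) (d : ℕ) (V : FGProj k) :
    Function.Bijective ((barConv hE A i d).app V) := by
  have h1 := homDirectSum_bijective (E.homogeneous d) (hE.finite d _)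
    (fun t : WordIn i d => (A.word t.1).param V)
  let l : ∀ t : WordIn i d, ((convAlg E hE A).word t.1).obj V →ₗ[k]
      PolyFunctor.Hom (E.obj d) ((A.word t.1).param V) := fun t => (wordConv hE A t.1 d t.2.2).app V
  have h2 : Function.Bijective (DirectSum.lmap l) :=
    ⟨(DirectSum.lmap_injective l).2 fun t => (wordConv_bijective hE hA hH V t.1 d t.2.2).1,
      (DirectSum.lmap_surjective l).2 fun t => (wordConv_bijective hE hA hH V t.1 d t.2.2).2⟩
  let g : DirectSum (WordIn i d) (fun t => ((convAlg E hE A).word t.1).obj V) →ₗ[k]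
      PolyFunctor.Hom (E.obj d) (directSum fun t : WordIn i d => (A.word t.1).param V) :=
    (barConv hE A i d).app V
  have h3 : g = homDirectSum (E.obj d) (fun t : WordIn i d => (A.word t.1).param V) ∘ₗ
      DirectSum.lmap l := by
    refine DirectSum.linearMap_ext k fun t => LinearMap.ext fun z => ?_
    refine (barConv_ι hE i d t z).trans ?_
    rw [LinearMap.comp_apply, LinearMap.comp_apply, DirectSum.lmap_lof]
    exact (homDirectSum_lof (F := E.obj d) (G := fun t : WordIn i d => (A.word t.1).param V) t
      (l t z)).symm
  have h4 := h1.comp h2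
  rw [← LinearMap.coe_comp, ← h3] at h4
  exact h4

end PolyDga

/-! ### The values of the comparison map, product and differential on words. -/

namespace PolyAlgebra

variable {k : Type u} [CommRing k] {E : PolyAlgebra.{u, v} k} (hE : E.IsExponential)

theorem IsExponential.starLin_counit {n : ℕ} {W : FGProj k} {X Y Z : Type*} [AddCommGroup X]
    [AddCommGroup Y] [AddCommGroup Z] [Module k X] [Module k Y] [Module k Z]
    {b : X →ₗ[k] Y →ₗ[k] Z} {p : (E.obj 0).obj W →ₗ[k] X} {q : (E.obj n).obj W →ₗ[k] Y}
    {r : (E.obj n).obj W →ₗ[k] Z}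
    (hb : ∀ x y, b (p x) (q y) = ((E.counit hE).app W x : k) • r y) :
    hE.starLin (zero_add n) b p q = r := by
  have h1 : TensorProduct.lift b ∘ₗ TensorProduct.map p q = r ∘ₗ
      (TensorProduct.lid k _).toLinearMap ∘ₗ
        TensorProduct.map ((E.counit hE).app W) LinearMap.id :=
    TensorProduct.ext' fun x y => (hb x y).trans (r.map_smul _ _).symm
  ext y
  have h2 := LinearMap.congr_fun h1 ((E.comul hE (zero_add n)).app W y)
  exact h2.trans (congrArg r (hE.lid_counit_comul y))

end PolyAlgebra

namespace PolyDga

open PolyFunctor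

variable {k : Type u} [CommRing k] {E : PolyAlgebra.{u, v} k} (hE : E.IsExponential)
  {A : PolyDga.{u, w} k} {V W : FGProj k}

/-- The component at `W` of the image of a letter. -/
def idealVal (a : ℤ × ℕ) (V W : FGProj k) : ((convAlg E hE A).ideal a).obj V →ₗ[k]
    (E.obj a.2).obj W →ₗ[k] (A.ideal a).obj (V.tensor W) where
  toFun x := PolyFunctor.Hom.app (G := (A.ideal a).param V) ((idealConv hE A a).app V x) W
  map_add' x y := by rw [map_add]; rfl
  map_smul' c x := by rw [map_smul]; rfl

/-- The component at `W` of the image of a word. -/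
def wordVal (t : List (ℤ × ℕ)) {n : ℕ} (h : wordWt t = n) (V W : FGProj k) :
    ((convAlg E hE A).word t).obj V →ₗ[k]
      (E.obj n).obj W →ₗ[k] (A.word t).obj (V.tensor W) where
  toFun x := PolyFunctor.Hom.app (G := (A.word t).param V) ((wordConv hE A t n h).app V x) W
  map_add' x y := by rw [map_add]; rfl
  map_smul' c x := by rw [map_smul]; rfl

/-- The component of weight `n` at `W` of the image of an element of the bar construction. -/
def barVal (n : ℕ) (V W : FGProj k) : (convAlg E hE A).barTotal.obj V →ₗ[k]
    (E.obj n).obj W →ₗ[k] A.barTotal.obj (V.tensor W) :=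
  -- Words of another weight get the value zero. This makes the map total on the ungraded bar
  -- construction, and the recursion `barVal_cons` holds for all arguments.
  DirectSum.toModule k (List (ℤ × ℕ)) _ fun t => if h : wordWt t = n then
    LinearMap.compRight k ((A.wordι t).app (V.tensor W)) ∘ₗ wordVal hE t h V W else 0

theorem barVal_ι {n : ℕ} (t : List (ℤ × ℕ)) (h : wordWt t = n)
    (z : ((convAlg E hE A).word t).obj V) :
    barVal hE n V W (((convAlg E hE A).wordι t).app V z) =
      (A.wordι t).app (V.tensor W) ∘ₗ wordVal hE t h V W z := by
  refine (DirectSum.toModule_lof k (M := fun t => ((convAlg E hE A).word t).obj V) t z).trans ?_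
  rw [dif_pos h]
  rfl

theorem barVal_ι_of_ne {n : ℕ} (t : List (ℤ × ℕ)) (h : wordWt t ≠ n)
    (z : ((convAlg E hE A).word t).obj V) :
    barVal hE n V W (((convAlg E hE A).wordι t).app V z) = 0 := by
  refine (DirectSum.toModule_lof k (M := fun t => ((convAlg E hE A).word t).obj V) t z).trans ?_
  rw [dif_neg h]
  rfl

theorem wordVal_cons (a : ℤ × ℕ) (t : List (ℤ × ℕ)) {m n : ℕ} (hm : wordWt t = m)
    (h : wordWt (a :: t) = n) (h' : a.2 + m = n) (x : ((convAlg E hE A).ideal a).obj V)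
    (z : ((convAlg E hE A).word t).obj V) :
    wordVal hE (a :: t) h V W (x ⊗ₜ z) =
      hE.starLin h' (TensorProduct.mk k _ _) (idealVal hE a V W x) (wordVal hE t hm V W z) := by
  subst hm
  exact hE.starParam_app h' (A.ideal_isHomogeneous a) (A.word_homogeneous t)
    (A.word_isHomogeneous (a :: t) h) V W _ _

/-- Prefixing a letter corresponds to convolving with its image. With this, the recursive formulas
for the bar differential and the shuffle product become identities between convolutions. -/
theorem barVal_cons (a : ℤ × ℕ) {m n : ℕ} (h : a.2 + m = n)
    (x : ((convAlg E hE A).ideal a).obj V) (z : (convAlg E hE A).barTotal.obj V) :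
    barVal hE n V W ((convAlg E hE A).cons V a x z) =
      hE.starLin h (A.cons (V.tensor W) a) (idealVal hE a V W x) (barVal hE m V W z) := by
  induction z using (convAlg E hE A).barTotal_induction with
  | h0 => rw [map_zero, map_zero, map_zero, hE.starLin_zero_right]
  | hadd x y hx hy => rw [map_add, map_add, map_add, hx, hy, hE.starLin_add_right]
  | h t z =>
    rw [cons_wordι]
    by_cases ht : wordWt t = m
    · have ht' : wordWt (a :: t) = n := by rw [wordWt_cons, ht, h]
      rw [barVal_ι hE _ ht', barVal_ι hE _ ht, wordVal_cons hE a t ht ht' h, hE.comp_starLin]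
      exact hE.starLin_congr h fun x y => (A.cons_wordι a t _ _).symm
    · have ht' : wordWt (a :: t) ≠ n := by rw [wordWt_cons]; omega
      rw [barVal_ι_of_ne hE _ ht, barVal_ι_of_ne hE _ ht', hE.starLin_zero_right]

theorem wordVal_nil_apply (h : wordWt [] = 0) (c : ((convAlg E hE A).word []).obj V)
    (y : (E.obj 0).obj W) : wordVal hE [] h V W c y = ULift.up (c.down * ((E.counit hE).app W y : k)) := rfl

/-- Compatibility with the shuffle product. -/
theorem barVal_shuffle (hcomm : E.IsCommutative) : ∀ (s t : List (ℤ × ℕ)) {d e n : ℕ}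
    (hd : wordWt s = d) (he : wordWt t = e) (h : d + e = n)
    (z : ((convAlg E hE A).word s).obj V) (z' : ((convAlg E hE A).word t).obj V),
    barVal hE n V W (((convAlg E hE A).shuffle s t).app V (z ⊗ₜ z')) =
      hE.starLin h (TensorProduct.curry ((A.shuffle s t).app (V.tensor W)))
        (wordVal hE s hd V W z) (wordVal hE t he V W z')
  | [], t, d, e, n, hd, he, h, z, z' => by
    obtain rfl : 0 = d := hd
    obtain rfl : e = n := by omega
    have e1 : ((convAlg E hE A).shuffle [] t).app V (z ⊗ₜ z') =
        z.down • ((convAlg E hE A).wordι t).app V z' := by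
      rw [shuffle]
      exact ((convAlg E hE A).wordι t).app V |>.map_smul z.down z'
    rw [e1, map_smul, barVal_ι hE t he]
    symm
    apply hE.starLin_counit
    intro x y
    rw [TensorProduct.curry_apply, shuffle]
    refine (((A.wordι t).app (V.tensor W)).map_smul
      (z.down * ((E.counit hE).app W x : k)) (wordVal hE t he V W z' y)).trans ?_
    rw [mul_comm, mul_smul]
    rfl
  | a :: s, [], d, e, n, hd, he, h, z, z' => by
    obtain rfl : 0 = e := he
    obtain rfl : d = n := by omega
    have e1 : ((convAlg E hE A).shuffle (a :: s) []).app V (z ⊗ₜ z') =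
        z'.down • ((convAlg E hE A).wordι (a :: s)).app V z := by
      rw [shuffle]
      exact ((convAlg E hE A).wordι (a :: s)).app V |>.map_smul z'.down z
    rw [e1, map_smul, barVal_ι hE (a :: s) hd]
    -- The counit law is available on the left factor only, so the empty second word is moved to the
    -- left.
    rw [hE.starLin_comm hcomm h (zero_add d) (b' := (TensorProduct.curry
      ((A.shuffle (a :: s) []).app (V.tensor W))).flip) (fun x y => rfl)]
    symm
    apply hE.starLin_counit
    intro x y
    rw [LinearMap.flip_apply, TensorProduct.curry_apply, shuffle]
    refine (((A.wordι (a :: s)).app (V.tensor W)).map_smul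
      (z'.down * ((E.counit hE).app W x : k)) (wordVal hE (a :: s) hd V W z y)).trans ?_
    rw [mul_comm, mul_smul]
    rfl
  | a :: s, b :: t, d, e, n, hd, he, h, z, z' => by
    induction z using TensorProduct.induction_on with
    | zero =>
      rw [TensorProduct.zero_tmul, map_zero, map_zero, map_zero, hE.starLin_zero_left]
    | add z₁ z₂ h₁ h₂ =>
      rw [TensorProduct.add_tmul, map_add, map_add, map_add, hE.starLin_add_left, h₁, h₂]
    | tmul x z =>
    induction z' using TensorProduct.induction_on with
    | zero =>
      rw [TensorProduct.tmul_zero, map_zero, map_zero, map_zero, hE.starLin_zero_right]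
    | add z₁ z₂ h₁ h₂ =>
      rw [TensorProduct.tmul_add, map_add, map_add, map_add, hE.starLin_add_right, h₁, h₂]
    | tmul y z' =>
    rw [wordWt_cons] at hd he
    have ih1 := barVal_shuffle hcomm s (b :: t) (n := wordWt s + e) rfl he rfl z (y ⊗ₜ z')
    have ih2 := barVal_shuffle hcomm (a :: s) t (n := d + wordWt t) hd rfl rfl (x ⊗ₜ z) z'
    have e1 : ((convAlg E hE A).shuffle (a :: s) (b :: t)).app V ((x ⊗ₜ z) ⊗ₜ (y ⊗ₜ z')) =
        (convAlg E hE A).cons V a x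
          (((convAlg E hE A).shuffle s (b :: t)).app V (z ⊗ₜ (y ⊗ₜ z'))) +
        ksign k (wordDeg (a :: s) * (b.1 + 1)) • (convAlg E hE A).cons V b y
          (((convAlg E hE A).shuffle (a :: s) t).app V ((x ⊗ₜ z) ⊗ₜ z')) := by
      rw [shuffle]
      rfl
    have e2 : TensorProduct.curry ((A.shuffle (a :: s) (b :: t)).app (V.tensor W)) =
        TensorProduct.curry ((A.shuffleLeft a s (b :: t) (A.shuffle s (b :: t))).app
          (V.tensor W)) +
        TensorProduct.curry ((A.shuffleRight b (a :: s) t (A.shuffle (a :: s) t)).app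
          (V.tensor W)) := by
      rw [shuffle]
      rfl
    rw [e1, e2, map_add, map_smul, barVal_cons hE a (show a.2 + (wordWt s + e) = n by omega),
      barVal_cons hE b (show b.2 + (d + wordWt t) = n by omega), ih1, ih2, hE.starLin_add]
    -- A shuffle beginning in the first word only requires reassociating the convolution. One
    -- beginning in the second word requires moving its letter past the first word, which uses
    -- commutativity of `E`; the Koszul sign is already part of `shuffleRight`.
    congr 1
    · rw [wordVal_cons hE a s rfl hd hd]
      exact (hE.starLin_assoc _ _ _ _ fun _ _ _ => rfl).symm
    · rw [wordVal_cons hE b t rfl he he, ← hE.starLin_smul]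
      exact (hE.starLin_left_comm hcomm _ _ _ _ fun _ _ _ => rfl).symm
termination_by s t => s.length + t.length

theorem idealVal_idealDiff (hA : A.IsCdga) (hcomm : E.IsCommutative) (a : ℤ × ℕ)
    (x : ((convAlg E hE A).ideal a).obj V) :
    idealVal hE (a.1 - 1, a.2) V W (((convAlg E hE A).idealDiff a).app V x) =
      (A.idealDiff a).app (V.tensor W) ∘ₗ idealVal hE a V W x := by
  refine LinearMap.ext fun y => A.idealι_injective (V.tensor W) (a.1 - 1, a.2) ?_
  refine (idealι_idealConv hE (A := A) (a.1 - 1, a.2) _ W y).trans ?_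
  rw [(hA.convAlg hE hcomm).idealι_idealDiff, LinearMap.comp_apply, hA.idealι_idealDiff]
  refine (convAlg_diff_app hE _ _ _ _ _ y).trans ?_
  exact congrArg _ (idealι_idealConv hE a x W y).symm

theorem idealVal_idealMul (hA : A.IsCdga) (hcomm : E.IsCommutative) (a b : ℤ × ℕ)
    (x : ((convAlg E hE A).ideal a).obj V) (y : ((convAlg E hE A).ideal b).obj V) :
    idealVal hE (a + b) V W (((convAlg E hE A).idealMul a b).app V (x ⊗ₜ y)) =
      hE.starLin rfl (TensorProduct.curry ((A.idealMul a b).app (V.tensor W)))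
        (idealVal hE a V W x) (idealVal hE b V W y) := by
  refine LinearMap.ext fun z => A.idealι_injective (V.tensor W) (a + b) ?_
  refine (idealι_idealConv hE (A := A) (a + b) _ W z).trans ?_
  rw [(hA.convAlg hE hcomm).idealι_idealMul]
  refine (convAlg_mul_app hE _ _ _ _ _ _ z).trans ?_
  change _ = ((A.idealι (a + b)).app (V.tensor W) ∘ₗ hE.starLin rfl _ _ _) z
  rw [hE.comp_starLin]
  have h1 : ∀ t : (E.obj a.2).obj W ⊗[k] (E.obj b.2).obj W,
      (A.mul (l := (a + b).1) (n := (a + b).2) rfl rfl).app (V.tensor W) (TensorProduct.map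
        (PolyFunctor.Hom.app (G := (A.obj a.1 a.2).param V)
          (((convAlg E hE A).idealι a).app V x) W)
        (PolyFunctor.Hom.app (G := (A.obj b.1 b.2).param V)
          (((convAlg E hE A).idealι b).app V y) W) t) =
      TensorProduct.lift ((TensorProduct.curry ((A.idealMul a b).app (V.tensor W))).compr₂
        ((A.idealι (a + b)).app (V.tensor W)))
        (TensorProduct.map (idealVal hE a V W x) (idealVal hE b V W y) t) := by
    intro t
    induction t using TensorProduct.induction_on with
    | zero => simp only [map_zero]
    | add x y hx hy => simp only [map_add, hx, hy]
    | tmul p q =>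
      rw [TensorProduct.map_tmul, TensorProduct.map_tmul, TensorProduct.lift.tmul,
        LinearMap.compr₂_apply, TensorProduct.curry_apply, hA.idealι_idealMul,
        ← idealι_idealConv, ← idealι_idealConv]
      rfl
  exact h1 _

/-- Multiplying adjacent letters corresponds to associativity: `x ⋆ (y ⋆ z) = (x ⋆ y) ⋆ z`, pushed
forward along the multiplication of `A'`. -/
theorem barVal_contract (hA : A.IsCdga) (hcomm : E.IsCommutative) (a : ℤ × ℕ)
    (x : ((convAlg E hE A).ideal a).obj V) : ∀ (t : List (ℤ × ℕ)) {m n : ℕ} (hm : wordWt t = m)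
    (h : a.2 + m = n) (z : ((convAlg E hE A).word t).obj V),
    barVal hE n V W (((convAlg E hE A).barContract a t).app V (x ⊗ₜ z)) =
      hE.starLin h (TensorProduct.curry ((A.barContract a t).app (V.tensor W)))
        (idealVal hE a V W x) (wordVal hE t hm V W z)
  | [], m, n, hm, h, z => by
    have e1 : ((convAlg E hE A).barContract a []).app V (x ⊗ₜ z) = 0 := rfl
    have e2 : TensorProduct.curry ((A.barContract a []).app (V.tensor W)) = 0 := rfl
    -- The zero bilinear map is written as `0 • 0`, so that linearity of the convolution in the
    -- bilinear map shows that it vanishes.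
    rw [e1, e2, map_zero, ← zero_smul k (0 : (A.ideal a).obj (V.tensor W) →ₗ[k] _),
      hE.starLin_smul, zero_smul]
  | b :: t, m, n, hm, h, z => by
    induction z using TensorProduct.induction_on with
    | zero => rw [TensorProduct.tmul_zero, map_zero, map_zero, map_zero, hE.starLin_zero_right]
    | add z₁ z₂ h₁ h₂ =>
      rw [TensorProduct.tmul_add, map_add, map_add, map_add, hE.starLin_add_right, h₁, h₂]
    | tmul y z =>
      rw [wordWt_cons] at hm
      have e1 : ((convAlg E hE A).barContract a (b :: t)).app V (x ⊗ₜ (y ⊗ₜ z)) =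
          ((convAlg E hE A).wordι ((a + b) :: t)).app V
            (((convAlg E hE A).idealMul a b).app V (x ⊗ₜ y) ⊗ₜ z) := rfl
      have hn : wordWt ((a + b) :: t) = n := by
        rw [wordWt_cons, Prod.snd_add]; omega
      have hn' : (a + b).2 + wordWt t = n := hn
      rw [e1, barVal_ι hE _ hn, wordVal_cons hE (a + b) t rfl hn hn', hE.comp_starLin,
        idealVal_idealMul hE hA hcomm, wordVal_cons hE b t rfl hm hm]
      exact hE.starLin_assoc _ _ _ _ fun _ _ _ => rfl

/-- Compatibility with the differential. -/
theorem barVal_wordDiff (hA : A.IsCdga) (hcomm : E.IsCommutative) : ∀ (t : List (ℤ × ℕ)) {n : ℕ}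
    (h : wordWt t = n) (z : ((convAlg E hE A).word t).obj V),
    barVal hE n V W (((convAlg E hE A).wordDiff t).app V z) =
      (A.wordDiff t).app (V.tensor W) ∘ₗ wordVal hE t h V W z
  | [], n, h, z => by
    have e1 : ((convAlg E hE A).wordDiff []).app V z = 0 := rfl
    have e2 : (A.wordDiff []).app (V.tensor W) = 0 := rfl
    rw [e1, e2, map_zero, LinearMap.zero_comp]
  | a :: t, n, h, z => by
    induction z using TensorProduct.induction_on with
    | zero => rw [map_zero, map_zero, map_zero, LinearMap.comp_zero]
    | add z₁ z₂ h₁ h₂ => rw [map_add, map_add, map_add, LinearMap.comp_add, h₁, h₂]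
    | tmul x z =>
      have h' : a.2 + wordWt t = n := h
      have ih := barVal_wordDiff hA hcomm t rfl z
      have e1 : ((convAlg E hE A).wordDiff (a :: t)).app V (x ⊗ₜ z) =
          -((convAlg E hE A).wordι ((a.1 - 1, a.2) :: t)).app V
            (((convAlg E hE A).idealDiff a).app V x ⊗ₜ z) +
          ksign k (a.1 + 1) • (convAlg E hE A).cons V a x
            (((convAlg E hE A).wordDiff t).app V z) +
          ksign k (a.1 + 1) • ((convAlg E hE A).barContract a t).app V (x ⊗ₜ z) := rfl
      -- The differential of `[x|z]`, as a bilinear map in `x` and `z`, splits into its three terms.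
      -- Convolution is linear in the bilinear map, so the terms can be matched one by one with
      -- those of `e1`.
      have e2 : (TensorProduct.mk k ((A.ideal a).obj (V.tensor W))
          ((A.word t).obj (V.tensor W))).compr₂ ((A.wordDiff (a :: t)).app (V.tensor W)) =
          (-1 : k) • (TensorProduct.mk k _ _).compr₂
            ((A.wordι ((a.1 - 1, a.2) :: t)).app (V.tensor W)) ∘ₗ
              (A.idealDiff a).app (V.tensor W) +
          ksign k (a.1 + 1) • (A.cons (V.tensor W) a).compl₂ ((A.wordDiff t).app (V.tensor W)) +
          ksign k (a.1 + 1) • TensorProduct.curry ((A.barContract a t).app (V.tensor W)) := by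
        apply LinearMap.ext₂
        intro x z
        simp only [LinearMap.add_apply, LinearMap.smul_apply, LinearMap.comp_apply,
          LinearMap.compr₂_apply, LinearMap.compl₂_apply, neg_smul, one_smul]
        rfl
      rw [e1, map_add, map_add, map_neg, map_smul, map_smul,
        barVal_ι hE ((a.1 - 1, a.2) :: t) h, wordVal_cons hE (a.1 - 1, a.2) t rfl h h',
        barVal_cons hE a h', ih, barVal_contract hE hA hcomm a x t rfl h',
        wordVal_cons hE a t rfl h h', hE.comp_starLin, hE.comp_starLin, e2, hE.starLin_add,
        hE.starLin_add, hE.starLin_smul, hE.starLin_smul, hE.starLin_smul, neg_smul, one_smul,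
        idealVal_idealDiff hE hA hcomm]
      congr 2
      · exact congrArg Neg.neg (hE.starLin_congr h' fun _ _ => rfl)
      · exact congrArg (ksign k (a.1 + 1) • ·) (hE.starLin_congr h' fun _ _ => rfl)

end PolyDga

/-! ### The comparison map is an isomorphism of augmented dg algebras. -/

namespace PolyDga

open PolyFunctor

variable {k : Type u} [CommRing k] {E : PolyAlgebra.{u, v} k} (hE : E.IsExponential)
  {A : PolyDga.{u, w} k} {V W : FGProj k}

theorem bar_ext {Q : Type*} [AddCommGroup Q] [Module k Q] {i : ℤ} {d : ℕ}
    {f g : (A.bar.obj i d).obj V →ₗ[k] Q}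
    (h : ∀ (t : WordIn i d) (z : (A.word t.1).obj V),
      f ((directSumι (fun t : WordIn i d => A.word t.1) t).app V z) =
        g ((directSumι (fun t : WordIn i d => A.word t.1) t).app V z)) : f = g :=
  DirectSum.linearMap_ext k fun t => LinearMap.ext (h t)

theorem barι_ι (i : ℤ) (d : ℕ) (t : WordIn i d) (z : (A.word t.1).obj V) :
    (A.barι i d).app V ((directSumι (fun t : WordIn i d => A.word t.1) t).app V z) =
      (A.wordι t.1).app V z := A.barIncl_ι i d t z

theorem barι_ext {Q : Type*} [AddCommGroup Q] [Module k Q] {i : ℤ} {d : ℕ}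
    {f g : A.barTotal.obj V →ₗ[k] Q}
    (h : ∀ t, wordDeg t = i → wordWt t = d → ∀ z, f ((A.wordι t).app V z) = g ((A.wordι t).app V z))
    (z : (A.bar.obj i d).obj V) : f ((A.barι i d).app V z) = g ((A.barι i d).app V z) := by
  refine barPart_ext (fun t z h1 h2 hz => ?_) (A.barι_mem i d z)
  obtain ⟨u, rfl⟩ := hz.exists_wordι
  exact h t h1 h2 u

/-- The values of `barConv`. -/
theorem barι_barConv (i : ℤ) (d : ℕ) (z : ((convAlg E hE A).bar.obj i d).obj V)
    (y : (E.obj d).obj W) :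
    (A.barι i d).app (V.tensor W) (PolyFunctor.Hom.app (G := (A.bar.obj i d).param V)
      ((barConv hE A i d).app V z) W y) =
      barVal hE d V W (((convAlg E hE A).barι i d).app V z) y := by
  let f : ((convAlg E hE A).bar.obj i d).obj V →ₗ[k] A.barTotal.obj (V.tensor W) :=
    (A.barι i d).app (V.tensor W) ∘ₗ
      evalHom (E.obj d) ((A.bar.obj i d).param V) W y ∘ₗ (barConv hE A i d).app V
  let g : ((convAlg E hE A).bar.obj i d).obj V →ₗ[k] A.barTotal.obj (V.tensor W) :=
    LinearMap.applyₗ y ∘ₗ barVal hE d V W ∘ₗ ((convAlg E hE A).barι i d).app V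
  refine LinearMap.congr_fun (f := f) (g := g) (bar_ext fun t z => ?_) z
  refine (congrArg (fun φ => (A.barι i d).app (V.tensor W)
    (PolyFunctor.Hom.app (G := (A.bar.obj i d).param V) φ W y)) (barConv_ι hE i d t z)).trans ?_
  refine (barι_ι (A := A) i d t _).trans ?_
  refine Eq.trans ?_ (congrArg (fun z => barVal hE d V W z y) (barι_ι i d t z)).symm
  dsimp only
  rw [barVal_ι hE t.1 t.2.2]
  rfl

theorem barVal_shuffleMul (hcomm : E.IsCommutative) {i j : ℤ} {d e n : ℕ} (h : d + e = n)
    (z : ((convAlg E hE A).bar.obj i d).obj V) (z' : ((convAlg E hE A).bar.obj j e).obj V) :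
    barVal hE n V W ((convAlg E hE A).shuffleMul V (((convAlg E hE A).barι i d).app V z)
      (((convAlg E hE A).barι j e).app V z')) =
      hE.starLin h (A.shuffleMul (V.tensor W))
        (barVal hE d V W (((convAlg E hE A).barι i d).app V z))
        (barVal hE e V W (((convAlg E hE A).barι j e).app V z')) := by
  -- Convolution packaged as a bilinear map in its two arguments, so that each variable can be
  -- reduced to a single word by linearity.
  let st : ((E.obj d).obj W →ₗ[k] A.barTotal.obj (V.tensor W)) →ₗ[k]
      ((E.obj e).obj W →ₗ[k] A.barTotal.obj (V.tensor W)) →ₗ[k]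
        ((E.obj n).obj W →ₗ[k] A.barTotal.obj (V.tensor W)) :=
    LinearMap.mk₂ k (fun p q => hE.starLin h (A.shuffleMul (V.tensor W)) p q)
      (fun p p' q => hE.starLin_add_left h _ p p' q)
      (fun c p q => by
        rw [PolyAlgebra.IsExponential.starLin, TensorProduct.map_smul_left, LinearMap.smul_comp,
          LinearMap.comp_smul]; rfl)
      (fun p q q' => hE.starLin_add_right h _ p q q')
      (fun c p q => by
        rw [PolyAlgebra.IsExponential.starLin, TensorProduct.map_smul_right, LinearMap.smul_comp,
          LinearMap.comp_smul]; rfl)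
  refine barι_ext (f := barVal hE n V W ∘ₗ ((convAlg E hE A).shuffleMul V).flip
      (((convAlg E hE A).barι j e).app V z'))
    (g := st.flip (barVal hE e V W (((convAlg E hE A).barι j e).app V z')) ∘ₗ barVal hE d V W)
    (fun s _ hs z => ?_) z
  refine barι_ext (f := barVal hE n V W ∘ₗ (convAlg E hE A).shuffleMul V
      (((convAlg E hE A).wordι s).app V z))
    (g := st (barVal hE d V W (((convAlg E hE A).wordι s).app V z)) ∘ₗ barVal hE e V W)
    (fun t _ ht z' => ?_) z'
  rw [LinearMap.comp_apply, LinearMap.comp_apply, shuffleMul_wordι,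
    barVal_shuffle hE hcomm s t hs ht h]
  change _ = hE.starLin h (A.shuffleMul (V.tensor W)) _ _
  rw [barVal_ι hE s hs, barVal_ι hE t ht]
  exact hE.starLin_congr h fun x y => (A.shuffleMul_wordι s t _ _).symm

theorem barVal_barDiffTotal (hA : A.IsCdga) (hcomm : E.IsCommutative) {i : ℤ} {d : ℕ}
    (z : ((convAlg E hE A).bar.obj i d).obj V) (y : (E.obj d).obj W) :
    barVal hE d V W ((convAlg E hE A).barDiffTotal.app V (((convAlg E hE A).barι i d).app V z)) y =
      A.barDiffTotal.app (V.tensor W)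
        (barVal hE d V W (((convAlg E hE A).barι i d).app V z) y) := by
  refine barι_ext
    (f := LinearMap.applyₗ y ∘ₗ barVal hE d V W ∘ₗ (convAlg E hE A).barDiffTotal.app V)
    (g := A.barDiffTotal.app (V.tensor W) ∘ₗ LinearMap.applyₗ y ∘ₗ barVal hE d V W)
    (fun t _ ht z => ?_) z
  simp only [LinearMap.comp_apply, LinearMap.applyₗ_apply_apply]
  have h : (convAlg E hE A).barDiffTotal.app V (((convAlg E hE A).wordι t).app V z) =
    ((convAlg E hE A).wordDiff t).app V z := directSumDesc_ι _ _ _ _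
  rw [h, barVal_wordDiff hE hA hcomm t ht, barVal_ι hE t ht]
  exact (directSumDesc_ι A.wordDiff t _ _).symm

theorem barConv_mul (hcomm : E.IsCommutative) {i j l : ℤ} {d e n : ℕ} (hi : i + j = l)
    (hd : d + e = n) (V : FGProj k) (x : ((convAlg E hE A).bar.obj i d).obj V)
    (y : ((convAlg E hE A).bar.obj j e).obj V) :
    (barConv hE A l n).app V (((convAlg E hE A).bar.mul hi hd).app V (x ⊗ₜ y)) =
      ((convAlg E hE A.bar).mul hi hd).app V
        ((barConv hE A i d).app V x ⊗ₜ (barConv hE A j e).app V y) := by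
  apply convAlg_ext hE (A := A.bar)
  intro W z
  apply A.barι_injective l n
  rw [barι_barConv, barι_mul, barVal_shuffleMul hE hcomm hd, convAlg_mul_app]
  have h : ∀ t : (E.obj d).obj W ⊗[k] (E.obj e).obj W,
      TensorProduct.lift (A.shuffleMul (V.tensor W)) (TensorProduct.map
        (barVal hE d V W (((convAlg E hE A).barι i d).app V x))
        (barVal hE e V W (((convAlg E hE A).barι j e).app V y)) t) =
      (A.barι l n).app (V.tensor W) ((A.bar.mul hi hd).app (V.tensor W) (TensorProduct.map
        (PolyFunctor.Hom.app (G := (A.bar.obj i d).param V) ((barConv hE A i d).app V x) W)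
        (PolyFunctor.Hom.app (G := (A.bar.obj j e).param V) ((barConv hE A j e).app V y) W)
        t)) := by
    intro t
    induction t using TensorProduct.induction_on with
    | zero => simp only [map_zero]
    | add x y hx hy => simp only [map_add, hx, hy]
    | tmul p q =>
      rw [TensorProduct.map_tmul, TensorProduct.map_tmul, TensorProduct.lift.tmul, barι_mul,
        barι_barConv, barι_barConv]
  exact h _

theorem barConv_diff (hA : A.IsCdga) (hcomm : E.IsCommutative) {i j : ℤ} (h : j + 1 = i) (d : ℕ)
    (V : FGProj k) (x : ((convAlg E hE A).bar.obj i d).obj V) :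
    (barConv hE A j d).app V (((convAlg E hE A).bar.diff h d).app V x) =
      ((convAlg E hE A.bar).diff h d).app V ((barConv hE A i d).app V x) := by
  apply convAlg_ext hE (A := A.bar)
  intro W z
  apply A.barι_injective j d
  rw [barι_barConv, barι_diff, convAlg_diff_app, barι_diff, barι_barConv,
    barVal_barDiffTotal hE hA hcomm]

theorem barConv_unit (V : FGProj k) (c : k) :
    (barConv hE A 0 0).app V ((convAlg E hE A).bar.unit.app V c) =
      (convAlg E hE A.bar).unit.app V c := by
  have h : (barConv hE A 0 0).app V ((convAlg E hE A).bar.unit.app V (1 : k)) =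
      (convAlg E hE A.bar).unit.app V (1 : k) := by
    apply convAlg_ext hE (A := A.bar)
    intro W z
    apply A.barι_injective 0 0
    rw [barι_barConv, barι_unit, convAlg_unit_app, barNil, barVal_ι hE [] wordWt_nil,
      LinearMap.comp_apply, wordVal_nil_apply]
    have h1 : A.bar.unit.app (V.tensor W) ((E.counit hE).app W z) =
        ((E.counit hE).app W z : k) • A.bar.unit.app (V.tensor W) (1 : k) := by
      rw [← map_smul, smul_eq_mul, _root_.mul_one]
    rw [h1, map_smul, barι_unit, barNil, ← map_smul]
    refine congrArg _ (congrArg ULift.up ?_)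
    exact mul_comm _ _
  have h2 := congrArg (fun z => (c : k) • z) h
  dsimp only at h2
  rw [← map_smul, ← map_smul, ← map_smul] at h2
  have h3 : (c : k) • (1 : k) = c := _root_.mul_one c
  rw [h3] at h2
  exact h2

theorem nilCoeff_wordι_nil (c : (A.word []).obj V) :
    A.nilCoeff V ((A.wordι []).app V c) = c.down :=
  congrArg ((constDown k).app V) (A.directSumπ_nil V c)

theorem nilCoeff_wordι_cons (a : ℤ × ℕ) (t : List (ℤ × ℕ)) (z : (A.word (a :: t)).obj V) :
    A.nilCoeff V ((A.wordι (a :: t)).app V z) = 0 := by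
  refine A.wordι_ext (A.nilCoeff V) 0 (a :: t) (fun z hz => ?_) z
  cases hz with
  | cons _ x _ => exact A.nilCoeff_cons a x _

/-- Both augmentations read off the coefficient of the empty word. Longer words contribute zero, and
on the empty word the factor introduced by the comparison is the counit at the unit, which is `1`.
-/
theorem barConv_aug (V : FGProj k) (x : ((convAlg E hE A).bar.obj 0 0).obj V) :
    (convAlg E hE A.bar).aug.app V ((barConv hE A 0 0).app V x) =
      (convAlg E hE A).bar.aug.app V x := by
  have h1 : A.bar.aug.app (V.tensor (FGProj.unit k)) (PolyFunctor.Hom.app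
      (G := (A.bar.obj 0 0).param V) ((barConv hE A 0 0).app V x) (FGProj.unit k)
        (E.unit.app (FGProj.unit k) (1 : k))) =
      A.nilCoeff _ (barVal hE 0 V (FGProj.unit k) (((convAlg E hE A).barι 0 0).app V x)
        (E.unit.app (FGProj.unit k) (1 : k))) := by
    rw [← barι_barConv]
    rfl
  rw [convAlg_aug_app, h1]
  refine barι_ext
    (f := A.nilCoeff _ ∘ₗ LinearMap.applyₗ (E.unit.app (FGProj.unit k) (1 : k)) ∘ₗ
      barVal hE 0 V (FGProj.unit k))
    (g := (convAlg E hE A).nilCoeff V) (fun t _ ht z => ?_) x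
  simp only [LinearMap.comp_apply, LinearMap.applyₗ_apply_apply]
  rw [barVal_ι hE t ht, LinearMap.comp_apply]
  cases t with
  | nil =>
    rw [wordVal_nil_apply, PolyAlgebra.counit_unit, nilCoeff_wordι_nil, nilCoeff_wordι_nil]
    exact _root_.mul_one _
  | cons a t =>
    exact (nilCoeff_wordι_cons a t _).trans (nilCoeff_wordι_cons a t _).symm

/-- The interchange isomorphism. -/
def interchange (hA : A.IsCdga) (hcomm : E.IsCommutative) (hp : A.HasProjectiveValues)
    (hH : (convAlg E hE A).HasProjectiveValues) :
    Iso (convAlg E hE A.bar) (convAlg E hE A).bar :=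
  have hl : ∀ i d V x, (homInv (barConv hE A i d) (barConv_bijective hE hp hH i d)).app V
      ((barConv hE A i d).app V x) = x := fun i d V x =>
    (LinearEquiv.ofBijective _ (barConv_bijective hE hp hH i d V)).symm_apply_apply x
  have hr : ∀ i d V x, (barConv hE A i d).app V
      ((homInv (barConv hE A i d) (barConv_bijective hE hp hH i d)).app V x) = x := fun i d V x =>
    (LinearEquiv.ofBijective _ (barConv_bijective hE hp hH i d V)).apply_symm_apply x
  -- The inverse of `barConv` inherits each compatibility, by injectivity of `barConv`.
  { toHom :=
      { hom := fun i d => homInv (barConv hE A i d) (barConv_bijective hE hp hH i d)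
        map_unit := fun V c => by rw [← barConv_unit, hl]
        map_mul := fun hi hd V x y => by
          apply (barConv_bijective hE hp hH _ _ V).1
          rw [barConv_mul hE hcomm, hr, hr, hr]
        map_diff := fun h d V x => by
          apply (barConv_bijective hE hp hH _ _ V).1
          rw [barConv_diff hE hA hcomm, hr, hr]
        map_aug := fun V x => by rw [← barConv_aug hE, hr] }
    invHom :=
      { hom := barConv hE A
        map_unit := barConv_unit hE
        map_mul := barConv_mul hE hcomm
        map_diff := barConv_diff hE hA hcomm
        map_aug := barConv_aug hE }
    inv_hom := hr
    hom_inv := hl }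

end PolyDga

/-! ### Naturality in the algebra. -/

namespace PolyDga

open PolyFunctor

variable {k : Type u} [CommRing k] {E : PolyAlgebra.{u, v} k} (hE : E.IsExponential)
  {A B : PolyDga.{u, w} k} {V W : FGProj k}

theorem Hom.augAt_hom (g : Hom A B) (i : ℤ) (d : ℕ) (x : (A.obj i d).obj V) :
    (B.augAt i d).app V ((g.hom i d).app V x) = (A.augAt i d).app V x := by
  by_cases h : i = 0 ∧ d = 0
  · obtain ⟨rfl, rfl⟩ := h
    exact g.map_aug V x
  · rw [A.augAt_of_ne V h, B.augAt_of_ne V h]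

theorem Hom.idealι_idealMap (g : Hom A B) (a : ℤ × ℕ) (x : (A.ideal a).obj V) :
    (B.idealι a).app V ((idealMap g.hom a).app V x) =
      (g.hom a.1 a.2).app V ((A.idealι a).app V x) := by
  apply B.idealι_idealπ_of_augAt
  exact (g.augAt_hom a.1 a.2 _).trans (A.augAt_idealι V a x)

/-- `convMap` is a mere family of morphisms, not a morphism of algebras, so that it preserves the
augmentation ideal is checked on all values, by `augAt_app_eq_zero`. -/
theorem Hom.idealι_idealMap_convMap (g : Hom A B) (a : ℤ × ℕ)
    (x : ((convAlg E hE A).ideal a).obj V) :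
    ((convAlg E hE B).idealι a).app V ((idealMap (convMap E hE g.hom) a).app V x) =
      (convMap E hE g.hom a.1 a.2).app V (((convAlg E hE A).idealι a).app V x) := by
  apply (convAlg E hE B).idealι_idealπ_of_augAt
  rw [augAt_app_eq_zero]
  intro W y
  exact (g.augAt_hom a.1 a.2 _).trans
    ((augAt_app_eq_zero hE a.1 a.2 _).1 ((convAlg E hE A).augAt_idealι V a x) W y)

theorem idealVal_idealMap (g : Hom A B) (a : ℤ × ℕ) (x : ((convAlg E hE A).ideal a).obj V) :
    idealVal hE a V W ((idealMap (convMap E hE g.hom) a).app V x) =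
      (idealMap g.hom a).app (V.tensor W) ∘ₗ idealVal hE a V W x := by
  refine LinearMap.ext fun y => B.idealι_injective (V.tensor W) a ?_
  refine (idealι_idealConv hE (A := B) a _ W y).trans ?_
  rw [g.idealι_idealMap_convMap hE, LinearMap.comp_apply, g.idealι_idealMap]
  exact congrArg ((g.hom a.1 a.2).app (V.tensor W)) (idealι_idealConv hE a x W y).symm

theorem wordVal_wordMap (g : Hom A B) : ∀ (t : List (ℤ × ℕ)) {n : ℕ} (h : wordWt t = n)
    (z : ((convAlg E hE A).word t).obj V),
    wordVal hE t h V W ((wordMap (convMap E hE g.hom) t).app V z) =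
      (wordMap g.hom t).app (V.tensor W) ∘ₗ wordVal hE t h V W z
  | [], _, rfl, z => rfl
  | a :: t, n, h, z => by
    induction z using TensorProduct.induction_on with
    | zero => rw [map_zero, map_zero, map_zero, LinearMap.comp_zero]
    | add z₁ z₂ h₁ h₂ => rw [map_add, map_add, map_add, LinearMap.comp_add, h₁, h₂]
    | tmul x z =>
      have h' : a.2 + wordWt t = n := h
      have e : (wordMap (convMap E hE g.hom) (a :: t)).app V (x ⊗ₜ z) =
        (idealMap (convMap E hE g.hom) a).app V x ⊗ₜ
          (wordMap (convMap E hE g.hom) t).app V z := rfl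
      rw [e, wordVal_cons hE a t rfl h h', wordVal_cons hE a t rfl h h', idealVal_idealMap,
        wordVal_wordMap g t, hE.comp_starLin]
      exact hE.starLin_congr h' fun _ _ => rfl

theorem barMap_ι (g : ∀ i d, PolyFunctor.Hom (A.obj i d) (B.obj i d)) (i : ℤ) (d : ℕ)
    (t : WordIn i d) (z : (A.word t.1).obj V) :
    (barMap g i d).app V ((directSumι (fun t : WordIn i d => A.word t.1) t).app V z) =
      (directSumι (fun t : WordIn i d => B.word t.1) t).app V ((wordMap g t.1).app V z) :=
  directSumDesc_ι (F := fun t : WordIn i d => A.word t.1) _ t V z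

/-- On words this says that convolution commutes with applying `g` to every letter, which is
`wordVal_wordMap`. -/
theorem barConv_barMap (g : Hom A B) (i : ℤ) (d : ℕ) (V : FGProj k)
    (z : ((convAlg E hE A).bar.obj i d).obj V) :
    (barConv hE B i d).app V ((barMap (convMap E hE g.hom) i d).app V z) =
      (convMap E hE (barMap g.hom) i d).app V ((barConv hE A i d).app V z) := by
  refine LinearMap.congr_fun
    (f := (barConv hE B i d).app V ∘ₗ (barMap (convMap E hE g.hom) i d).app V)
    (g := (convMap E hE (barMap g.hom) i d).app V ∘ₗ (barConv hE A i d).app V)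
    (bar_ext fun t z => ?_) z
  refine (congrArg ((barConv hE B i d).app V) (barMap_ι (convMap E hE g.hom) i d t z)).trans ?_
  refine (barConv_ι hE i d t _).trans ?_
  refine Eq.trans ?_
    (congrArg ((convMap E hE (barMap g.hom) i d).app V) (barConv_ι hE i d t z)).symm
  refine PolyFunctor.Hom.ext (G := (B.bar.obj i d).param V) fun W y => ?_
  refine Eq.trans ?_ (barMap_ι g.hom i d t (wordVal hE t.1 t.2.2 V W z y)).symm
  exact congrArg ((directSumι (fun t : WordIn i d => B.word t.1) t).app (V.tensor W))
    (LinearMap.congr_fun (wordVal_wordMap hE g t.1 t.2.2 z) y)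

end PolyDga

end

/-! ### The interchange property. -/

theorem mainTheorem2 (k : Type u) [CommRing k] (E : PolyAlgebra.{u, v} k)
    (hE : E.IsExponential) (hcomm : E.IsCommutative) :
    (∀ A : PolyDga.{u, w} k, A.IsCdga → A.HasProjectiveValues →
      (PolyDga.convAlg E hE A).HasProjectiveValues →
        (PolyDga.convAlg E hE (PolyDga.bar A)).IsCdga ∧
          (PolyDga.bar (PolyDga.convAlg E hE A)).IsCdga) ∧
    ∃ θ : ∀ A : PolyDga.{u, w} k, A.IsCdga → A.HasProjectiveValues →
        (PolyDga.convAlg E hE A).HasProjectiveValues →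
          PolyDga.Iso (PolyDga.convAlg E hE (PolyDga.bar A))
            (PolyDga.bar (PolyDga.convAlg E hE A)),
      ∀ (A B : PolyDga.{u, w} k) (hA : A.IsCdga) (hB : B.IsCdga)
        (hpA : A.HasProjectiveValues) (hpB : B.HasProjectiveValues)
        (hHA : (PolyDga.convAlg E hE A).HasProjectiveValues)
        (hHB : (PolyDga.convAlg E hE B).HasProjectiveValues)
        (g : PolyDga.Hom A B) (i : ℤ) (d : ℕ) (V : FGProj k)
        (x : ((PolyDga.convAlg E hE (PolyDga.bar A)).obj i d).obj V),
        ((θ B hB hpB hHB).toHom.hom i d).app V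
            ((PolyDga.convMap E hE (PolyDga.barMap g.hom) i d).app V x) =
          (PolyDga.barMap (PolyDga.convMap E hE g.hom) i d).app V
            (((θ A hA hpA hHA).toHom.hom i d).app V x) := by
  refine ⟨fun A hA _ _ => ⟨hA.bar.convAlg hE hcomm, (hA.convAlg hE hcomm).bar⟩,
    fun A hA hp hH => PolyDga.interchange hE hA hcomm hp hH, ?_⟩
  intro A B hA hB hpA hpB hHA hHB g i d V x
  -- Since the isomorphism is inverse to `barConv`, applying the injective `barConv` of `B` turns
  -- its naturality into that of `barConv`.
  apply (PolyDga.barConv_bijective hE hpB hHB i d V).1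
  rw [PolyDga.barConv_barMap]
  refine ((PolyDga.interchange hE hB hcomm hpB hHB).inv_hom i d V _).trans ?_
  exact congrArg _ ((PolyDga.interchange hE hA hcomm hpA hHA).inv_hom i d V x).symm
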